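/- **Setting.** Let $\mathcal{DL}$ be a description logic. Its concepts are built from concept names with the constructors of $\mathcal{ALC}$ and possibly further constructors with set-theoretic semantics, and its grammar says which concepts may occur on the left-hand side of inclusions, on their right-hand side, and in assertions. The grammar admits concept names and is invariant under renaming of concept names. A classical knowledge base is a finite set of inclusions $C\sqsubseteq D$, assertions $C(a)$, $R(a,b)$ and possibly further axioms without concepts, such as role inclusions. *Subsumption (resp. instance) checking in $\mathcal{DL}$* is the problem of deciding $\mathcal S\models C\sqsubseteq D$ (resp. $\mathcal S\models C(a)$), given a $\mathcal{DL}$ knowledge base $\mathcal S$ and a $\mathcal{DL}$ query. The defeasible extension $\mathcal{DL}^{\mathrm N}$ has a new concept name $\mathrm NC$ for each $\mathcal{DL}$ concept $C$ (such that $\mathrm NC\sqsubseteq C$ is syntactically an inclusion of $\mathcal{DL}$). A $\mathcal{DL}^{\mathrm N}$ knowledge base $\mathcal{KB}=\mathcal S\cup\mathcal D$ consists of a $\mathcal{DL}$ knowledge base $\mathcal S$ and a finite set $\mathcal D$ of defeasible inclusions $\delta=(\mathrm{pre}(\delta)\sqsubseteq_n\mathrm{con}(\delta))$ between $\mathcal{DL}^{\mathrm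 N}$ concepts; it may carry additional data (e.g. time stamps) on which priorities may depend. A priority relation $\prec$ assigns to every $\mathcal{KB}$ a strict partial order on $\mathcal D$, where $\delta\prec\delta'$ means that $\delta$ has the higher priority; deciding $\prec$ means deciding $\delta\prec\delta'$, given $\mathcal{KB}$ and $\delta,\delta'\in\mathcal D$. For a query $\alpha$ (an inclusion or a concept assertion of $\mathcal{DL}^{\mathrm N}$) let $\Sigma$ be the set of all $\mathrm NC$ that occur in $\mathcal{KB}$ or in $\alpha$, let $\delta^{\mathrm NC}$ be the axiom $\mathrm NC\sqcap\mathrm{pre}(\delta)\sqsubseteq\mathrm{con}(\delta)$, let $$\mathcal S'\!\downarrow_{\prec\delta}\;=\;\mathcal S'\setminus\{\delta_0^{\mathrm NC}\mid \delta_0\in\mathcal D,\ \mathrm NC\in\Sigma,\ \delta_0\not\prec\delta\},$$ and let $\delta_1,\dots,\delta_m$ be an arbitrary enumeration of $\mathcal D$ without repetitions such that $\delta_i\prec\delta_j$ implies $i<j$. Put $$\mathcal S_0^\Sigma=\mathcal S\cup\{\mathrm NC\sqsubseteq C\mid \mathrm NC\in\Sigma\},$$ $$\mathcal S_i^\Sigma=\mathcal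 S_{i-1}^\Sigma\cup\{\delta_i^{\mathrm NC}\mid \mathrm NC\in\Sigma,\ \mathcal S_{i-1}^\Sigma\!\downarrow_{\prec\delta_i}\cup\,\{\delta_i^{\mathrm NC}\}\not\models \mathrm NC\sqsubseteq\bot\},$$ and $\mathcal{KB}^\Sigma=\mathcal S_m^\Sigma$. By definition, $\alpha$ follows from $\mathcal{KB}$ in $\mathcal{DL}^{\mathrm N}$ iff $\mathcal{KB}^\Sigma\models\alpha$. *Subsumption (resp. instance) checking in $\mathcal{DL}^{\mathrm N}$* is the problem of deciding whether a given inclusion (resp. concept assertion) follows from a given $\mathcal{KB}$. Let $\mathrm P^{\mathcal C}=\bigcup_{A\in\mathcal C}\mathrm P^{A}$, where $\mathrm P^A$ is the class of languages decided in polynomial time by deterministic Turing machines with oracle $A$. All decision problems are posed for well-formed inputs: a problem is in a class if some language of the class contains the encodings of its positive instances and not those of its negative instances. **Theorem.** Let $\mathcal C$ be a class of languages such that any two members of $\mathcal C$ are polynomial-time Turing reducible to a single member of $\mathcal C$ (as is the case for every class that has a complete problem or is closed under disjoint unions). Suppose that subsumption (resp. instance) checking in $\mathcal{DL}$ is in $\mathcal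 C$ and that deciding $\prec$ is in $\mathrm P^{\mathcal C}$. If $\mathcal{DL}$ supports $\sqcap$ on the left-hand side of inclusions, then subsumption (resp. instance) checking in $\mathcal{DL}^{\mathrm N}$ is in $\mathrm P^{\mathcal C}$. In particular (since $\mathrm P^{\mathrm P}=\mathrm P$), if subsumption (resp. instance) checking in $\mathcal{DL}$ and deciding $\prec$ are in $\mathrm P$, then so is subsumption (resp. instance) checking in $\mathcal{DL}^{\mathrm N}$. -/

import Mathlib

/-! Oracle Turing machines and relativized polynomial time -/

namespace OracleTime

open Turing

/-- A deterministic oracle Turing machine: a finite-control multi-stack machine (`Turing.TM2`,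
the model on which Mathlib bases polynomial-time computability) in which a label either executes
a `TM2` statement or asks the oracle. All alphabets, label sets and state sets are finite. -/
structure OracleTM where
  /-- index set of the stacks -/
  K : Type
  [decK : DecidableEq K]
  [finK : Fintype K]
  /-- stack alphabets -/
  Γ : K → Type
  [finΓ : ∀ k, Fintype (Γ k)]
  /-- labels -/
  Λ : Type
  [finΛ : Fintype Λ]
  /-- internal states -/
  σ : Type
  [finσ : Fintype σ]
  /-- the input stack, and the letters in which the input is written on it -/
  inStack : K
  inSym : Bool → Γ inStack
  /-- the query stack, and how its letters are read by the oracle -/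
  qStack : K
  qSym : Γ qStack → Bool
  /-- start label, start state, accepting states -/
  main : Λ
  start : σ
  accept : σ → Bool
  /-- the program: a label holds a statement, or an oracle query with the two labels
  at which the computation continues on a positive resp. negative answer -/
  code : Λ → TM2.Stmt Γ Λ σ ⊕ (Bool → Λ)

attribute [instance] OracleTM.decK OracleTM.finK OracleTM.finΓ OracleTM.finΛ OracleTM.finσ

namespace OracleTM

variable (M : OracleTM)

/-- Configurations. -/
abbrev Cfg : Type := TM2.Cfg M.Γ M.Λ M.σ

/-- The initial configuration on input `w`. -/
def init (w : List Bool) : M.Cfg where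
  l := some M.main
  var := M.start
  stk := Function.update (fun _ => []) M.inStack (w.map M.inSym)

open Classical in
/-- One step with oracle `O`; a halted configuration stays as it is. A query takes one step:
the word on the query stack is submitted and erased. -/
noncomputable def step (O : Language Bool) : M.Cfg → M.Cfg
  | ⟨none, v, S⟩ => ⟨none, v, S⟩
  | ⟨some l, v, S⟩ =>
    match M.code l with
    | .inl q => TM2.stepAux q v S
    | .inr next =>
        ⟨some (next (decide ((S M.qStack).map M.qSym ∈ O))), v, Function.update S M.qStack []⟩

/-- The configuration reached from input `w` after `t` steps. -/
noncomputable def run (O : Language Bool) (w : List Bool) (t : ℕ) : M.Cfg :=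
  (M.step O)^[t] (M.init w)

end OracleTM

/-- `PRel O` is the class `P^O` of the languages decided in polynomial time by a deterministic
Turing machine with oracle `O`. -/
def PRel (O : Language Bool) : Set (Language Bool) :=
  {L | ∃ (M : OracleTM) (p : Polynomial ℕ), ∀ w : List Bool,
    (M.run O w (p.eval w.length)).l = none ∧
    (M.accept (M.run O w (p.eval w.length)).var = true ↔ w ∈ L)}

/-- `P^𝒞` for a class `𝒞` of languages. -/
def PClass (𝒞 : Set (Language Bool)) : Set (Language Bool) :=
  {L | ∃ O ∈ 𝒞, L ∈ PRel O}

/-- The class `P` (the oracle is empty). -/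
def PTime : Set (Language Bool) := PRel (0 : Language Bool)

/-- A decision problem, given by an encoding of its inputs, the set of its instances (the
well-formed inputs) and the set of its positive inputs, belongs to a class of languages. -/
def ProblemIn {α : Type} (𝒞 : Set (Language Bool)) (enc : α → List Bool)
    (isInstance yes : α → Prop) : Prop :=
  ∃ L ∈ 𝒞, ∀ x, isInstance x → (enc x ∈ L ↔ yes x)

end OracleTime

/-! Description logics -/

namespace DLN

/-- The number of arguments of each kind taken by a constructor. -/
structure Arity where
  concepts : ℕ
  roles : ℕ
  individuals : ℕ
  features : ℕ

/-- The constructors that a description logic may have beyond those of `ALC`: further concept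
constructors (nominals, number restrictions, inverse roles, concrete-domain predicates, ...) and
further axiom forms (role inclusions, disjointness of roles, ...), each with its arity, its
set-theoretic semantics over every domain, and its code as a bit string. `Feature Δ` is what a
concrete feature denotes over the domain `Δ`, for instance a partial function from `Δ` into a
concrete domain; logics without concrete domains make no use of it. -/
structure Constructors where
  Feature : Type → Type
  Op : Type
  opArity : Op → Arity
  opSem : (o : Op) → (Δ : Type) → (Fin (opArity o).concepts → Set Δ) →
    (Fin (opArity o).roles → Δ → Δ → Prop) → (Fin (opArity o).individuals → Δ) →
    (Fin (opArity o).features → Feature Δ) → Set Δ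
  opCode : Op → List Bool
  opCode_injective : Function.Injective opCode
  Ax : Type
  axArity : Ax → Arity
  axSem : (o : Ax) → (Δ : Type) → (Fin (axArity o).roles → Δ → Δ → Prop) →
    (Fin (axArity o).individuals → Δ) → (Fin (axArity o).features → Feature Δ) → Prop
  axCode : Ax → List Bool
  axCode_injective : Function.Injective axCode

variable {K : Constructors} {X Y : Type}

/-- Concepts over a set `X` of concept names; role, individual and feature names are numbers. -/
inductive Concept (K : Constructors) (X : Type) : Type
  | name (A : X)
  | top
  | bot
  | neg (C : Concept K X)
  | inter (C D : Concept K X)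
  | union (C D : Concept K X)
  | ex (R : ℕ) (C : Concept K X)
  | all (R : ℕ) (C : Concept K X)
  | ext (o : K.Op) (cs : Fin (K.opArity o).concepts → Concept K X)
      (rs : Fin (K.opArity o).roles → ℕ) (is : Fin (K.opArity o).individuals → ℕ)
      (fs : Fin (K.opArity o).features → ℕ)

/-- Axioms other than concept inclusions and concept assertions. No concepts occur in them. -/
inductive OtherAxiom (K : Constructors) : Type
  | roleAssertion (R a b : ℕ)
  | ext (o : K.Ax) (rs : Fin (K.axArity o).roles → ℕ)
      (is : Fin (K.axArity o).individuals → ℕ) (fs : Fin (K.axArity o).features → ℕ)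

/-- Axioms: concept inclusions `C ⊑ D`, concept assertions `C(a)`, and the others. -/
inductive Axm (K : Constructors) (X : Type) : Type
  | incl (C D : Concept K X)
  | assert (C : Concept K X) (a : ℕ)
  | other (o : OtherAxiom K)

/-- Renaming of concept names. -/
def Concept.map (f : X → Y) : Concept K X → Concept K Y
  | .name A => .name (f A)
  | .top => .top
  | .bot => .bot
  | .neg C => .neg (C.map f)
  | .inter C D => .inter (C.map f) (D.map f)
  | .union C D => .union (C.map f) (D.map f)
  | .ex R C => .ex R (C.map f)
  | .all R C => .all R (C.map f)
  | .ext o cs rs is fs => .ext o (fun i => (cs i).map f) rs is fs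

/-- Renaming of concept names. -/
def Axm.map (f : X → Y) : Axm K X → Axm K Y
  | .incl C D => .incl (C.map f) (D.map f)
  | .assert C a => .assert (C.map f) a
  | .other o => .other o

/-- The concept names occurring in a concept. -/
def Concept.names : Concept K X → Set X
  | .name A => {A}
  | .top => ∅
  | .bot => ∅
  | .neg C => C.names
  | .inter C D => C.names ∪ D.names
  | .union C D => C.names ∪ D.names
  | .ex _ C => C.names
  | .all _ C => C.names
  | .ext _ cs _ _ _ => ⋃ i, (cs i).names

/-- The concept names occurring in an axiom. -/
def Axm.names : Axm K X → Set X
  | .incl C D => C.names ∪ D.names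
  | .assert C _ => C.names
  | .other _ => ∅

/-- Interpretations. -/
structure Interp (K : Constructors) (X : Type) where
  Δ : Type
  [nonempty : Nonempty Δ]
  concept : X → Set Δ
  role : ℕ → Δ → Δ → Prop
  individual : ℕ → Δ
  feature : ℕ → K.Feature Δ

/-- The extension of a concept. -/
def Concept.sem (I : Interp K X) : Concept K X → Set I.Δ
  | .name A => I.concept A
  | .top => Set.univ
  | .bot => ∅
  | .neg C => (C.sem I)ᶜ
  | .inter C D => C.sem I ∩ D.sem I
  | .union C D => C.sem I ∪ D.sem I
  | .ex R C => {d | ∃ e, I.role R d e ∧ e ∈ C.sem I}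
  | .all R C => {d | ∀ e, I.role R d e → e ∈ C.sem I}
  | .ext o cs rs is fs => K.opSem o I.Δ (fun i => (cs i).sem I) (fun i => I.role (rs i))
      (fun i => I.individual (is i)) (fun i => I.feature (fs i))

/-- Truth of an axiom in an interpretation. -/
def Interp.Sat (I : Interp K X) : Axm K X → Prop
  | .incl C D => C.sem I ⊆ D.sem I
  | .assert C a => I.individual a ∈ C.sem I
  | .other (.roleAssertion R a b) => I.role R (I.individual a) (I.individual b)
  | .other (.ext o rs is fs) => K.axSem o I.Δ (fun i => I.role (rs i))
      (fun i => I.individual (is i)) (fun i => I.feature (fs i))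

/-- Classical entailment `S ⊨ α`. -/
def Entails (S : Set (Axm K X)) (α : Axm K X) : Prop :=
  ∀ I : Interp K X, (∀ β ∈ S, I.Sat β) → I.Sat α

/-- A description logic (fragment): which sets of other axioms are admitted, and which concepts
are admitted in knowledge bases with the set `O` of other axioms, on the left-hand side of
inclusions, on their right-hand side, and in assertions. (The dependence on `O` accounts for
conditions such as the simplicity of the roles in number restrictions.) The grammar refers to
concept names as atoms only: it is given over every set `X` of concept names, invariantly under
renaming, and it admits the concept names themselves. -/
structure Fragment (K : Constructors) where
  adm : Set (Set (OtherAxiom K))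
  lhs : Set (OtherAxiom K) → (X : Type) → Set (Concept K X)
  rhs : Set (OtherAxiom K) → (X : Type) → Set (Concept K X)
  asr : Set (OtherAxiom K) → (X : Type) → Set (Concept K X)
  map_mem_lhs : ∀ (O : Set (OtherAxiom K)) (X Y : Type) (f : X → Y), Function.Injective f →
    ∀ C : Concept K X, C.map f ∈ lhs O Y ↔ C ∈ lhs O X
  map_mem_rhs : ∀ (O : Set (OtherAxiom K)) (X Y : Type) (f : X → Y), Function.Injective f →
    ∀ C : Concept K X, C.map f ∈ rhs O Y ↔ C ∈ rhs O X
  map_mem_asr : ∀ (O : Set (OtherAxiom K)) (X Y : Type) (f : X → Y), Function.Injective f →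
    ∀ C : Concept K X, C.map f ∈ asr O Y ↔ C ∈ asr O X
  name_mem_lhs : ∀ (O : Set (OtherAxiom K)) (X : Type) (A : X), Concept.name A ∈ lhs O X
  name_mem_rhs : ∀ (O : Set (OtherAxiom K)) (X : Type) (A : X), Concept.name A ∈ rhs O X
  name_mem_asr : ∀ (O : Set (OtherAxiom K)) (X : Type), (asr O X).Nonempty →
    ∀ A : X, Concept.name A ∈ asr O X

/-- The set of other axioms of a finite knowledge base. -/
def others (S : List (Axm K X)) : Set (OtherAxiom K) := {o | Axm.other o ∈ S}

/-- The finite knowledge base `S` (given as a list) belongs to the description logic. -/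
structure Fragment.IsKB (F : Fragment K) (S : List (Axm K X)) : Prop where
  others_mem : others S ∈ F.adm
  incl_mem : ∀ C D, Axm.incl C D ∈ S → C ∈ F.lhs (others S) X ∧ D ∈ F.rhs (others S) X
  assert_mem : ∀ C a, Axm.assert C a ∈ S → C ∈ F.asr (others S) X

/-- The description logic supports `⊓` in the left-hand side of inclusions. -/
def Fragment.SupportsConj (F : Fragment K) : Prop :=
  ∀ O ∈ F.adm, ∀ (X : Type), ∀ C ∈ F.lhs O X, ∀ D ∈ F.lhs O X, Concept.inter C D ∈ F.lhs O X

/-! The defeasible extension -/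

/-- The concept names of the defeasible extension: the concept names of the description logic
(numbers), and a new concept name `N C` for every concept `C` of the description logic. -/
abbrev NName (K : Constructors) : Type := ℕ ⊕ Concept K ℕ

/-- The concept name `N C`, as a concept. -/
def normal (C : Concept K ℕ) : Concept K (NName K) := .name (.inr C)

/-- Defeasible inclusions `pre ⊑ₙ con`. -/
structure DI (K : Constructors) where
  pre : Concept K (NName K)
  con : Concept K (NName K)

/-- Defeasible knowledge bases: a finite set of strong axioms without normality concepts, a finite
set of defeasible inclusions, and possibly further data (time stamps, a priority table, ...) which
have no influence on the semantics except that priorities may depend on them. -/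
structure DKB (K : Constructors) where
  strong : List (Axm K ℕ)
  dis : List (DI K)
  info : List Bool

/-- All normality concepts occurring in `C` are formed from concepts admitted on the right-hand
side of inclusions (so that `N C ⊑ C` is an inclusion of the description logic). -/
def Fragment.NormalOK (F : Fragment K) (O : Set (OtherAxiom K)) (C : Concept K (NName K)) : Prop :=
  ∀ E, Sum.inr E ∈ C.names → E ∈ F.rhs O ℕ

/-- The knowledge base belongs to the defeasible extension of the description logic. -/
structure Fragment.IsDKB (F : Fragment K) (kb : DKB K) : Prop where
  strong_isKB : F.IsKB kb.strong
  pre_mem : ∀ δ ∈ kb.dis, δ.pre ∈ F.lhs (others kb.strong) (NName K) ∧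
    F.NormalOK (others kb.strong) δ.pre
  con_mem : ∀ δ ∈ kb.dis, δ.con ∈ F.rhs (others kb.strong) (NName K) ∧
    F.NormalOK (others kb.strong) δ.con

/-- A priority relation, depending on the knowledge base: `prec kb δ₁ δ₂` says that `δ₁` has
higher priority than `δ₂`. -/
abbrev Priority (K : Constructors) : Type := DKB K → DI K → DI K → Prop

/-- `≺` is a strict partial order on the defeasible inclusions of every knowledge base. -/
structure Priority.IsStrictPartialOrder (prec : Priority K) (F : Fragment K) : Prop where
  irrefl : ∀ kb, F.IsDKB kb → ∀ δ ∈ kb.dis, ¬ prec kb δ δ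
  trans : ∀ kb, F.IsDKB kb → ∀ δ₁ ∈ kb.dis, ∀ δ₂ ∈ kb.dis, ∀ δ₃ ∈ kb.dis,
    prec kb δ₁ δ₂ → prec kb δ₂ δ₃ → prec kb δ₁ δ₃

/-- `Σ`: the (arguments of the) normality concepts occurring in `kb` or in the query `α`. -/
def sigma (kb : DKB K) (α : Axm K (NName K)) : Set (Concept K ℕ) :=
  {C | (∃ δ ∈ kb.dis, Sum.inr C ∈ δ.pre.names ∪ δ.con.names) ∨ Sum.inr C ∈ α.names}

/-- The axiom `N C ⊓ pre δ ⊑ con δ`. -/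
def DI.inst (δ : DI K) (C : Concept K ℕ) : Axm K (NName K) :=
  .incl (.inter (normal C) δ.pre) δ.con

/-- `S` without the axioms `δ₀^(N C)`, `N C ∈ Sg`, such that `δ₀ ⊀ δ`. -/
def restrict (prec : Priority K) (kb : DKB K) (Sg : Set (Concept K ℕ)) (S : Set (Axm K (NName K)))
    (δ : DI K) : Set (Axm K (NName K)) :=
  S \ {β | ∃ δ₀ ∈ kb.dis, ∃ C ∈ Sg, ¬ prec kb δ₀ δ ∧ β = δ₀.inst C}

/-- The strong axioms together with `N C ⊑ C` for all `N C ∈ Sg`. -/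
def stageZero (kb : DKB K) (Sg : Set (Concept K ℕ)) : Set (Axm K (NName K)) :=
  {β | ∃ γ ∈ kb.strong, β = γ.map Sum.inl} ∪
  {β | ∃ C ∈ Sg, β = .incl (normal C) (C.map Sum.inl)}

/-- One step of the construction: `δ^(N C)` is added for those `N C ∈ Sg` whose consistency is
preserved. -/
def stageNext (prec : Priority K) (kb : DKB K) (Sg : Set (Concept K ℕ))
    (S : Set (Axm K (NName K))) (δ : DI K) : Set (Axm K (NName K)) :=
  S ∪ {β | ∃ C ∈ Sg, β = δ.inst C ∧
    ¬ Entails (restrict prec kb Sg S δ ∪ {δ.inst C}) (.incl (normal C) .bot)}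

/-- `KB^Σ`, for the enumeration `l` of the defeasible inclusions. -/
def kbSigma (prec : Priority K) (kb : DKB K) (Sg : Set (Concept K ℕ)) (l : List (DI K)) :
    Set (Axm K (NName K)) :=
  l.foldl (stageNext prec kb Sg) (stageZero kb Sg)

/-- `l` enumerates the defeasible inclusions without repetitions, and `δᵢ ≺ δⱼ` implies
`i < j`. -/
structure IsLinearization (prec : Priority K) (kb : DKB K) (l : List (DI K)) : Prop where
  nodup : l.Nodup
  mem_iff : ∀ δ, δ ∈ l ↔ δ ∈ kb.dis
  lt_of_prec : ∀ i j : Fin l.length, prec kb (l.get i) (l.get j) → i < j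

/-- Defeasible entailment of `α` from `kb`, for an arbitrary linearization. -/
def DefEntails (prec : Priority K) (kb : DKB K) (α : Axm K (NName K)) : Prop :=
  ∀ l, IsLinearization prec kb l → Entails (kbSigma prec kb (sigma kb α) l) α

/-! Inputs as bit strings: labelled trees in bracket notation over four letters, each of
which is written with two bits. -/

/-- Letters: brackets and bits. -/
inductive Letter
  | lpar
  | rpar
  | bit (b : Bool)

/-- The two bits of a letter. -/
def Letter.code : Letter → List Bool
  | .lpar => [true, false]
  | .rpar => [true, true]
  | .bit b => [false, b]

/-- The tree with the given label and the given immediate subtrees. -/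
def node (label : List Bool) (children : List (List Letter)) : List Letter :=
  .lpar :: label.map .bit ++ children.flatten ++ [.rpar]

/-- A bit string, as a tree. -/
def leaf (w : List Bool) : List Letter := node w []

/-- A natural number, in binary notation. -/
def encNat (n : ℕ) : List Letter := leaf n.bits

/-- A list of numbers. -/
def encNats {n : ℕ} (v : Fin n → ℕ) : List Letter :=
  node [] (List.ofFn fun i => encNat (v i))

/-- Concepts, given an encoding of the concept names. -/
def Concept.enc (e : X → List Letter) : Concept K X → List Letter
  | .name A => e A
  | .top => node [false, false, true, false] []
  | .bot => node [false, false, true, true] []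
  | .neg C => node [false, true, false, false] [C.enc e]
  | .inter C D => node [false, true, false, true] [C.enc e, D.enc e]
  | .union C D => node [false, true, true, false] [C.enc e, D.enc e]
  | .ex R C => node [false, true, true, true] [encNat R, C.enc e]
  | .all R C => node [true, false, false, false] [encNat R, C.enc e]
  | .ext o cs rs is fs => node [true, false, false, true]
      [leaf (K.opCode o), node [] (List.ofFn fun i => (cs i).enc e),
        encNats rs, encNats is, encNats fs]

/-- Concept names of the description logic. -/
def encName (n : ℕ) : List Letter := node [false, false, false, false] [encNat n]

/-- Concept names of the defeasible extension. -/
def encNName : NName K → List Letter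
  | .inl n => encName n
  | .inr C => node [false, false, false, true] [C.enc encName]

/-- Axioms, given an encoding of the concept names. -/
def Axm.enc (e : X → List Letter) : Axm K X → List Letter
  | .incl C D => node [true, false, true, false] [C.enc e, D.enc e]
  | .assert C a => node [true, false, true, true] [C.enc e, encNat a]
  | .other (.roleAssertion R a b) => node [true, true, false, false] [encNat R, encNat a, encNat b]
  | .other (.ext o rs is fs) => node [true, true, false, true]
      [leaf (K.axCode o), encNats rs, encNats is, encNats fs]

/-- Finite sets of axioms. -/
def encKB (e : X → List Letter) (S : List (Axm K X)) : List Letter :=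
  node [] (S.map (Axm.enc e))

/-- Defeasible inclusions. -/
def DI.enc (δ : DI K) : List Letter :=
  node [true, true, true, false] [δ.pre.enc encNName, δ.con.enc encNName]

/-- Defeasible knowledge bases. -/
def DKB.enc (kb : DKB K) : List Letter :=
  node [] [encKB encName kb.strong, node [] (kb.dis.map DI.enc), leaf kb.info]

/-- The input word formed from several parts. -/
def word (parts : List (List Letter)) : List Bool := (node [] parts).flatMap Letter.code

/-! The decision problems -/

open OracleTime

/-- Subsumption checking in the description logic, given `S`, `C` and `D`: does `S ⊨ C ⊑ D`? -/
def SubsumptionIn (F : Fragment K) (𝒞 : Set (Language Bool)) : Prop :=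
  ProblemIn (α := List (Axm K ℕ) × Concept K ℕ × Concept K ℕ) 𝒞
    (fun x => word [encKB encName x.1, x.2.1.enc encName, x.2.2.enc encName])
    (fun x => F.IsKB x.1 ∧ x.2.1 ∈ F.lhs (others x.1) ℕ ∧ x.2.2 ∈ F.rhs (others x.1) ℕ)
    (fun x => Entails {β | β ∈ x.1} (.incl x.2.1 x.2.2))

/-- Instance checking in the description logic, given `S`, `C` and `a`: does `S ⊨ C(a)`? -/
def InstanceIn (F : Fragment K) (𝒞 : Set (Language Bool)) : Prop :=
  ProblemIn (α := List (Axm K ℕ) × Concept K ℕ × ℕ) 𝒞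
    (fun x => word [encKB encName x.1, x.2.1.enc encName, encNat x.2.2])
    (fun x => F.IsKB x.1 ∧ x.2.1 ∈ F.asr (others x.1) ℕ)
    (fun x => Entails {β | β ∈ x.1} (.assert x.2.1 x.2.2))

/-- Deciding the priority relation, given a knowledge base and two of its defeasible inclusions. -/
def PriorityIn (F : Fragment K) (prec : Priority K) (𝒞 : Set (Language Bool)) : Prop :=
  ProblemIn (α := DKB K × DI K × DI K) 𝒞
    (fun x => word [x.1.enc, x.2.1.enc, x.2.2.enc])
    (fun x => F.IsDKB x.1 ∧ x.2.1 ∈ x.1.dis ∧ x.2.2 ∈ x.1.dis)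
    (fun x => prec x.1 x.2.1 x.2.2)

/-- Subsumption checking in the defeasible extension, for queries `C ⊑ D`. -/
def DefSubsumptionIn (F : Fragment K) (prec : Priority K) (𝒞 : Set (Language Bool)) : Prop :=
  ProblemIn (α := DKB K × Concept K (NName K) × Concept K (NName K)) 𝒞
    (fun x => word [x.1.enc, x.2.1.enc encNName, x.2.2.enc encNName])
    (fun x => F.IsDKB x.1 ∧
      (x.2.1 ∈ F.lhs (others x.1.strong) (NName K) ∧ F.NormalOK (others x.1.strong) x.2.1) ∧
      (x.2.2 ∈ F.rhs (others x.1.strong) (NName K) ∧ F.NormalOK (others x.1.strong) x.2.2))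
    (fun x => DefEntails prec x.1 (.incl x.2.1 x.2.2))

/-- Instance checking in the defeasible extension, for queries `C(a)`. -/
def DefInstanceIn (F : Fragment K) (prec : Priority K) (𝒞 : Set (Language Bool)) : Prop :=
  ProblemIn (α := DKB K × Concept K (NName K) × ℕ) 𝒞
    (fun x => word [x.1.enc, x.2.1.enc encNName, encNat x.2.2])
    (fun x => F.IsDKB x.1 ∧
      (x.2.1 ∈ F.asr (others x.1.strong) (NName K) ∧ F.NormalOK (others x.1.strong) x.2.1))
    (fun x => DefEntails prec x.1 (.assert x.2.1 x.2.2))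

/-- Any two members of `𝒞` are polynomial-time reducible to a single member of `𝒞`; this holds for
every class with a complete problem and for every class closed under disjoint unions. -/
def IsDirected (𝒞 : Set (Language Bool)) : Prop :=
  ∀ A ∈ 𝒞, ∀ B ∈ 𝒞, ∃ D ∈ 𝒞, A ∈ PRel D ∧ B ∈ PRel D

end DLN

/-! Structured programs on four stacks of bits -/

namespace OracleTime

open Turing

/-! The logical core is that `KB^Σ` can be computed without knowing the enumeration. The test for
`δ^(N C)` removes all instances of inclusions that are not of strictly higher priority than `δ`, and
no instance lies in the initial stage (`DI.inst_notMem_stageZero`). What remains is the initial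
stage and the accepted instances of higher priority (`restrict_stage`). So the set of accepted pairs
`(δ, C)` is characterized by a fixed-point equation: `refineStep` tests all pairs simultaneously
against a guess `T`, and any fixed point yields `KB^Σ` for every enumeration (`kbSigma_eq`). The
operator is antitone, not monotone, but a verdict depends only on verdicts about inclusions that
come earlier in an enumeration. Starting from `∅`, the verdicts on the first `k` inclusions are
therefore final after `k` rounds (`mem_iterate_iff`), and as many rounds as there are defeasible
inclusions reach the fixed point. Each round makes polynomially many entailment tests and
comparisons by `≺`. That an enumeration exists matters only for the correctness proof
(`defEntails_iff`).

Every test has to be a query of the original logic. Normality concepts are turned into ordinary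
concept names by the injective renaming `newName`, which preserves entailment (`entails_map`) and
well-formedness (`isKB_axiomsOf`, where conjunction on the left is needed). As `⊥` may not be
available, the inconsistency of `N C` is asked as `N C ⊑ A` with a fresh name `A`
(`entails_incl_new_name`), or, for instance checking, as `A(a)` after adding `N C(a)` for a fresh
individual `a` (`entails_assert_new_name`). The procedure acts on encodings: trees are cut out by
counting brackets, and the encoded concept names are found and replaced as tokens (`cut`,
`Renames`). `decideDef_iff` is its correctness.

For the running time, `PolyTime O` is a class of functions on data coded by binary trees, computed
by structured programs that compile to oracle machines (`Eval.iterate`). It is closed under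
composition, pairing, case distinction and folds over lists whose intermediate results stay
polynomially bounded (`PolyTime.foldl`). It contains the oracle (`PolyTime.oracle`), and its Boolean
functions on words decide languages of `P^O` (`PolyTime.mem_PRel`). Oracle substitution
(`PolyTime.char_of_mem_PRel`) holds because one step of a machine is such a function and enlarges
the stacks by at most a constant, so a clocked simulation stays polynomial. Directedness of `𝒞`
finally merges the oracles for entailment and for priorities into one. -/

/-- Structured programs. They work on four stacks of bits; queries are asked on stack `2`. -/
inductive Prog
  | skip
  | push (k : Fin 4) (b : Bool)
  | seq (p q : Prog)
  | pop (k : Fin 4) (onEmpty onFalse onTrue : Prog)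
  | loop (k : Fin 4) (onFalse onTrue : Prog)
  | query (onFalse onTrue : Prog)

/-- Contents of the stacks. -/
abbrev Stacks : Type := Fin 4 → List Bool

/-- `Eval O p S t S'`: with oracle `O`, the program `p` leads from `S` to `S'` in at most `t`
steps. -/
inductive Eval (O : Language Bool) : Prog → Stacks → ℕ → Stacks → Prop
  | skip {S t} : 1 ≤ t → Eval O .skip S t S
  | push {k b S t} : 1 ≤ t → Eval O (.push k b) S t (Function.update S k (b :: S k))
  | seq {p q S S₁ S₂ t₁ t₂ t} : Eval O p S t₁ S₁ → Eval O q S₁ t₂ S₂ → t₁ + t₂ ≤ t →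
      Eval O (.seq p q) S t S₂
  | popNil {k p q r S S' t₁ t} : S k = [] → Eval O p S t₁ S' → t₁ + 1 ≤ t →
      Eval O (.pop k p q r) S t S'
  | popFalse {k p q r S S' l t₁ t} : S k = false :: l →
      Eval O q (Function.update S k l) t₁ S' → t₁ + 1 ≤ t → Eval O (.pop k p q r) S t S'
  | popTrue {k p q r S S' l t₁ t} : S k = true :: l →
      Eval O r (Function.update S k l) t₁ S' → t₁ + 1 ≤ t → Eval O (.pop k p q r) S t S'
  | loopNil {k p q S t} : S k = [] → 1 ≤ t → Eval O (.loop k p q) S t S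
  | loopFalse {k p q S S₁ S' l t₁ t₂ t} : S k = false :: l →
      Eval O p (Function.update S k l) t₁ S₁ → Eval O (.loop k p q) S₁ t₂ S' → t₁ + t₂ + 1 ≤ t →
      Eval O (.loop k p q) S t S'
  | loopTrue {k p q S S₁ S' l t₁ t₂ t} : S k = true :: l →
      Eval O q (Function.update S k l) t₁ S₁ → Eval O (.loop k p q) S₁ t₂ S' → t₁ + t₂ + 1 ≤ t →
      Eval O (.loop k p q) S t S'
  | queryFalse {p q S S' t₁ t} : S 2 ∉ O → Eval O p (Function.update S 2 []) t₁ S' → t₁ + 1 ≤ t →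
      Eval O (.query p q) S t S'
  | queryTrue {p q S S' t₁ t} : S 2 ∈ O → Eval O q (Function.update S 2 []) t₁ S' → t₁ + 1 ≤ t →
      Eval O (.query p q) S t S'

theorem Eval.mono {O : Language Bool} {p S t S' t'} (h : Eval O p S t S') (ht : t ≤ t') :
    Eval O p S t' S' := by
  cases h with
  | skip h => exact .skip (h.trans ht)
  | push h => exact .push (h.trans ht)
  | seq h₁ h₂ h => exact .seq h₁ h₂ (h.trans ht)
  | popNil e h₁ h => exact .popNil e h₁ (h.trans ht)
  | popFalse e h₁ h => exact .popFalse e h₁ (h.trans ht)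
  | popTrue e h₁ h => exact .popTrue e h₁ (h.trans ht)
  | loopNil e h => exact .loopNil e (h.trans ht)
  | loopFalse e h₁ h₂ h => exact .loopFalse e h₁ h₂ (h.trans ht)
  | loopTrue e h₁ h₂ h => exact .loopTrue e h₁ h₂ (h.trans ht)
  | queryFalse e h₁ h => exact .queryFalse e h₁ (h.trans ht)
  | queryTrue e h₁ h => exact .queryTrue e h₁ (h.trans ht)

/-! Compilation to oracle Turing machines -/

/-- The labels of a program. -/
def Prog.Lab : Prog → Type
  | .skip => Unit
  | .push _ _ => Unit
  | .seq p q => p.Lab ⊕ q.Lab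
  | .pop _ p q r => Option (p.Lab ⊕ q.Lab ⊕ r.Lab)
  | .loop _ p q => Option (p.Lab ⊕ q.Lab)
  | .query p q => Option (p.Lab ⊕ q.Lab)

/-- The set of labels is finite. -/
@[reducible] noncomputable def Prog.fintypeLab : (p : Prog) → Fintype p.Lab
  | .skip => inferInstanceAs (Fintype Unit)
  | .push _ _ => inferInstanceAs (Fintype Unit)
  | .seq p q => by
      have := p.fintypeLab; have := q.fintypeLab
      exact inferInstanceAs (Fintype (p.Lab ⊕ q.Lab))
  | .pop _ p q r => by
      have := p.fintypeLab; have := q.fintypeLab; have := r.fintypeLab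
      exact inferInstanceAs (Fintype (Option (p.Lab ⊕ q.Lab ⊕ r.Lab)))
  | .loop _ p q => by
      have := p.fintypeLab; have := q.fintypeLab
      exact inferInstanceAs (Fintype (Option (p.Lab ⊕ q.Lab)))
  | .query p q => by
      have := p.fintypeLab; have := q.fintypeLab
      exact inferInstanceAs (Fintype (Option (p.Lab ⊕ q.Lab)))

/-- The label at which the execution of a program starts. -/
def Prog.entry : (p : Prog) → p.Lab
  | .skip => ()
  | .push _ _ => ()
  | .seq p _ => .inl p.entry
  | .pop _ _ _ _ => none
  | .loop _ _ _ => none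
  | .query _ _ => none

/-- What a label holds: a statement or a query. -/
abbrev Instr (Λ : Type) : Type := TM2.Stmt (fun _ : Fin 4 => Bool) Λ (Option Bool) ⊕ (Bool → Λ)

/-- The statement that pops from stack `k` and jumps accordingly. -/
def popGoto {Λ : Type} (k : Fin 4) (f : Option Bool → Λ) : Instr Λ :=
  .inl (.pop k (fun _ o => o) (.goto f))

/-- The code of a program, embedded into a larger set `Λ` of labels and leading to `exit`. -/
def Prog.code {Λ : Type} : (p : Prog) → (p.Lab → Λ) → Λ → p.Lab → Instr Λ
  | .skip, _, exit, _ => .inl (.goto fun _ => exit)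
  | .push k b, _, exit, _ => .inl (.push k (fun _ => b) (.goto fun _ => exit))
  | .seq p q, emb, _, .inl l => p.code (fun l => emb (.inl l)) (emb (.inr q.entry)) l
  | .seq _ q, emb, exit, .inr l => q.code (fun l => emb (.inr l)) exit l
  | .pop k p q r, emb, _, none => popGoto k fun o => match o with
      | none => emb (some (.inl p.entry))
      | some false => emb (some (.inr (.inl q.entry)))
      | some true => emb (some (.inr (.inr r.entry)))
  | .pop _ p _ _, emb, exit, some (.inl l) => p.code (fun l => emb (some (.inl l))) exit l
  | .pop _ _ q _, emb, exit, some (.inr (.inl l)) =>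
      q.code (fun l => emb (some (.inr (.inl l)))) exit l
  | .pop _ _ _ r, emb, exit, some (.inr (.inr l)) =>
      r.code (fun l => emb (some (.inr (.inr l)))) exit l
  | .loop k p q, emb, exit, none => popGoto k fun o => match o with
      | none => exit
      | some false => emb (some (.inl p.entry))
      | some true => emb (some (.inr q.entry))
  | .loop _ p _, emb, _, some (.inl l) => p.code (fun l => emb (some (.inl l))) (emb none) l
  | .loop _ _ q, emb, _, some (.inr l) => q.code (fun l => emb (some (.inr l))) (emb none) l
  | .query p q, emb, _, none => .inr fun b =>
      if b then emb (some (.inr q.entry)) else emb (some (.inl p.entry))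
  | .query p _, emb, exit, some (.inl l) => p.code (fun l => emb (some (.inl l))) exit l
  | .query _ q, emb, exit, some (.inr l) => q.code (fun l => emb (some (.inr l))) exit l

/-- The machine with four stacks of bits and the given code; it accepts when the last popped bit
is `true`. -/
def bitMachine (Λ : Type) [Fintype Λ] (main : Λ) (c : Λ → Instr Λ) : OracleTM where
  K := Fin 4
  Γ := fun _ => Bool
  Λ := Λ
  σ := Option Bool
  inStack := 1
  inSym := id
  qStack := 2
  qSym := id
  main := main
  start := none
  accept := fun v => v == some true
  code := c

theorem OracleTM.step_inl (M : OracleTM) (O : Language Bool) {l : M.Λ} {q : TM2.Stmt M.Γ M.Λ M.σ}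
    (h : M.code l = .inl q) (v : M.σ) (S : ∀ k, List (M.Γ k)) :
    M.step O ⟨some l, v, S⟩ = TM2.stepAux q v S := by
  simp only [OracleTM.step, h]

theorem OracleTM.step_inr (M : OracleTM) (O : Language Bool) {l : M.Λ} {f : Bool → M.Λ}
    (h : M.code l = .inr f) (v : M.σ) (S : ∀ k, List (M.Γ k)) (b : Bool)
    (hb : b = true ↔ (S M.qStack).map M.qSym ∈ O) :
    M.step O ⟨some l, v, S⟩ = ⟨some (f b), v, Function.update S M.qStack []⟩ := by
  simp only [OracleTM.step, h]
  congr 3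
  cases b <;> simp_all

/-- Configurations of a machine with four stacks of bits. -/
abbrev BitCfg (Λ : Type) : Type := TM2.Cfg (fun _ : Fin 4 => Bool) Λ (Option Bool)

/-- The step function of a machine with four stacks of bits. -/
noncomputable def bitStep {Λ : Type} [Fintype Λ] (main : Λ) (c : Λ → Instr Λ) (O : Language Bool) :
    BitCfg Λ → BitCfg Λ :=
  (bitMachine Λ main c).step O

section bitStep

variable {Λ : Type} [Fintype Λ] {main : Λ} {c : Λ → Instr Λ} {O : Language Bool}

theorem bitStep_inl {q : TM2.Stmt (fun _ : Fin 4 => Bool) Λ (Option Bool)} {l : Λ}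
    (h : c l = .inl q) (v : Option Bool) (S : Stacks) :
    bitStep main c O ⟨some l, v, S⟩ = TM2.stepAux q v S :=
  (bitMachine Λ main c).step_inl O h v S

theorem bitStep_popGoto {k : Fin 4} {f : Option Bool → Λ} {l : Λ} (h : c l = popGoto k f)
    (v : Option Bool) (S : Stacks) : bitStep main c O ⟨some l, v, S⟩ =
      ⟨some (f (S k).head?), (S k).head?, Function.update S k (S k).tail⟩ :=
  bitStep_inl h v S

theorem bitStep_popGoto_nil {k : Fin 4} {f : Option Bool → Λ} {l : Λ} (h : c l = popGoto k f)
    (v : Option Bool) {S : Stacks} (e : S k = []) :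
    bitStep main c O ⟨some l, v, S⟩ = ⟨some (f none), none, S⟩ := by
  rw [bitStep_popGoto h, e, List.tail_nil, ← e, Function.update_eq_self, e]
  rfl

theorem bitStep_popGoto_cons {k : Fin 4} {f : Option Bool → Λ} {l : Λ} (h : c l = popGoto k f)
    (v : Option Bool) {S : Stacks} {b : Bool} {s : List Bool} (e : S k = b :: s) :
    bitStep main c O ⟨some l, v, S⟩ = ⟨some (f (some b)), some b, Function.update S k s⟩ := by
  rw [bitStep_popGoto h, e]
  rfl

theorem bitStep_inr {f : Bool → Λ} {l : Λ} (h : c l = .inr f) (v : Option Bool)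
    (S : Stacks) (b : Bool) (hb : b = true ↔ S 2 ∈ O) :
    bitStep main c O ⟨some l, v, S⟩ = ⟨some (f b), v, Function.update S 2 []⟩ :=
  (bitMachine Λ main c).step_inr O h v S b
    (hb.trans (iff_of_eq (congrArg (· ∈ O) (List.map_id (S 2)).symm)))

end bitStep

theorem iterate_chain {α : Type} {f : α → α} {a b d : α} {m n : ℕ} (h₁ : f^[m] a = b)
    (h₂ : f^[n] b = d) : f^[n + m] a = d := by
  rw [Function.iterate_add_apply, h₁, h₂]

/-- Execution of compiled code. -/
theorem Eval.iterate {O : Language Bool} {p S t S'} (h : Eval O p S t S') :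
    -- Ambient labels, embedding and exit are quantified inside the induction: a subprogram occupies
    -- a part of a larger program and leads to an exit of its own. The state is arbitrary because it
    -- is only read immediately after a pop.
    ∀ {Λ : Type} [Fintype Λ] {main : Λ} {c : Λ → Instr Λ} (emb : p.Lab → Λ) (exit : Λ),
      (∀ l, c (emb l) = p.code emb exit l) → ∀ v : Option Bool, ∃ n ≤ t, ∃ v' : Option Bool,
        (bitStep main c O)^[n] ⟨some (emb p.entry), v, S⟩ = ⟨some exit, v', S'⟩ := by
  induction h with
  | skip ht =>
    intro Λ _ main c emb exit hc v
    exact ⟨1, ht, v, bitStep_inl (hc ()) v _⟩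
  | push ht =>
    intro Λ _ main c emb exit hc v
    exact ⟨1, ht, v, bitStep_inl (hc ()) v _⟩
  | @seq p q S S₁ S₂ t₁ t₂ t _ _ ht ih₁ ih₂ =>
    intro Λ _ main c emb exit hc v
    obtain ⟨n₁, h₁, v₁, e₁⟩ := ih₁ (main := main) (c := c) (fun l => emb (.inl l))
      (emb (.inr q.entry)) (fun l => hc (.inl l)) v
    obtain ⟨n₂, h₂, v₂, e₂⟩ := ih₂ (main := main) (c := c) (fun l => emb (.inr l)) exit
      (fun l => hc (.inr l)) v₁
    exact ⟨n₂ + n₁, by omega, v₂, iterate_chain e₁ e₂⟩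
  | popNil e _ ht ih =>
    intro Λ _ main c emb exit hc v
    obtain ⟨n, h₁, v₁, e₁⟩ := ih (main := main) (c := c) (fun l => emb (some (.inl l))) exit
      (fun l => hc (some (.inl l))) none
    exact ⟨n + 1, by omega, v₁, iterate_chain (bitStep_popGoto_nil (hc none) v e) e₁⟩
  | popFalse e _ ht ih =>
    intro Λ _ main c emb exit hc v
    obtain ⟨n, h₁, v₁, e₁⟩ := ih (main := main) (c := c) (fun l => emb (some (.inr (.inl l)))) exit
      (fun l => hc (some (.inr (.inl l)))) (some false)
    exact ⟨n + 1, by omega, v₁, iterate_chain (bitStep_popGoto_cons (hc none) v e) e₁⟩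
  | popTrue e _ ht ih =>
    intro Λ _ main c emb exit hc v
    obtain ⟨n, h₁, v₁, e₁⟩ := ih (main := main) (c := c) (fun l => emb (some (.inr (.inr l)))) exit
      (fun l => hc (some (.inr (.inr l)))) (some true)
    exact ⟨n + 1, by omega, v₁, iterate_chain (bitStep_popGoto_cons (hc none) v e) e₁⟩
  | loopNil e ht =>
    intro Λ _ main c emb exit hc v
    exact ⟨1, ht, none, bitStep_popGoto_nil (hc none) v e⟩
  | loopFalse e _ _ ht ih₁ ih₂ =>
    intro Λ _ main c emb exit hc v
    obtain ⟨n₁, h₁, v₁, e₁⟩ := ih₁ (main := main) (c := c) (fun l => emb (some (.inl l)))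
      (emb none) (fun l => hc (some (.inl l))) (some false)
    -- The body leads back to `emb none`, the entry of the loop, so the rest is a run of the same
    -- code with the same exit.
    obtain ⟨n₂, h₂, v₂, e₂⟩ := ih₂ (main := main) (c := c) emb exit hc v₁
    exact ⟨n₂ + (n₁ + 1), by omega, v₂,
      iterate_chain (iterate_chain (bitStep_popGoto_cons (hc none) v e) e₁) e₂⟩
  | loopTrue e _ _ ht ih₁ ih₂ =>
    intro Λ _ main c emb exit hc v
    obtain ⟨n₁, h₁, v₁, e₁⟩ := ih₁ (main := main) (c := c) (fun l => emb (some (.inr l)))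
      (emb none) (fun l => hc (some (.inr l))) (some true)
    obtain ⟨n₂, h₂, v₂, e₂⟩ := ih₂ (main := main) (c := c) emb exit hc v₁
    exact ⟨n₂ + (n₁ + 1), by omega, v₂,
      iterate_chain (iterate_chain (bitStep_popGoto_cons (hc none) v e) e₁) e₂⟩
  | queryFalse e _ ht ih =>
    intro Λ _ main c emb exit hc v
    obtain ⟨n, h₁, v₁, e₁⟩ := ih (main := main) (c := c) (fun l => emb (some (.inl l))) exit
      (fun l => hc (some (.inl l))) v
    exact ⟨n + 1, by omega, v₁,
      iterate_chain (bitStep_inr (hc none) v _ false (by simpa using e)) e₁⟩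
  | queryTrue e _ ht ih =>
    intro Λ _ main c emb exit hc v
    obtain ⟨n, h₁, v₁, e₁⟩ := ih (main := main) (c := c) (fun l => emb (some (.inr l))) exit
      (fun l => hc (some (.inr l))) v
    exact ⟨n + 1, by omega, v₁,
      iterate_chain (bitStep_inr (hc none) v _ true (by simpa using e)) e₁⟩

/-- The code of the machine of a program. -/
def Prog.fullCode (p : Prog) : Option p.Lab → Instr (Option p.Lab)
  | some l => p.code some none l
  | none => .inl (.pop 0 (fun _ o => o) .halt)

/-- The machine that runs a program and then accepts if the top of stack `0` is `true`. -/
noncomputable def Prog.machine (p : Prog) : OracleTM :=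
  letI := p.fintypeLab
  bitMachine (Option p.Lab) (some p.entry) p.fullCode

theorem OracleTM.step_iterate_of_halted (M : OracleTM) (O : Language Bool) {c : M.Cfg}
    (h : c.l = none) (n : ℕ) : (M.step O)^[n] c = c := by
  obtain ⟨l, v, S⟩ := c
  cases h
  exact Function.iterate_fixed rfl n

theorem OracleTM.run_of_halted (M : OracleTM) (O : Language Bool) (w : List Bool) {m n : ℕ}
    (h : (M.run O w m).l = none) (hmn : m ≤ n) : M.run O w n = M.run O w m := by
  obtain ⟨k, rfl⟩ := Nat.exists_eq_add_of_le' hmn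
  rw [OracleTM.run, Function.iterate_add_apply]
  exact M.step_iterate_of_halted O h k

/-- The additional step is that of the final label, which pops stack `0` into the state, where
acceptance is read off. Later steps change nothing because the machine has halted. -/
theorem Prog.machine_run {O : Language Bool} {p : Prog} {w : List Bool} {t n : ℕ} {S' : Stacks}
    (h : Eval O p (Function.update (fun _ => []) 1 w) t S') (hn : t + 1 ≤ n) :
    (p.machine.run O w n).l = none ∧
      (p.machine.accept (p.machine.run O w n).var = true ↔ (S' 0).head? = some true) := by
  let _ := p.fintypeLab
  obtain ⟨m, hm, v, e⟩ := h.iterate (main := some p.entry) (c := p.fullCode) some none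
    (fun l => rfl) none
  let c₀ : BitCfg (Option p.Lab) := ⟨some (some p.entry), none, Function.update (fun _ => []) 1 w⟩
  let c₁ : BitCfg (Option p.Lab) := ⟨none, (S' 0).head?, Function.update S' 0 (S' 0).tail⟩
  have hi : p.machine.init w = c₀ :=
    congrArg (TM2.Cfg.mk _ _) (congrArg (Function.update (fun _ => []) (1 : Fin 4)) (List.map_id w))
  have e' : p.machine.run O w (m + 1) = c₁ := by
    rw [OracleTM.run, Function.iterate_succ_apply', hi]
    exact (congrArg (p.machine.step O) e).trans (bitStep_inl (c := p.fullCode) (l := none) rfl v S')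
  rw [OracleTM.run_of_halted _ _ _ (m := m + 1) (by rw [e']; rfl) (by omega), e']
  exact ⟨rfl, beq_iff_eq⟩

end OracleTime

/-! Polynomial-time functions on encoded data -/

namespace OracleTime

open Turing

/-- Unlabelled binary trees. -/
inductive Data
  | nil
  | cons (x y : Data)

/-- Binary trees in prefix notation. -/
def Data.bits : Data → List Bool
  | .nil => [false]
  | .cons x y => true :: (x.bits ++ y.bits)

/-- Stack contents, listed. -/
def st (a b c d : List Bool) : Stacks := ![a, b, c, d]

/-! ### Evaluation rules, and operations on trees stored on the stacks -/

section Eval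

variable {O : Language Bool} {p q r : Prog} {S S' S₁ : Stacks} {t t₁ t₂ : ℕ} {a b c d l : List Bool}
  {x : Bool}

theorem st_update_zero : Function.update (st a b c d) 0 l = st l b c d := by
  funext i; fin_cases i <;> rfl

theorem st_update_one : Function.update (st a b c d) 1 l = st a l c d := by
  funext i; fin_cases i <;> rfl

theorem st_update_two : Function.update (st a b c d) 2 l = st a b l d := by
  funext i; fin_cases i <;> rfl

theorem st_update_three : Function.update (st a b c d) 3 l = st a b c l := by
  funext i; fin_cases i <;> rfl

theorem Eval.seq' (h₁ : Eval O p S t₁ S₁) (h₂ : Eval O q S₁ t₂ S') :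
    Eval O (.seq p q) S (t₁ + t₂) S' := .seq h₁ h₂ le_rfl

theorem Eval.push_zero : Eval O (.push 0 x) (st a b c d) 1 (st (x :: a) b c d) := by
  have h := Eval.push (O := O) (k := 0) (b := x) (S := st a b c d) (t := 1) le_rfl
  rw [st_update_zero] at h
  exact h

theorem Eval.push_one : Eval O (.push 1 x) (st a b c d) 1 (st a (x :: b) c d) := by
  have h := Eval.push (O := O) (k := 1) (b := x) (S := st a b c d) (t := 1) le_rfl
  rw [st_update_one] at h
  exact h

theorem Eval.push_two : Eval O (.push 2 x) (st a b c d) 1 (st a b (x :: c) d) := by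
  have h := Eval.push (O := O) (k := 2) (b := x) (S := st a b c d) (t := 1) le_rfl
  rw [st_update_two] at h
  exact h

theorem Eval.push_three : Eval O (.push 3 x) (st a b c d) 1 (st a b c (x :: d)) := by
  have h := Eval.push (O := O) (k := 3) (b := x) (S := st a b c d) (t := 1) le_rfl
  rw [st_update_three] at h
  exact h

theorem Eval.pop_zero (h : Eval O (bif x then r else q) (st a b c d) t S') :
    Eval O (.pop 0 p q r) (st (x :: a) b c d) (t + 1) S' := by
  rw [← st_update_zero (a := x :: a)] at h
  cases x
  · exact .popFalse rfl h le_rfl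
  · exact .popTrue rfl h le_rfl

theorem Eval.loop_one (h : Eval O (bif x then q else p) (st a b c d) t₁ S₁)
    (h' : Eval O (.loop 1 p q) S₁ t₂ S') :
    Eval O (.loop 1 p q) (st a (x :: b) c d) (t₁ + t₂ + 1) S' := by
  rw [← st_update_one (b := x :: b)] at h
  cases x
  · exact .loopFalse rfl h h' le_rfl
  · exact .loopTrue rfl h h' le_rfl

theorem Eval.loop_two (h : Eval O (bif x then q else p) (st a b c d) t₁ S₁)
    (h' : Eval O (.loop 2 p q) S₁ t₂ S') :
    Eval O (.loop 2 p q) (st a b (x :: c) d) (t₁ + t₂ + 1) S' := by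
  rw [← st_update_two (c := x :: c)] at h
  cases x
  · exact .loopFalse rfl h h' le_rfl
  · exact .loopTrue rfl h h' le_rfl

theorem Eval.loop_three (h : Eval O (bif x then q else p) (st a b c d) t₁ S₁)
    (h' : Eval O (.loop 3 p q) S₁ t₂ S') :
    Eval O (.loop 3 p q) (st a b c (x :: d)) (t₁ + t₂ + 1) S' := by
  rw [← st_update_three (d := x :: d)] at h
  cases x
  · exact .loopFalse rfl h h' le_rfl
  · exact .loopTrue rfl h h' le_rfl

theorem Eval.loop_one_nil : Eval O (.loop 1 p q) (st a [] c d) 1 (st a [] c d) := .loopNil rfl le_rfl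

theorem Eval.loop_two_nil : Eval O (.loop 2 p q) (st a b [] d) 1 (st a b [] d) := .loopNil rfl le_rfl

theorem Eval.loop_three_nil : Eval O (.loop 3 p q) (st a b c []) 1 (st a b c []) :=
  .loopNil rfl le_rfl

/-- Moves one tree from stack `0` to stack `k`, reversing its code. -/
def Prog.move (k : Fin 4) : Prog :=
  .seq (.push 3 true) (.loop 3 .skip (.pop 0 .skip (.push k false)
    (.seq (.push k true) (.seq (.push 3 true) (.push 3 true)))))

/-- Stack `3` counts the trees still to be moved: a leaf uses up one token, an inner node exchanges
one token for two. An arbitrary continuation of the run is carried along, so that for an inner node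
the runs for the two subtrees can be chained. A node costs at most five steps: loop, pop and three
pushes. -/
theorem Eval.move_one_aux (x : Data) : ∀ {a b d t S'},
    Eval O (.loop 3 .skip (.pop 0 .skip (.push 1 false)
      (.seq (.push 1 true) (.seq (.push 3 true) (.push 3 true)))))
      (st a (x.bits.reverse ++ b) c d) t S' →
    Eval O (.loop 3 .skip (.pop 0 .skip (.push 1 false)
      (.seq (.push 1 true) (.seq (.push 3 true) (.push 3 true)))))
      (st (x.bits ++ a) b c (true :: d)) (t + 5 * x.bits.length) S' := by
  induction x with
  | nil =>
    intro a b d t S' h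
    exact (Eval.loop_three (Eval.pop_zero Eval.push_one) h).mono (by simp [Data.bits]; omega)
  | cons x y hx hy =>
    intro a b d t S' h
    simp only [Data.bits, List.reverse_cons, List.reverse_append, List.append_assoc,
      List.cons_append, List.nil_append] at h ⊢
    exact (Eval.loop_three (Eval.pop_zero (Eval.push_one.seq' (Eval.push_three.seq'
      Eval.push_three))) (hx (hy h))).mono (by simp; omega)

theorem Eval.move_two_aux (x : Data) : ∀ {a c d t S'},
    Eval O (.loop 3 .skip (.pop 0 .skip (.push 2 false)
      (.seq (.push 2 true) (.seq (.push 3 true) (.push 3 true)))))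
      (st a b (x.bits.reverse ++ c) d) t S' →
    Eval O (.loop 3 .skip (.pop 0 .skip (.push 2 false)
      (.seq (.push 2 true) (.seq (.push 3 true) (.push 3 true)))))
      (st (x.bits ++ a) b c (true :: d)) (t + 5 * x.bits.length) S' := by
  induction x with
  | nil =>
    intro a b d t S' h
    exact (Eval.loop_three (Eval.pop_zero Eval.push_two) h).mono (by simp [Data.bits]; omega)
  | cons x y hx hy =>
    intro a b d t S' h
    simp only [Data.bits, List.reverse_cons, List.reverse_append, List.append_assoc,
      List.cons_append, List.nil_append] at h ⊢
    exact (Eval.loop_three (Eval.pop_zero (Eval.push_two.seq' (Eval.push_three.seq'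
      Eval.push_three))) (hx (hy h))).mono (by simp; omega)

theorem Eval.move_one (x : Data) : Eval O (.move 1) (st (x.bits ++ a) b c [])
    (5 * x.bits.length + 2) (st a (x.bits.reverse ++ b) c []) :=
  (Eval.push_three.seq' (Eval.move_one_aux x Eval.loop_three_nil)).mono (by omega)

theorem Eval.move_two (x : Data) : Eval O (.move 2) (st (x.bits ++ a) b c [])
    (5 * x.bits.length + 2) (st a b (x.bits.reverse ++ c) []) :=
  (Eval.push_three.seq' (Eval.move_two_aux x Eval.loop_three_nil)).mono (by omega)

/-- Moves everything from stack `k` to stack `k'`. -/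
def Prog.pour (k k' : Fin 4) : Prog := .loop k (.push k' false) (.push k' true)

theorem Eval.pour_one_zero (b : List Bool) : ∀ {a}, Eval O (.pour 1 0) (st a b c d)
    (2 * b.length + 1) (st (b.reverse ++ a) [] c d) := by
  induction b with
  | nil => exact Eval.loop_one_nil
  | cons x b ih =>
    intro a
    rw [List.reverse_cons, List.append_assoc]
    refine (Eval.loop_one (S₁ := st (x :: a) b c d) (t₁ := 1) ?_ ih).mono (by simp; omega)
    cases x <;> exact Eval.push_zero

theorem Eval.pour_two_zero (c : List Bool) : ∀ {a}, Eval O (.pour 2 0) (st a b c d)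
    (2 * c.length + 1) (st (c.reverse ++ a) b [] d) := by
  induction c with
  | nil => exact Eval.loop_two_nil
  | cons x b ih =>
    intro a
    rw [List.reverse_cons, List.append_assoc]
    refine (Eval.loop_two (S₁ := st (x :: a) _ b d) (t₁ := 1) ?_ ih).mono (by simp; omega)
    cases x <;> exact Eval.push_zero

theorem Eval.pour_two_one (c : List Bool) : ∀ {b}, Eval O (.pour 2 1) (st a b c d)
    (2 * c.length + 1) (st a (c.reverse ++ b) [] d) := by
  induction c with
  | nil => exact Eval.loop_two_nil
  | cons x c ih =>
    intro b
    rw [List.reverse_cons, List.append_assoc]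
    refine (Eval.loop_two (S₁ := st a (x :: b) c d) (t₁ := 1) ?_ ih).mono (by simp; omega)
    cases x <;> exact Eval.push_one

theorem Eval.pour_one_two (b : List Bool) : ∀ {c}, Eval O (.pour 1 2) (st a b c d)
    (2 * b.length + 1) (st a [] (b.reverse ++ c) d) := by
  induction b with
  | nil => exact Eval.loop_one_nil
  | cons x b ih =>
    intro c
    rw [List.reverse_cons, List.append_assoc]
    refine (Eval.loop_one (S₁ := st a b (x :: c) d) (t₁ := 1) ?_ ih).mono (by simp; omega)
    cases x <;> exact Eval.push_two

/-- Empties stack `1`. -/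
def Prog.clear : Prog := .loop 1 .skip .skip

theorem Eval.clear (b : List Bool) : Eval O .clear (st a b c d) (2 * b.length + 1) (st a [] c d) := by
  induction b with
  | nil => exact Eval.loop_one_nil
  | cons x b ih =>
    refine (Eval.loop_one (S₁ := st a b c d) (t₁ := 1) ?_ ih).mono (by simp; omega)
    cases x <;> exact .skip le_rfl

/-- Moves everything from stack `1` to both stack `0` and stack `2`. -/
def Prog.fork : Prog :=
  .loop 1 (.seq (.push 0 false) (.push 2 false)) (.seq (.push 0 true) (.push 2 true))

theorem Eval.fork (b : List Bool) : ∀ {a c}, Eval O .fork (st a b c d)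
    (3 * b.length + 1) (st (b.reverse ++ a) [] (b.reverse ++ c) d) := by
  induction b with
  | nil => exact Eval.loop_one_nil
  | cons x b ih =>
    intro a c
    rw [List.reverse_cons, List.append_assoc, List.append_assoc]
    refine (Eval.loop_one (S₁ := st (x :: a) b (x :: c) d) (t₁ := 2) ?_ ih).mono (by simp; omega)
    cases x <;> exact Eval.push_zero.seq' Eval.push_two

/-- Duplicates the tree on top of stack `0`. -/
def Prog.dup : Prog := .seq (.move 1) (.seq .fork (.seq (.pour 2 1) (.pour 1 0)))

/-- Every transfer between stacks reverses the code. The reversed tree on stack `1` is forked in the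
right order to stacks `0` and `2`; the second copy then takes the detour through stack `1` in order
to be reversed twice. -/
theorem Eval.dup (x : Data) : Eval O .dup (st (x.bits ++ a) [] [] [])
    (12 * x.bits.length + 5) (st (x.bits ++ (x.bits ++ a)) [] [] []) := by
  refine ((Eval.move_one x).seq' ((Eval.fork _).seq' ((Eval.pour_two_one _).seq'
    (t₂ := 2 * x.bits.length + 1) (S' := st (x.bits ++ (x.bits ++ a)) [] [] []) ?_))).mono ?_
  · simpa using Eval.pour_one_zero (O := O) (c := []) (d := []) x.bits.reverse (a := x.bits ++ a)
  · simp; omega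

/-- Removes the tree on top of stack `0`. -/
def Prog.drop : Prog := .seq (.move 1) .clear

theorem Eval.drop (x : Data) : Eval O .drop (st (x.bits ++ a) [] [] [])
    (7 * x.bits.length + 3) (st a [] [] []) :=
  ((Eval.move_one x).seq' (Eval.clear _)).mono (by simp; omega)

/-- Exchanges the two trees on top of stack `0`. -/
def Prog.swap : Prog := .seq (.move 1) (.seq (.move 2) (.seq (.pour 1 0) (.pour 2 0)))

theorem Eval.swap (x y : Data) : Eval O .swap (st (x.bits ++ (y.bits ++ a)) [] [] [])
    (7 * x.bits.length + 7 * y.bits.length + 6) (st (y.bits ++ (x.bits ++ a)) [] [] []) := by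
  have h₁ := Eval.pour_one_zero (O := O) (c := y.bits.reverse ++ []) (d := [])
    (x.bits.reverse ++ []) (a := a)
  have h₂ := Eval.pour_two_zero (O := O) (b := []) (d := []) (y.bits.reverse ++ [])
    (a := x.bits ++ a)
  simp only [List.append_nil, List.reverse_reverse, List.length_reverse] at h₁ h₂
  refine ((Eval.move_one x).seq' ((Eval.move_two y).seq' ?_)).mono
    (t := (5 * x.bits.length + 2) + ((5 * y.bits.length + 2) +
      (2 * x.bits.length + 1 + (2 * y.bits.length + 1)))) (by omega)
  simpa using h₁.seq' h₂

/-- Pushes a word on stack `0`. -/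
def Prog.write : List Bool → Prog
  | [] => .skip
  | x :: l => .seq (.write l) (.push 0 x)

theorem Eval.write (l : List Bool) : Eval O (.write l) (st a b c d) (l.length + 1)
    (st (l ++ a) b c d) := by
  induction l with
  | nil => exact .skip le_rfl
  | cons x l ih => exact (ih.seq' Eval.push_zero).mono (by simp)

end Eval

/-! Encodings and polynomial bounds -/

/-- Encodings by binary trees. -/
class Enc (α : Type) where
  /-- the code of an object -/
  code : α → Data

/-- The code as a word. -/
def bits {α : Type} [Enc α] (a : α) : List Bool := (Enc.code a).bits

/-- The length of the code. -/
def size {α : Type} [Enc α] (a : α) : ℕ := (bits a).length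

instance : Enc Unit := ⟨fun _ => .nil⟩

instance : Enc Bool := ⟨fun b => if b then .cons .nil .nil else .nil⟩

instance {α β : Type} [Enc α] [Enc β] : Enc (α × β) := ⟨fun x => .cons (Enc.code x.1) (Enc.code x.2)⟩

/-- The tree for a list. -/
def codeList {α : Type} [Enc α] : List α → Data
  | [] => .nil
  | a :: l => .cons (Enc.code a) (codeList l)

instance {α : Type} [Enc α] : Enc (List α) := ⟨codeList⟩

instance {α : Type} [Enc α] : Enc (Option α) := ⟨fun x => match x with
  | none => .nil
  | some a => .cons .nil (Enc.code a)⟩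

section size

variable {α β : Type} [Enc α] [Enc β]

theorem bits_true : bits true = [true, false, false] := rfl

theorem bits_false : bits false = [false] := rfl

theorem bits_prod (x : α × β) : bits x = true :: (bits x.1 ++ bits x.2) := rfl

theorem bits_cons (a : α) (l : List α) : bits (a :: l) = true :: (bits a ++ bits l) := rfl

theorem bits_some (a : α) : bits (some a) = true :: false :: bits a := rfl

theorem size_prod (x : α × β) : size x = size x.1 + size x.2 + 1 := by
  simp [size, bits_prod]

theorem size_nil : size ([] : List α) = 1 := rfl

theorem size_cons (a : α) (l : List α) : size (a :: l) = size a + size l + 1 := by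
  simp [size, bits_cons]

theorem size_none : size (none : Option α) = 1 := rfl

theorem size_some (a : α) : size (some a) = size a + 2 := by
  simp [size, bits_some]

theorem size_bool (b : Bool) : size b ≤ 3 := by
  cases b <;> decide

theorem size_append (l l' : List α) : size (l ++ l') + 1 = size l + size l' := by
  induction l with
  | nil => simp [size_nil]; omega
  | cons a l ih => simp only [List.cons_append, size_cons]; omega

theorem length_lt_size (l : List α) : l.length < size l := by
  induction l with
  | nil => simp [size_nil]
  | cons a l ih => simp only [List.length_cons, size_cons]; omega

theorem size_reverse (l : List α) : size l.reverse = size l := by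
  induction l with
  | nil => rfl
  | cons a l ih =>
    have := size_append l.reverse [a]
    simp only [List.reverse_cons, size_cons, size_nil] at *
    omega

theorem size_le_of_mem {a : α} {l : List α} (h : a ∈ l) : size a < size l := by
  induction l with
  | nil => simp at h
  | cons b l ih =>
    rw [size_cons]
    rcases List.mem_cons.1 h with rfl | h
    · omega
    · have := ih h; omega

theorem size_le_of_sublist {l l' : List α} (h : l.Sublist l') : size l ≤ size l' := by
  induction h with
  | slnil => exact le_rfl
  | cons a _ ih => rw [size_cons]; omega
  | cons_cons a _ ih => rw [size_cons, size_cons]; omega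

end size

/-- Boundedness by a polynomial in the size of the argument. -/
def PolyBd {α : Type} [Enc α] (f : α → ℕ) : Prop :=
  ∃ q : Polynomial ℕ, ∀ a, f a ≤ q.eval (size a)

/-- The coefficients are natural numbers, so no term decreases. -/
theorem eval_mono (q : Polynomial ℕ) {m n : ℕ} (h : m ≤ n) : q.eval m ≤ q.eval n := by
  induction q using Polynomial.induction_on' with
  | add p q hp hq => simp only [Polynomial.eval_add]; omega
  | monomial k a => simp only [Polynomial.eval_monomial]; gcongr

namespace PolyBd

variable {α β : Type} [Enc α] [Enc β] {f g : α → ℕ}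

theorem of_le (hg : PolyBd g) (h : ∀ a, f a ≤ g a) : PolyBd f :=
  hg.imp fun _ hq a => (h a).trans (hq a)

theorem size : PolyBd (size : α → ℕ) := ⟨.X, fun a => by simp⟩

theorem const (n : ℕ) : PolyBd fun _ : α => n := ⟨.C n, fun a => by simp⟩

theorem add (hf : PolyBd f) (hg : PolyBd g) : PolyBd fun a => f a + g a := by
  obtain ⟨p, hp⟩ := hf
  obtain ⟨q, hq⟩ := hg
  exact ⟨p + q, fun a => by rw [Polynomial.eval_add]; exact add_le_add (hp a) (hq a)⟩

theorem mul (hf : PolyBd f) (hg : PolyBd g) : PolyBd fun a => f a * g a := by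
  obtain ⟨p, hp⟩ := hf
  obtain ⟨q, hq⟩ := hg
  exact ⟨p * q, fun a => by rw [Polynomial.eval_mul]; exact Nat.mul_le_mul (hp a) (hq a)⟩

theorem comp {h : β → ℕ} (hh : PolyBd h) {k : α → β}
    (hk : PolyBd fun a => OracleTime.size (k a)) : PolyBd fun a => h (k a) := by
  obtain ⟨p, hp⟩ := hh
  obtain ⟨q, hq⟩ := hk
  exact ⟨p.comp q, fun a => by
    rw [Polynomial.eval_comp]; exact (hp _).trans (eval_mono p (hq a))⟩

end PolyBd

/-- `f` is computed in polynomial time with oracle `O`: some program replaces the code of `a` on top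
of stack `0` by the code of `f a`. -/
def PolyTime (O : Language Bool) {α β : Type} [Enc α] [Enc β] (f : α → β) : Prop :=
  ∃ (p : Prog) (τ : α → ℕ), PolyBd τ ∧ PolyBd (fun a => size (f a)) ∧
    ∀ a r, Eval O p (st (bits a ++ r) [] [] []) (τ a) (st (bits (f a) ++ r) [] [] [])

namespace PolyTime

variable {O : Language Bool} {α β γ : Type} [Enc α] [Enc β] [Enc γ]

theorem polyBd {f : α → β} (hf : PolyTime O f) : PolyBd fun a => size (f a) := by
  obtain ⟨_, _, _, h, _⟩ := hf
  exact h

/-- The empty program suffices. This covers all constructors and destructors that are invisible in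
the code, such as passing from a pair of head and tail to a list. -/
theorem recode {f : α → β} (h : ∀ a, Enc.code (f a) = Enc.code a) : PolyTime O f := by
  have h' : ∀ a, bits (f a) = bits a := fun a => congrArg Data.bits (h a)
  exact ⟨.skip, fun _ => 1, .const 1, PolyBd.size.of_le fun a => (congrArg List.length (h' a)).le,
    fun a r => by rw [h']; exact .skip le_rfl⟩

theorem id : PolyTime O fun a : α => a := recode fun _ => rfl

theorem comp {g : β → γ} {f : α → β} (hg : PolyTime O g) (hf : PolyTime O f) :
    PolyTime O fun a => g (f a) := by
  obtain ⟨p, τ, hτ, hs, hp⟩ := hf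
  obtain ⟨q, τ', hτ', hs', hq⟩ := hg
  exact ⟨.seq p q, fun a => τ a + τ' (f a), hτ.add (hτ'.comp hs), hs'.comp hs,
    fun a r => (hp a r).seq' (hq _ r)⟩

theorem const (c : β) : PolyTime O fun _ : α => c :=
  ⟨.seq .drop (.write (bits c)), fun a => 7 * size a + 3 + (size c + 1),
    (((PolyBd.const 7).mul .size).add (.const 3)).add (.const _), .const _,
    fun a _ => (Eval.drop (Enc.code a)).seq' (Eval.write _)⟩

/-- Programs leave the part of stack `0` below their argument untouched. So a copy of the argument
can wait there while `g` is computed, and then the value of `g` waits while `f` is computed. The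
final push of `true` turns two adjacent trees into a pair. -/
theorem mk {f : α → β} {g : α → γ} (hf : PolyTime O f) (hg : PolyTime O g) :
    PolyTime O fun a => (f a, g a) := by
  obtain ⟨p, τ, hτ, hs, hp⟩ := hf
  obtain ⟨q, τ', hτ', hs', hq⟩ := hg
  refine ⟨.seq .dup (.seq q (.seq .swap (.seq p (.push 0 true)))),
    fun a => (12 * size a + 5) + (τ' a + ((7 * size (g a) + 7 * size a + 6) + (τ a + 1))),
    ?_, ((hs.add hs').add (.const 1)).of_le fun a => (size_prod _).le, fun a r => ?_⟩
  · exact (((PolyBd.const 12).mul .size).add (.const 5)).add (hτ'.add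
      (((((PolyBd.const 7).mul hs').add ((PolyBd.const 7).mul .size)).add (.const 6)).add
      (hτ.add (.const 1))))
  · refine (Eval.dup (Enc.code a)).seq' ((hq a _).seq' ((Eval.swap (Enc.code (g a))
      (Enc.code a)).seq' ((hp a _).seq' ?_)))
    simpa [bits_prod] using! Eval.push_zero

theorem fst : PolyTime O fun x : α × β => x.1 := by
  refine ⟨.pop 0 .skip .skip (.seq .swap .drop),
    fun x => ((7 * size x.1 + 7 * size x.2 + 6) + (7 * size x.2 + 3)) + 1, ?_, ?_, fun x r => ?_⟩
  · exact (((PolyBd.const 14).mul .size).add (.const 10)).of_le fun x => by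
      rw [size_prod]; omega
  · exact PolyBd.size.of_le fun x => by rw [size_prod]; dsimp only; omega
  · rw [bits_prod, List.cons_append, List.append_assoc]
    exact Eval.pop_zero ((Eval.swap (Enc.code x.1) (Enc.code x.2)).seq' (Eval.drop (Enc.code x.2)))

theorem snd : PolyTime O fun x : α × β => x.2 := by
  refine ⟨.pop 0 .skip .skip .drop, fun x => (7 * size x.1 + 3) + 1, ?_, ?_, fun x r => ?_⟩
  · exact (((PolyBd.const 7).mul .size).add (.const 4)).of_le fun x => by
      rw [size_prod]; omega
  · exact PolyBd.size.of_le fun x => by rw [size_prod]; dsimp only; omega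
  · rw [bits_prod, List.cons_append, List.append_assoc]
    exact Eval.pop_zero (Eval.drop (Enc.code x.1))

theorem ite {c : α → Bool} {f g : α → β} (hc : PolyTime O c) (hf : PolyTime O f)
    (hg : PolyTime O g) : PolyTime O fun a => if c a then f a else g a := by
  obtain ⟨p₀, τ₀, hτ₀, hs₀, hp₀⟩ := hc
  obtain ⟨p, τ, hτ, hs, hp⟩ := hf
  obtain ⟨q, τ', hτ', hs', hq⟩ := hg
  -- The code of `true` is `[true, false, false]` and that of `false` is `[false]`, hence three pops
  -- on the way to `p` and one on the way to `q`.
  refine ⟨.seq .dup (.seq p₀ (.pop 0 .skip q (.pop 0 .skip (.pop 0 .skip p .skip) .skip))),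
    fun a => (12 * size a + 5) + (τ₀ a + (τ a + τ' a + 3)), ?_,
    (hs.add hs').of_le fun a => ?_, fun a r => ?_⟩
  · exact (((PolyBd.const 12).mul .size).add (.const 5)).add
      (hτ₀.add ((hτ.add hτ').add (.const 3)))
  · dsimp only
    split <;> omega
  · refine (Eval.dup (Enc.code a)).seq' ((hp₀ a _).seq' ?_)
    cases h : c a
    · exact (Eval.pop_zero (t := τ' a) (by simpa [h] using! hq a r)).mono (by omega)
    · exact (Eval.pop_zero (Eval.pop_zero (Eval.pop_zero (t := τ a)
        (by simpa [h] using! hp a r)))).mono (by omega)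

theorem nil : PolyTime O fun _ : α => ([] : List β) := const []

theorem cons {f : α → β} {g : α → List β} (hf : PolyTime O f) (hg : PolyTime O g) :
    PolyTime O fun a => f a :: g a :=
  (recode (f := fun x : β × List β => x.1 :: x.2) fun _ => rfl).comp (hf.mk hg)

theorem some {f : α → β} (hf : PolyTime O f) : PolyTime O fun a => Option.some (f a) :=
  (recode (f := fun x : Unit × β => Option.some x.2) fun _ => rfl).comp ((const ()).mk hf)

theorem listCases {l : α → List β} {f : α → γ} {g : α → β → List β → γ} (hl : PolyTime O l)
    (hf : PolyTime O f) (hg : PolyTime O fun x : (β × List β) × α => g x.2 x.1.1 x.1.2) :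
    PolyTime O fun a => match l a with
      | [] => f a
      | b :: l => g a b l := by
  obtain ⟨p, τ, hτ, hs, hp⟩ := hf
  obtain ⟨q, τ', hτ', hs', hq⟩ := hg
  have key : PolyTime O fun x : List β × α => match x.1 with
      | [] => f x.2
      | b :: l => g x.2 b l := by
    -- The first bit belongs to the pair, the second one tells whether the list is empty. In the
    -- nonempty case both are put back, since `(b :: l, a)` and `((b, l), a)` have the same code.
    refine ⟨.pop 0 .skip .skip (.pop 0 .skip p (.seq (.push 0 true) (.seq (.push 0 true) q))),
      fun x => (match x.1 with
      | [] => τ x.2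
      | b :: l => τ' ((b, l), x.2)) + 4, ?_, ?_, fun x r => ?_⟩
    · obtain ⟨P, hP⟩ := hτ
      obtain ⟨Q, hQ⟩ := hτ'
      refine PolyBd.add ⟨P + Q, ?_⟩ (.const 4)
      rintro ⟨_ | ⟨b, l⟩, a⟩
      · rw [Polynomial.eval_add]
        exact ((hP a).trans (eval_mono P (by rw [size_prod]; dsimp only; omega))).trans
          (Nat.le_add_right _ _)
      · rw [Polynomial.eval_add]
        exact ((hQ ((b, l), a)).trans (eval_mono Q (by simp only [size_prod, size_cons]; omega))).trans
          (Nat.le_add_left _ _)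
    · obtain ⟨P, hP⟩ := hs
      obtain ⟨Q, hQ⟩ := hs'
      refine ⟨P + Q, ?_⟩
      rintro ⟨_ | ⟨b, l⟩, a⟩
      · rw [Polynomial.eval_add]
        exact ((hP a).trans (eval_mono P (by rw [size_prod]; dsimp only; omega))).trans
          (Nat.le_add_right _ _)
      · rw [Polynomial.eval_add]
        exact ((hQ ((b, l), a)).trans (eval_mono Q (by simp only [size_prod, size_cons]; omega))).trans
          (Nat.le_add_left _ _)
    · obtain ⟨_ | ⟨b, l⟩, a⟩ := x
      · exact (Eval.pop_zero (Eval.pop_zero (hp a r))).mono (by dsimp only; omega)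
      · have := hq ((b, l), a) r
        simp only [bits_prod, bits_cons, List.cons_append, List.append_assoc] at this ⊢
        exact (Eval.pop_zero (Eval.pop_zero (Eval.push_zero.seq' (Eval.push_zero.seq'
          this)))).mono (by omega)
  exact key.comp (hl.mk id)

theorem optionCases {l : α → Option β} {f : α → γ} {g : α → β → γ} (hl : PolyTime O l)
    (hf : PolyTime O f) (hg : PolyTime O fun x : β × α => g x.2 x.1) :
    PolyTime O fun a => match l a with
      | none => f a
      | .some b => g a b := by
  obtain ⟨p, τ, hτ, hs, hp⟩ := hf
  obtain ⟨q, τ', hτ', hs', hq⟩ := hg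
  have key : PolyTime O fun x : Option β × α => match x.1 with
      | none => f x.2
      | .some b => g x.2 b := by
    refine ⟨.pop 0 .skip .skip (.pop 0 .skip p (.pop 0 .skip (.seq (.push 0 true) q) .skip)),
      fun x => (match x.1 with
      | none => τ x.2
      | .some b => τ' (b, x.2)) + 4, ?_, ?_, fun x r => ?_⟩
    · obtain ⟨P, hP⟩ := hτ
      obtain ⟨Q, hQ⟩ := hτ'
      refine PolyBd.add ⟨P + Q, ?_⟩ (.const 4)
      rintro ⟨_ | b, a⟩
      · rw [Polynomial.eval_add]
        exact ((hP a).trans (eval_mono P (by rw [size_prod]; dsimp only; omega))).trans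
          (Nat.le_add_right _ _)
      · rw [Polynomial.eval_add]
        exact ((hQ (b, a)).trans (eval_mono Q (by simp only [size_prod, size_some]; omega))).trans
          (Nat.le_add_left _ _)
    · obtain ⟨P, hP⟩ := hs
      obtain ⟨Q, hQ⟩ := hs'
      refine ⟨P + Q, ?_⟩
      rintro ⟨_ | b, a⟩
      · rw [Polynomial.eval_add]
        exact ((hP a).trans (eval_mono P (by rw [size_prod]; dsimp only; omega))).trans
          (Nat.le_add_right _ _)
      · rw [Polynomial.eval_add]
        exact ((hQ (b, a)).trans (eval_mono Q (by simp only [size_prod, size_some]; omega))).trans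
          (Nat.le_add_left _ _)
    · obtain ⟨_ | b, a⟩ := x
      · exact (Eval.pop_zero (Eval.pop_zero (hp a r))).mono (by dsimp only; omega)
      · have := hq (b, a) r
        simp only [bits_prod, bits_some, List.cons_append, List.append_assoc] at this ⊢
        exact (Eval.pop_zero (Eval.pop_zero (Eval.pop_zero (Eval.push_zero.seq'
          this)))).mono (by omega)
  exact key.comp (hl.mk id)

end PolyTime

end OracleTime

/-! ### Folds over lists -/

namespace OracleTime

open Turing

namespace PolyTime

variable {O : Language Bool} {α β γ : Type} [Enc α] [Enc β] [Enc γ]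

/-- Pushes `true` on stack `2` if the first component of the pair on stack `0` is not `nil`. -/
def probe : Prog :=
  .pop 0 .skip .skip (.pop 0 .skip (.seq (.push 0 false) (.push 0 true))
    (.seq (.push 0 true) (.seq (.push 0 true) (.push 2 true))))

theorem eval_probe_nil (x : γ) (r : List Bool) :
    Eval O probe (st (bits (([] : List β), x) ++ r) [] [] []) 5
      (st (bits (([] : List β), x) ++ r) [] [] []) :=
  (Eval.pop_zero (Eval.pop_zero (Eval.push_zero.seq' Eval.push_zero))).mono (by omega)

theorem eval_probe_cons (b : β) (l : List β) (x : γ) (r : List Bool) :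
    Eval O probe (st (bits (b :: l, x) ++ r) [] [] []) 5 (st (bits ((b, l), x) ++ r) [] [true] []) :=
  (Eval.pop_zero (Eval.pop_zero (Eval.push_zero.seq' (Eval.push_zero.seq' Eval.push_two)))).mono
    (by omega)

/-- The loop works on the remaining list, the accumulator and the parameter, with a flag on stack
`2` that `probe` sets as long as the list is nonempty. The bound on the accumulator at every prefix
is essential: a step that is polynomial in the current size could otherwise make the size explode
after many rounds. -/
theorem foldl {l : α → List β} {s : α → γ} {g : α → γ → β → γ} (hl : PolyTime O l)
    (hs : PolyTime O s) (hg : PolyTime O fun x : (β × γ) × α => g x.2 x.1.2 x.1.1) {B : α → ℕ}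
    (hB : PolyBd B) (h : ∀ a l', l' <+: l a → size (l'.foldl (g a) (s a)) ≤ B a) :
    PolyTime O fun a => (l a).foldl (g a) (s a) := by
  have hbody : PolyTime O fun x : (β × List β) × (γ × α) =>
      (x.1.2, (g x.2.2 x.2.1 x.1.1, x.2.2)) :=
    (snd.comp fst).mk ((hg.comp (((fst.comp fst).mk (fst.comp snd)).mk (snd.comp snd))).mk
      (snd.comp snd))
  obtain ⟨p, τ, hτ, -, hp⟩ := hbody
  have key : ∀ (a : α) (r : List Bool) (T : ℕ) (l : List β) (c : γ),
      (∀ l₁ b l₂, l = l₁ ++ b :: l₂ → τ ((b, l₂), (l₁.foldl (g a) c, a)) ≤ T) →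
      Eval O (.seq probe (.loop 2 .skip (.seq p probe))) (st (bits (l, (c, a)) ++ r) [] [] [])
        (l.length * (T + 10) + 10)
        (st (bits (([] : List β), (l.foldl (g a) c, a)) ++ r) [] [] []) := by
    intro a r T l
    induction l with
    | nil => exact fun c _ => ((eval_probe_nil _ r).seq' Eval.loop_two_nil).mono (by simp)
    | cons b l ih =>
      intro c hT
      have hT' := hT [] b l rfl
      have := ih (g a c b) fun l₁ b' l₂ e => hT (b :: l₁) b' l₂ (by rw [e]; rfl)
      -- The run for the remaining list begins with a `probe`; it is split off and becomes the end
      -- of the current loop body.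
      cases this with
      | seq h₁ h₂ h₃ =>
        refine ((eval_probe_cons b l (c, a) r).seq' (Eval.loop_two
          ((hp ((b, l), (c, a)) r).seq' h₁) h₂)).mono ?_
        simp only [List.length_cons, Nat.add_mul, List.foldl_nil] at hT' h₃ ⊢
        omega
  have hbd : PolyBd fun a => size (l a) + B a + size a + 2 :=
    ((hl.polyBd.add hB).add .size).add (.const 2)
  obtain ⟨Q, hQ⟩ := hτ
  obtain ⟨P, hP⟩ := hbd
  have main : PolyTime O fun a => (([] : List β), ((l a).foldl (g a) (s a), a)) := by
    obtain ⟨p₁, τ₁, hτ₁, -, hp₁⟩ := hl.mk (hs.mk id)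
    have hsz : PolyBd fun a => size ((l a).foldl (g a) (s a)) := hB.of_le fun a => h a _ (List.prefix_refl _)
    refine ⟨.seq p₁ (.seq probe (.loop 2 .skip (.seq p probe))),
      fun a => τ₁ a + (size (l a) * (Q.eval (P.eval (size a)) + 10) + 10), ?_, ?_, fun a r => ?_⟩
    · exact hτ₁.add ((hl.polyBd.mul (PolyBd.add ⟨Q.comp P, fun a => by
        rw [Polynomial.eval_comp]⟩ (.const 10))).add (.const 10))
    · exact ((hsz.add .size).add (.const 3)).of_le fun a => by
        simp only [size_prod, size_nil]; omega
    · refine ((hp₁ a r).seq' ((key a r (Q.eval (P.eval (size a))) (l a) (s a)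
        fun l₁ b l₂ e => (hQ _).trans (eval_mono Q (le_trans ?_ (hP a)))).mono ?_))
      · have h₁ := h a l₁ ⟨b :: l₂, e.symm⟩
        have h₂ : size (b :: l₂) ≤ size (l a) := by
          rw [e]; exact size_le_of_sublist (List.sublist_append_right _ _)
        simp only [size_prod, size_cons] at h₂ ⊢
        omega
      · gcongr
        exact (length_lt_size _).le
  exact fst.comp (snd.comp main)

end PolyTime

/-! ### Case distinction over finite types -/

/-- Unary numerals. -/
def unary : ℕ → Data
  | 0 => .nil
  | n + 1 => .cons .nil (unary n)

/-- Elements of a finite type, in unary notation. -/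
@[reducible] noncomputable def Enc.ofFintype (ι : Type) [Fintype ι] : Enc ι :=
  ⟨fun i => unary (Fintype.equivFin ι i)⟩

/-- Finite types that are encoded in unary notation. -/
class FinEnc (ι : Type) [Enc ι] : Prop where
  exists_equiv : ∃ (n : ℕ) (e : ι ≃ Fin n), ∀ i, Enc.code i = unary (e i)

theorem FinEnc.exists_bound (ι : Type) [Enc ι] [FinEnc ι] : ∃ c, ∀ i : ι, size i ≤ c := by
  obtain ⟨n, e, -⟩ := FinEnc.exists_equiv (ι := ι)
  have := Finite.of_equiv _ e.symm
  obtain ⟨c, hc⟩ := (Set.finite_range (size : ι → ℕ)).bddAbove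
  exact ⟨c, fun i => hc ⟨i, rfl⟩⟩

namespace PolyTime

variable {O : Language Bool} {α β γ : Type} [Enc α] [Enc β] [Enc γ]

/-- Nothing uniform in `i` is required: the program contains one subprogram for each of the finitely
many values, and a chain of nested pops reads the numeral and selects among them. The value `i + 1`
is preceded by the two bits `true`, `false` in front of the numeral for `i`. -/
theorem exists_unaryCases (n : ℕ) : ∀ F : Fin n → α → γ, (∀ i, PolyTime O (F i)) →
    ∃ (p : Prog) (τ σ : α → ℕ), PolyBd τ ∧ PolyBd σ ∧ ∀ i a, size (F i a) ≤ σ a ∧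
      ∀ r, Eval O p (st ((unary i).bits ++ (bits a ++ r)) [] [] []) (τ a)
        (st (bits (F i a) ++ r) [] [] []) := by
  induction n with
  | zero => exact fun F _ => ⟨.skip, fun _ => 0, fun _ => 0, .const 0, .const 0, fun i => i.elim0⟩
  | succ n ih =>
    intro F hF
    obtain ⟨p, τ, σ, hτ, hσ, hp⟩ := ih (fun i => F i.succ) fun i => hF _
    obtain ⟨p₀, τ₀, hτ₀, hσ₀, hp₀⟩ := hF 0
    refine ⟨.pop 0 .skip p₀ (.pop 0 .skip p .skip), fun a => τ₀ a + τ a + 2,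
      fun a => size (F 0 a) + σ a, (hτ₀.add hτ).add (.const 2), hσ₀.add hσ, fun i a => ?_⟩
    refine Fin.cases ⟨Nat.le_add_right _ _, fun r => ?_⟩ (fun i => ⟨?_, fun r => ?_⟩) i
    · exact (Eval.pop_zero (hp₀ a r)).mono (by dsimp only; omega)
    · exact ((hp i a).1).trans (Nat.le_add_left _ _)
    · exact (Eval.pop_zero (Eval.pop_zero ((hp i a).2 r))).mono (by dsimp only; omega)

theorem finCases {ι : Type} [Enc ι] [FinEnc ι] {i : α → ι} {F : ι → α → γ} (hi : PolyTime O i)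
    (hF : ∀ i, PolyTime O (F i)) : PolyTime O fun a => F (i a) a := by
  obtain ⟨n, e, he⟩ := FinEnc.exists_equiv (ι := ι)
  obtain ⟨p, τ, σ, hτ, hσ, hp⟩ := exists_unaryCases n (fun j => F (e.symm j)) fun j => hF _
  have hp' : ∀ (i : ι) a, size (F i a) ≤ σ a ∧
      ∀ r, Eval O p (st (bits i ++ (bits a ++ r)) [] [] []) (τ a) (st (bits (F i a) ++ r) [] [] []) := by
    intro i a
    have := hp (e i) a
    rw [Equiv.symm_apply_apply, ← he] at this
    exact this
  have hsnd {f : α → ℕ} (hf : PolyBd f) : PolyBd fun x : ι × α => f x.2 := hf.comp (snd (O := O)).polyBd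
  have key : PolyTime O fun x : ι × α => F x.1 x.2 := by
    refine ⟨.pop 0 .skip .skip p, fun x => τ x.2 + 1, (hsnd hτ).add (.const 1),
      (hsnd hσ).of_le fun x => (hp' x.1 x.2).1, fun x r => ?_⟩
    rw [bits_prod, List.cons_append, List.append_assoc]
    exact Eval.pop_zero ((hp' x.1 x.2).2 r)
  exact key.comp (hi.mk id)

theorem finite {ι : Type} [Enc ι] [FinEnc ι] (F : ι → γ) : PolyTime O F :=
  finCases (α := ι) (F := fun i _ => F i) id fun _ => const _

/-! Queries and inputs -/

/-- Pops the code of a list of bits from stack `0` and pushes the list, reversed, on stack `1`. -/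
def unpack : Prog :=
  .loop 3 .skip (.pop 0 .skip .skip (.pop 0 .skip (.seq (.push 1 false) (.push 3 true))
    (.pop 0 .skip (.pop 0 .skip (.seq (.push 1 true) (.push 3 true)) .skip) .skip)))

/-- The flag on stack `3` keeps the loop going: every round consumes it, and it is renewed unless
the end of the list was read. -/
theorem eval_unpack (w : List Bool) : ∀ {a b}, Eval O unpack (st (bits w ++ a) b [] [true])
    (7 * w.length + 4) (st a (w.reverse ++ b) [] []) := by
  induction w with
  | nil => exact (Eval.loop_three (Eval.pop_zero (.skip le_rfl)) Eval.loop_three_nil).mono (by simp)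
  | cons x w ih =>
    intro a b
    rw [List.reverse_cons, List.append_assoc]
    cases x
    · exact (Eval.loop_three (Eval.pop_zero (Eval.pop_zero (Eval.push_one.seq' Eval.push_three)))
        ih).mono (by simp; omega)
    · exact (Eval.loop_three (Eval.pop_zero (Eval.pop_zero (Eval.pop_zero (Eval.pop_zero
        (Eval.push_one.seq' Eval.push_three))))) ih).mono (by simp; omega)

/-- Pops a list of bits from stack `2` and pushes its code on stack `0`. -/
def pack : Prog :=
  .loop 2 (.seq (.push 0 false) (.push 0 true))
    (.seq (.push 0 false) (.seq (.push 0 false) (.seq (.push 0 true) (.push 0 true))))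

theorem eval_pack (w : List Bool) : ∀ {v}, Eval O pack (st (bits v) [] w [])
    (5 * w.length + 1) (st (bits (w.reverse ++ v)) [] [] []) := by
  induction w with
  | nil => exact Eval.loop_two_nil
  | cons x w ih =>
    intro v
    rw [List.reverse_cons, List.append_assoc]
    cases x
    · exact (Eval.loop_two (Eval.push_zero.seq' Eval.push_zero) ih).mono (by simp; omega)
    · exact (Eval.loop_two (Eval.push_zero.seq' (Eval.push_zero.seq' (Eval.push_zero.seq'
        Eval.push_zero))) ih).mono (by simp; omega)

end PolyTime

open Classical in
/-- The characteristic function of a language. -/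
noncomputable def char (L : Language Bool) (w : List Bool) : Bool := decide (w ∈ L)

theorem char_eq_true {L : Language Bool} {w : List Bool} : char L w = true ↔ w ∈ L := by
  simp [char]

/-- Unpacking leaves the word reversed on stack `1`, and pouring it to the query stack restores its
order. The query erases that stack, so only the answer has to be written. -/
theorem PolyTime.oracle (O : Language Bool) : PolyTime O (char O) := by
  refine ⟨.seq (.push 3 true) (.seq unpack (.seq (.pour 1 2)
    (.query (.write (bits false)) (.write (bits true))))),
    fun w => 1 + ((7 * size w + 4) + ((2 * size w + 1) + 5)), ?_, ?_, fun w r => ?_⟩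
  · exact (((PolyBd.const 9).mul .size).add (.const 11)).of_le fun w => by omega
  · exact (PolyBd.const 3).of_le fun w => size_bool _
  · have hw := length_lt_size w
    have h₁ : Eval O (.pour 1 2) (st r (w.reverse ++ []) [] []) (2 * size w + 1) (st r [] w []) := by
      simpa using (Eval.pour_one_two (O := O) (a := r) (c := []) (d := []) w.reverse).mono
        (t' := 2 * size w + 1) (by simp; omega)
    refine Eval.push_three.seq' (((eval_unpack w).mono (by omega)).seq' (h₁.seq' ?_))
    have e : Function.update (st r [] w []) 2 [] = st r [] [] [] := st_update_two
    by_cases h : w ∈ O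
    · rw [char_eq_true.2 h]
      exact .queryTrue h (e ▸ Eval.write (bits true)) le_rfl
    · rw [Bool.eq_false_iff.2 (mt char_eq_true.1 h)]
      exact .queryFalse h (e ▸ Eval.write (bits false)) (by decide)

theorem size_word (w : List Bool) : size w ≤ 4 * w.length + 1 := by
  induction w with
  | nil => simp [size_nil]
  | cons b w ih =>
    have := size_bool b
    simp only [size_cons, List.length_cons]
    omega

/-- The machine first converts the raw input on stack `1` into the code of a list on stack `0`. A
list is coded from its end, hence the detour through stack `2`, which reverses the word. -/
theorem PolyTime.mem_PRel {O L : Language Bool} {f : List Bool → Bool} (hf : PolyTime O f)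
    (h : ∀ w, f w = true ↔ w ∈ L) : L ∈ PRel O := by
  obtain ⟨p, τ, ⟨Q, hQ⟩, -, hp⟩ := hf
  refine ⟨(Prog.seq (.pour 1 2) (.seq (.push 0 false) (.seq pack p))).machine,
    -- The code of a word of length `n` has size at most `4n + 1`; the remaining terms pay for
    -- pouring, packing and the final pop.
    Q.comp (4 * .X + 1) + 7 * .X + 5, fun w => ?_⟩
  have e : Function.update (fun _ => []) 1 w = st [] w [] [] := by
    funext i; fin_cases i <;> rfl
  have h₁ := eval_pack (O := O) w.reverse (v := [])
  have h₂ := hp w []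
  rw [List.reverse_reverse, List.append_nil] at h₁
  rw [List.append_nil, List.append_nil] at h₂
  have h₃ := (Eval.pour_one_two (O := O) (a := []) (c := []) (d := []) w).seq'
    (Eval.push_zero.seq' (((List.append_nil w.reverse).symm ▸ h₁).seq' h₂))
  rw [← e] at h₃
  obtain ⟨r₁, r₂⟩ := Prog.machine_run h₃
    (n := (Q.comp (4 * .X + 1) + 7 * .X + 5).eval w.length) (by
      have := (hQ w).trans (eval_mono Q (size_word w))
      simp only [Polynomial.eval_add, Polynomial.eval_comp, Polynomial.eval_mul,
        Polynomial.eval_X, Polynomial.eval_ofNat, Polynomial.eval_one, List.length_append, List.length_reverse, List.length_nil]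
      omega)
  refine ⟨r₁, r₂.trans ((iff_of_eq ?_).trans (h w))⟩
  -- The code of a Boolean begins with that Boolean, and this is the bit on which the machine
  -- accepts.
  change ((bits (f w)).head? = Option.some true) = _
  cases f w <;> simp [bits_true, bits_false]

end OracleTime

/-! ### List operations, bounded iteration and clocks -/

namespace OracleTime

instance : FinEnc Bool where
  exists_equiv := ⟨2, finTwoEquiv.symm, fun i => by cases i <;> rfl⟩

theorem size_flatMap_le {β γ : Type} [Enc β] [Enc γ] (l : List β) (f : β → List γ) (T : ℕ)
    (h : ∀ b ∈ l, size (f b) ≤ T) : size (l.flatMap f) ≤ l.length * T + 1 := by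
  induction l with
  | nil => simp [size_nil]
  | cons b l ih =>
    have h₁ := size_append (f b) (l.flatMap f)
    have h₂ := ih fun b' hb' => h b' (List.mem_cons_of_mem _ hb')
    have h₃ := h b List.mem_cons_self
    rw [List.flatMap_cons, List.length_cons, Nat.add_mul]
    omega

namespace PolyTime

variable {O : Language Bool} {α β γ : Type} [Enc α] [Enc β] [Enc γ]

theorem not {c : α → Bool} (hc : PolyTime O c) : PolyTime O fun a => !c a :=
  (finite (!·)).comp hc

theorem and {c d : α → Bool} (hc : PolyTime O c) (hd : PolyTime O d) :
    PolyTime O fun a => c a && d a := by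
  have : (fun a => c a && d a) = fun a => if c a then d a else false := by
    funext a; cases c a <;> rfl
  exact this ▸ hc.ite hd (const false)

theorem reverse_append {l l' : α → List β} (hl : PolyTime O l) (hl' : PolyTime O l') :
    PolyTime O fun a => (l a).reverse ++ l' a := by
  have e : ∀ (l l' : List β), l.foldl (fun s b => b :: s) l' = l.reverse ++ l' := by
    intro l
    induction l with
    | nil => simp
    | cons b l ih => intro l'; rw [List.foldl_cons, ih]; simp
  have := foldl hl hl' (g := fun _ s b => b :: s) ((fst.comp fst).cons (snd.comp fst))
    (hl.polyBd.add hl'.polyBd) fun a l₁ h => by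
      rw [e]
      have h₁ := size_append l₁.reverse (l' a)
      have h₂ := size_le_of_sublist h.sublist
      rw [size_reverse] at h₁
      omega
  simpa only [e] using this

theorem reverse {l : α → List β} (hl : PolyTime O l) : PolyTime O fun a => (l a).reverse := by
  simpa using hl.reverse_append (nil (β := β))

theorem append {l l' : α → List β} (hl : PolyTime O l) (hl' : PolyTime O l') :
    PolyTime O fun a => l a ++ l' a := by
  simpa using hl.reverse.reverse_append hl'

/-- The pieces are accumulated in reverse and the result is reversed at the end. The accumulator
never exceeds the number of elements times a common bound for the pieces. -/
theorem flatMap {l : α → List β} {f : α → β → List γ} (hl : PolyTime O l)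
    (hf : PolyTime O fun x : β × α => f x.2 x.1) : PolyTime O fun a => (l a).flatMap (f a) := by
  have e : ∀ a (l : List β) (s : List γ),
      l.foldl (fun s b => (f a b).reverse ++ s) s = (l.flatMap (f a)).reverse ++ s := by
    intro a l
    induction l with
    | nil => simp
    | cons b l ih => intro l'; rw [List.foldl_cons, ih]; simp
  obtain ⟨Q, hQ⟩ := hf.polyBd
  have hB : PolyBd fun a => size (l a) * Q.eval (size (l a) + size a + 1) + 2 :=
    (hl.polyBd.mul (PolyBd.comp (h := fun x : List β × α => Q.eval (size x))
      ⟨Q, fun _ => le_rfl⟩ (hl.mk id).polyBd |>.of_le fun a => by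
        rw [size_prod])).add (.const 2)
  have := foldl hl (nil (β := γ)) (g := fun a s b => (f a b).reverse ++ s)
    ((hf.comp ((fst.comp fst).mk snd)).reverse_append (snd.comp fst)) hB fun a l₁ h => by
      rw [e, List.append_nil, size_reverse]
      have h₀ := size_le_of_sublist h.sublist
      refine (size_flatMap_le l₁ (f a) (Q.eval (size (l a) + size a + 1)) fun b hb => ?_).trans ?_
      · refine (hQ (b, a)).trans (eval_mono Q ?_)
        have := size_le_of_mem hb
        rw [size_prod]
        dsimp only
        omega
      · have := (length_lt_size l₁).le.trans h₀
        have := Nat.mul_le_mul_right (Q.eval (size (l a) + size a + 1)) this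
        omega
  simp only [e, List.append_nil] at this
  simpa using this.reverse

theorem map {l : α → List β} {f : α → β → γ} (hl : PolyTime O l)
    (hf : PolyTime O fun x : β × α => f x.2 x.1) : PolyTime O fun a => (l a).map (f a) := by
  simpa only [List.map_eq_flatMap] using hl.flatMap (f := fun a b => [f a b]) (hf.cons nil)

theorem filter {l : α → List β} {f : α → β → Bool} (hl : PolyTime O l)
    (hf : PolyTime O fun x : β × α => f x.2 x.1) : PolyTime O fun a => (l a).filter (f a) := by
  have e : ∀ a (l : List β), l.flatMap (fun b => if f a b then [b] else []) = l.filter (f a) := by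
    intro a l
    induction l with
    | nil => rfl
    | cons b l ih => rw [List.flatMap_cons, ih, List.filter_cons]; split <;> rfl
  simpa only [e] using hl.flatMap (f := fun a b => if f a b then [b] else [])
    (hf.ite (fst.cons nil) nil)

theorem tail {l : α → List β} (hl : PolyTime O l) : PolyTime O fun a => (l a).tail := by
  have h := hl.listCases (f := fun _ => []) (g := fun _ _ l => l) nil (snd.comp fst)
  convert h using 2 with a
  cases l a <;> rfl

theorem head? {l : α → List β} (hl : PolyTime O l) : PolyTime O fun a => (l a).head? := by
  have h := hl.listCases (f := fun _ => none) (g := fun _ b _ => Option.some b) (const none)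
    (fst.comp fst).some
  convert h using 2 with a
  cases l a <;> rfl

theorem headD {l : α → List β} (c : β) (hl : PolyTime O l) :
    PolyTime O fun a => (l a).headD c := by
  have h := hl.listCases (f := fun _ => c) (g := fun _ b _ => b) (const c) (fst.comp fst)
  convert h using 2 with a
  cases l a <;> rfl

theorem isEmpty {l : α → List β} (hl : PolyTime O l) : PolyTime O fun a => (l a).isEmpty := by
  have h := hl.listCases (f := fun _ => true) (g := fun _ _ _ => false) (const _) (const _)
  convert h using 2 with a
  cases l a <;> rfl

/-- The list serves only as a unary counter for the number of rounds. -/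
theorem iterate {l : α → List β} {s : α → γ} {g : α → γ → γ} (hl : PolyTime O l)
    (hs : PolyTime O s) (hg : PolyTime O fun x : γ × α => g x.2 x.1) {B : α → ℕ}
    (hB : PolyBd B) (h : ∀ a n, n ≤ (l a).length → size ((g a)^[n] (s a)) ≤ B a) :
    PolyTime O fun a => (g a)^[(l a).length] (s a) := by
  have e : ∀ a (l : List β) s, l.foldl (fun s _ => g a s) s = (g a)^[l.length] s := by
    intro a l
    induction l with
    | nil => exact fun s => rfl
    | cons b l ih => exact fun s => ih (g a s)
  have := foldl hl hs (g := fun a s _ => g a s) (hg.comp ((snd.comp fst).mk snd)) hB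
    fun a l' hl' => by rw [e]; exact h a _ hl'.length_le
  simpa only [e] using this

/-- Clocks: the values of a polynomial in the length of a list, in unary notation. -/
theorem exists_clock (O : Language Bool) {β : Type} [Enc β] (q : Polynomial ℕ) :
    ∃ f : List β → List Unit, PolyTime O f ∧ ∀ w, (f w).length = q.eval w.length := by
  induction q using Polynomial.induction_on with
  | C n =>
    exact ⟨fun _ => List.replicate n (), const _, fun w => by simp⟩
  | add p q hp hq =>
    obtain ⟨f, hf, hf'⟩ := hp
    obtain ⟨g, hg, hg'⟩ := hq
    exact ⟨fun w => f w ++ g w, hf.append hg, fun w => by simp [hf', hg']⟩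
  | monomial n a h =>
    obtain ⟨f, hf, hf'⟩ := h
    -- Multiplication by the variable: every tick is replaced by as many ticks as `w` has letters.
    refine ⟨fun w => (f w).flatMap fun _ => w.map fun _ => (),
      hf.flatMap (snd.map (const ())), fun w => ?_⟩
    rw [pow_succ, ← mul_assoc, Polynomial.eval_mul, ← hf']
    simp

end PolyTime

end OracleTime

/-! Simulation of oracle machines -/

namespace OracleTime

open Turing

theorem PolyTime.of_code_eq {O : Language Bool} {α β γ : Type} [Enc α] [Enc β] [Enc γ] {f : α → β}
    {g : α → γ} (hf : PolyTime O f) (h : ∀ a, Enc.code (g a) = Enc.code (f a)) : PolyTime O g := by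
  obtain ⟨p, τ, hτ, hs, hp⟩ := hf
  have h' : ∀ a, bits (g a) = bits (f a) := fun a => congrArg Data.bits (h a)
  exact ⟨p, τ, hτ, hs.of_le fun a => (congrArg List.length (h' a)).le, fun a r => by
    rw [h']; exact hp a r⟩

theorem Enc.finEnc_ofFintype (ι : Type) [Fintype ι] : @FinEnc ι (Enc.ofFintype ι) :=
  @FinEnc.mk ι (Enc.ofFintype ι) ⟨_, Fintype.equivFin ι, fun _ => rfl⟩

namespace OracleTM

variable (M : OracleTM)

noncomputable instance : Enc M.Λ := .ofFintype _
noncomputable instance : Enc M.σ := .ofFintype _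
noncomputable instance (k : M.K) : Enc (M.Γ k) := .ofFintype _
instance : FinEnc M.Λ := Enc.finEnc_ofFintype _
instance : FinEnc M.σ := Enc.finEnc_ofFintype _
instance (k : M.K) : FinEnc (M.Γ k) := Enc.finEnc_ofFintype _

/-- Contents of the stacks of an oracle machine. -/
def Stk : Type := ∀ k, List (M.Γ k)

/-- The code of the stacks with indices in a given list. -/
noncomputable def stkCode (S : M.Stk) : List M.K → Data
  | [] => .nil
  | k :: ks => .cons (Enc.code (S k)) (stkCode S ks)

/-- The encoding of the stacks with indices in a given list. -/
@[reducible] noncomputable def stkEnc (ks : List M.K) : Enc M.Stk := ⟨fun S => M.stkCode S ks⟩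

/-- The encoding of pairs of stacks, with indices in a given list, and words. -/
@[reducible] noncomputable def stkEnc₂ (k : M.K) (ks : List M.K) : Enc (M.Stk × List (M.Γ k)) :=
  @instEncProd _ _ (M.stkEnc ks) _

noncomputable instance : Enc M.Stk := M.stkEnc Finset.univ.toList

variable {M} {O A : Language Bool}

/-- The stacks form a dependent function, coded along a list of indices. The induction on that list
changes the encoding of `M.Stk` itself, so the instances are passed explicitly. -/
theorem polyTime_get_aux (k : M.K) : ∀ ks : List M.K, k ∈ ks →
    @PolyTime O M.Stk (List (M.Γ k)) (M.stkEnc ks) _ fun S => S k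
  | k' :: ks, h => by
    let _ := M.stkEnc ks
    have h₀ : @PolyTime O M.Stk (List (M.Γ k') × M.Stk) (M.stkEnc (k' :: ks)) _ fun S => (S k', S) :=
      @PolyTime.recode O _ _ (M.stkEnc (k' :: ks)) _ _ fun _ => rfl
    by_cases hk : k = k'
    · subst hk
      exact @PolyTime.comp O _ _ _ (M.stkEnc (k :: ks)) _ _ _ _ PolyTime.fst h₀
    · have := polyTime_get_aux k ks ((List.mem_cons.1 h).resolve_left hk)
      exact @PolyTime.comp O _ _ _ (M.stkEnc (k' :: ks)) _ _ _ _ (this.comp PolyTime.snd) h₀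

theorem polyTime_get (k : M.K) : PolyTime O fun S : M.Stk => S k :=
  polyTime_get_aux k _ (by simp)

/-- Replacement of one stack. -/
def Stk.set (S : M.Stk) (k : M.K) (l : List (M.Γ k)) : M.Stk := Function.update S k l

theorem Stk.set_self (S : M.Stk) (k : M.K) (l : List (M.Γ k)) : S.set k l k = l :=
  Function.update_self ..

theorem Stk.set_of_ne (S : M.Stk) {k k' : M.K} (h : k' ≠ k) (l : List (M.Γ k)) :
    S.set k l k' = S k' :=
  Function.update_of_ne h ..

/-- The index `k` need not occur in `ks`, so the induction can start at the empty list. All entries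
are rebuilt, and only those at `k` differ. -/
theorem polyTime_set_aux (k : M.K) : ∀ ks : List M.K,
    @PolyTime O (M.Stk × List (M.Γ k)) M.Stk (M.stkEnc₂ k ks) (M.stkEnc ks)
      fun x => x.1.set k x.2
  | [] => by
    let _ := M.stkEnc []
    exact (PolyTime.const ()).of_code_eq fun _ => rfl
  | k' :: ks => by
    let _ := M.stkEnc ks
    have h₀ : @PolyTime O (M.Stk × List (M.Γ k)) ((List (M.Γ k') × M.Stk) × List (M.Γ k)) (M.stkEnc₂ k (k' :: ks))
        inferInstance fun x => ((x.1 k', x.1), x.2) :=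
      @PolyTime.recode O _ _ (M.stkEnc₂ k (k' :: ks)) _ _ fun _ => rfl
    have h₁ : PolyTime O fun x : (List (M.Γ k') × M.Stk) × List (M.Γ k) => x.1.2.set k x.2 :=
      (polyTime_set_aux k ks).comp ((PolyTime.snd.comp PolyTime.fst).mk PolyTime.snd)
    by_cases hk : k' = k
    · subst hk
      have h₂ := @PolyTime.comp O _ _ _ (M.stkEnc₂ k' (k' :: ks)) _ _ _ _ (PolyTime.snd.mk h₁) h₀
      refine @PolyTime.of_code_eq O _ _ _ (M.stkEnc₂ k' (k' :: ks)) _ (M.stkEnc (k' :: ks)) _ _ h₂ fun x => ?_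
      change Data.cons (Enc.code (x.1.set k' x.2 k')) _ = _
      rw [Stk.set_self]
      rfl
    · have h₂ := @PolyTime.comp O _ _ _ (M.stkEnc₂ k (k' :: ks)) _ _ _ _ ((PolyTime.fst.comp PolyTime.fst).mk h₁) h₀
      refine @PolyTime.of_code_eq O _ _ _ (M.stkEnc₂ k (k' :: ks)) _ (M.stkEnc (k' :: ks)) _ _ h₂ fun x => ?_
      change Data.cons (Enc.code (x.1.set k x.2 k')) _ = _
      rw [Stk.set_of_ne _ hk]
      rfl

theorem polyTime_set {α : Type} [Enc α] (k : M.K) {S : α → M.Stk} {l : α → List (M.Γ k)}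
    (hS : PolyTime O S) (hl : PolyTime O l) : PolyTime O fun a => (S a).set k (l a) :=
  PolyTime.comp (f := fun a => (S a, l a)) (polyTime_set_aux k _) (hS.mk hl)

/-- Every listed entry is charged with the growth `c`, although only those at `k` can change; this
crude count avoids any assumption on repetitions in `ks`. -/
theorem size_set_le_aux (S : M.Stk) (k : M.K) (l : List (M.Γ k)) (c : ℕ)
    (h : size l ≤ size (S k) + c) : ∀ ks : List M.K,
      (M.stkCode (S.set k l) ks).bits.length ≤ (M.stkCode S ks).bits.length + ks.length * c
  | [] => by simp [stkCode]
  | k' :: ks => by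
    have ih := size_set_le_aux S k l c h ks
    have : size (S.set k l k') ≤ size (S k') + c := by
      by_cases hk : k' = k
      · subst hk
        rwa [Stk.set_self]
      · rw [Stk.set_of_ne _ hk]
        omega
    simp only [size, bits] at this
    simp only [stkCode, Data.bits, List.length_cons, List.length_append, Nat.add_mul]
    omega

/-- The number of stacks. -/
noncomputable def width (M : OracleTM) : ℕ := (Finset.univ (α := M.K)).toList.length

theorem size_set_le (S : M.Stk) (k : M.K) (l : List (M.Γ k)) (c : ℕ)
    (h : size l ≤ size (S k) + c) : size (S.set k l) ≤ size S + M.width * c :=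
  size_set_le_aux S k l c h _

/-- Configurations as tuples. -/
abbrev Conf (M : OracleTM) : Type := Option M.Λ × M.σ × M.Stk

/-- The tuple of a configuration. -/
def toConf (c : M.Cfg) : M.Conf := (c.l, c.var, c.stk)

/-- The configuration of a tuple. -/
def ofConf (c : M.Conf) : M.Cfg := ⟨c.1, c.2.1, c.2.2⟩

theorem polyTime_head (k : M.K) (f : M.σ → Option (M.Γ k) → M.σ) :
    PolyTime O fun x : M.σ × M.Stk => f x.1 (x.2 k).head? := by
  refine PolyTime.finCases (F := fun v (x : M.σ × M.Stk) => f v (x.2 k).head?) PolyTime.fst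
    fun v => ?_
  have := (((polyTime_get (O := O) k).comp
    (PolyTime.snd (α := M.σ))).head?).optionCases (f := fun _ => f v none)
    (g := fun _ b => f v (some b)) (PolyTime.const _)
    ((PolyTime.finite fun b => f v (some b)).comp PolyTime.fst)
  convert this using 2 with x
  cases (x.2 k).head? <;> rfl

/-- The statement is part of the machine and hence fixed. Induction on it composes a bounded number
of polynomial-time operations, and the functions on letters and states are finite tables. -/
theorem polyTime_stepAux (q : TM2.Stmt M.Γ M.Λ M.σ) :
    PolyTime O fun x : M.σ × M.Stk => toConf (TM2.stepAux q x.1 x.2) := by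
  induction q with
  | push k f q ih =>
    exact PolyTime.comp (f := fun x : M.σ × M.Stk => (x.1, x.2.set k (f x.1 :: x.2 k))) ih
      (PolyTime.fst.mk (polyTime_set k PolyTime.snd (((PolyTime.finite f).comp PolyTime.fst).cons
        ((polyTime_get k).comp PolyTime.snd))))
  | peek k f q ih =>
    exact PolyTime.comp (f := fun x : M.σ × M.Stk => (f x.1 (x.2 k).head?, x.2)) ih
      ((polyTime_head k f).mk PolyTime.snd)
  | pop k f q ih =>
    exact PolyTime.comp (f := fun x : M.σ × M.Stk => (f x.1 (x.2 k).head?, x.2.set k (x.2 k).tail))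
      ih ((polyTime_head k f).mk (polyTime_set k PolyTime.snd
        ((polyTime_get k).comp PolyTime.snd).tail))
  | load f q ih =>
    exact PolyTime.comp (f := fun x : M.σ × M.Stk => (f x.1, x.2)) ih
      (((PolyTime.finite f).comp PolyTime.fst).mk PolyTime.snd)
  | branch f q₁ q₂ ih₁ ih₂ =>
    have := ((PolyTime.finite f).comp PolyTime.fst).ite ih₁ ih₂
    convert this using 2 with x
    change toConf (cond (f x.1) (TM2.stepAux q₁ x.1 x.2) (TM2.stepAux q₂ x.1 x.2)) = _
    cases f x.1 <;> rfl
  | goto f =>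
    exact ((PolyTime.finite f).comp PolyTime.fst).some.mk (PolyTime.fst.mk PolyTime.snd)
  | halt => exact (PolyTime.const none).mk (PolyTime.fst.mk PolyTime.snd)

/-- An additive constant is needed here: growth by a constant per step stays polynomial over
polynomially many steps, whereas a polynomial bound for each single step would not be enough. -/
theorem exists_size_stepAux_le (q : TM2.Stmt M.Γ M.Λ M.σ) :
    ∃ c, ∀ (v : M.σ) (S : M.Stk), size (toConf (TM2.stepAux q v S)).2.2 ≤ size S + c := by
  induction q with
  | push k f q ih =>
    obtain ⟨c, hc⟩ := ih
    obtain ⟨d, hd⟩ := FinEnc.exists_bound (M.Γ k)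
    refine ⟨M.width * (d + 1) + c, fun v S => (hc v (S.set k (f v :: S k))).trans ?_⟩
    have := size_set_le S k (f v :: S k) (d + 1) (by have := hd (f v); rw [size_cons]; omega)
    omega
  | peek k f q ih => exact ih.imp fun c hc v S => hc _ S
  | pop k f q ih =>
    obtain ⟨c, hc⟩ := ih
    refine ⟨c, fun v S => (hc _ (S.set k (S k).tail)).trans ?_⟩
    have := size_set_le S k (S k).tail 0 (size_le_of_sublist (List.tail_sublist _))
    omega
  | load f q ih => exact ih.imp fun c hc v S => hc _ S
  | branch f q₁ q₂ ih₁ ih₂ =>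
    obtain ⟨c, hc⟩ := ih₁
    obtain ⟨d, hd⟩ := ih₂
    refine ⟨c + d, fun v S => ?_⟩
    change size (toConf (cond (f v) (TM2.stepAux q₁ v S) (TM2.stepAux q₂ v S))).2.2 ≤ _
    cases f v
    · exact (hd v S).trans (by omega)
    · exact (hc v S).trans (by omega)
  | goto f => exact ⟨0, fun v S => le_rfl⟩
  | halt => exact ⟨0, fun v S => le_rfl⟩

/-- The step function on tuples. -/
noncomputable def confStep (M : OracleTM) (A : Language Bool) (c : M.Conf) : M.Conf :=
  toConf (M.step A (ofConf c))

theorem confStep_inl {l : M.Λ} {q : TM2.Stmt M.Γ M.Λ M.σ} (h : M.code l = .inl q)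
    (x : M.σ × M.Stk) : M.confStep A (some l, x) = toConf (TM2.stepAux q x.1 x.2) :=
  congrArg toConf (M.step_inl A h x.1 x.2)

theorem confStep_inr {l : M.Λ} {f : Bool → M.Λ} (h : M.code l = .inr f) (x : M.σ × M.Stk) :
    M.confStep A (some l, x) = (some (f (char A ((x.2 M.qStack).map M.qSym))), x.1,
      x.2.set M.qStack []) :=
  congrArg toConf (M.step_inr A h x.1 x.2 _ char_eq_true)

theorem polyTime_confStep (hA : PolyTime O (char A)) : PolyTime O (M.confStep A) := by
  have h₁ : PolyTime O fun x : M.Λ × M.Conf => M.confStep A (some x.1, x.2.2) := by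
    refine PolyTime.finCases (F := fun l (x : M.Λ × M.Conf) => M.confStep A (some l, x.2.2))
      PolyTime.fst fun l => ?_
    cases h : M.code l with
    | inl q =>
      simp only [confStep_inl h]
      exact (polyTime_stepAux q).comp (PolyTime.snd.comp PolyTime.snd)
    | inr f =>
      simp only [confStep_inr h]
      have hv : PolyTime O fun x : M.Λ × M.Conf => x.2.2.1 :=
        PolyTime.fst.comp (PolyTime.snd.comp PolyTime.snd)
      have hS : PolyTime O fun x : M.Λ × M.Conf => x.2.2.2 :=
        PolyTime.snd.comp (PolyTime.snd.comp PolyTime.snd)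
      exact ((PolyTime.finite f).comp (hA.comp (((polyTime_get M.qStack).comp hS).map
        ((PolyTime.finite M.qSym).comp PolyTime.fst)))).some.mk
        (hv.mk (polyTime_set M.qStack hS PolyTime.nil))
  have := (PolyTime.fst (O := O) (α := Option M.Λ) (β := M.σ × M.Stk)).optionCases
    (f := fun c => c) (g := fun c l => M.confStep A (some l, c.2)) PolyTime.id h₁
  convert this using 2 with c
  obtain ⟨_ | l, x⟩ := c <;> rfl

theorem exists_size_confStep_le (M : OracleTM) (A : Language Bool) :
    ∃ c, ∀ x : M.Conf, size (M.confStep A x).2.2 ≤ size x.2.2 + c := by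
  have : ∀ l, ∃ c, ∀ x : M.σ × M.Stk, size (M.confStep A (some l, x)).2.2 ≤ size x.2 + c := by
    intro l
    cases h : M.code l with
    | inl q =>
      simp only [confStep_inl h]
      exact (exists_size_stepAux_le q).imp fun c hc x => hc _ _
    | inr f =>
      simp only [confStep_inr h]
      exact ⟨0, fun x => size_set_le _ _ _ 0 (size_le_of_sublist (List.nil_sublist _))⟩
  choose c hc using this
  refine ⟨Finset.univ.sup c, ?_⟩
  rintro ⟨_ | l, x⟩
  · exact Nat.le_add_right _ _
  · exact (hc l x).trans (Nat.add_le_add_left (Finset.le_sup (Finset.mem_univ l)) _)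

theorem confStep_iterate (M : OracleTM) (A : Language Bool) (n : ℕ) (c : M.Cfg) :
    (M.confStep A)^[n] (toConf c) = toConf ((M.step A)^[n] c) := by
  induction n generalizing c with
  | zero => rfl
  | succ n ih => exact ih (M.step A c)

end OracleTM

/-- Oracle substitution. -/
theorem PolyTime.char_of_mem_PRel {O A L : Language Bool} (hA : PolyTime O (char A))
    (hL : L ∈ PRel A) : PolyTime O (char L) := by
  obtain ⟨M, q, hM⟩ := hL
  obtain ⟨clock, hclock, hq⟩ := exists_clock O (β := Bool) q
  have hinit : PolyTime O fun w => OracleTM.toConf (M.init w) :=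
    (const (Option.some M.main)).mk ((const M.start).mk (OracleTM.polyTime_set (M := M) M.inStack
      (const (β := M.Stk) fun _ => []) (id.map ((finite M.inSym).comp fst))))
  obtain ⟨c, hc⟩ := M.exists_size_confStep_le A
  obtain ⟨d, hd⟩ := FinEnc.exists_bound M.Λ
  obtain ⟨e, he⟩ := FinEnc.exists_bound M.σ
  have hsize : ∀ w n, size ((M.confStep A)^[n] (OracleTM.toConf (M.init w))).2.2 ≤
      size (OracleTM.toConf (M.init w)) + n * c := by
    intro w n
    induction n with
    | zero => simp only [Function.iterate_zero, id_eq, size_prod]; omega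
    | succ n ih =>
      rw [Function.iterate_succ_apply', Nat.add_mul]
      have := hc ((M.confStep A)^[n] (OracleTM.toConf (M.init w)))
      omega
  have hrun := hclock.iterate hinit (g := fun _ => M.confStep A)
    ((OracleTM.polyTime_confStep hA).comp fst)
    -- The stacks account for the first two summands. The constant covers the label with its two
    -- bits for `some`, the state, and one bit for each of the two pairs.
    (B := fun w => size (OracleTM.toConf (M.init w)) + size (clock w) * c + (d + e + 4))
    ((hinit.polyBd.add (hclock.polyBd.mul (.const c))).add (.const _)) fun w n hn => by
      have h₁ := hsize w n
      have h₂ := Nat.mul_le_mul_right c (hn.trans (length_lt_size _).le)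
      generalize (M.confStep A)^[n] (OracleTM.toConf (M.init w)) = x at h₁ ⊢
      obtain ⟨_ | l, v, S⟩ := x
      · have := he v
        simp only [size_prod, size_none] at h₁ ⊢
        omega
      · have := he v
        have := hd l
        simp only [size_prod, size_some] at h₁ ⊢
        omega
  have := (finite M.accept).comp (fst.comp (snd.comp hrun))
  convert this using 2 with w
  -- The clock has exactly as many ticks as the number of steps after which the machine is known to
  -- have halted with the right answer.
  rw [M.confStep_iterate, hq, Bool.eq_iff_iff, char_eq_true]
  exact (hM w).2.symm

end OracleTime

/-! Words over brackets and bits -/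

namespace DLN

open OracleTime

/-- The two bits of a letter, as a pair. -/
def Letter.toPair : Letter → Bool × Bool
  | .lpar => (true, false)
  | .rpar => (true, true)
  | .bit b => (false, b)

/-- The letter with given bits. -/
def Letter.ofPair : Bool → Bool → Letter
  | true, false => .lpar
  | true, true => .rpar
  | false, b => .bit b

instance : Enc Letter := ⟨fun x => Enc.code x.toPair⟩

theorem size_letter (x : Letter) : size x ≤ 7 := by
  have h : size x = size x.toPair := rfl
  have h₁ := size_bool x.toPair.1
  have h₂ := size_bool x.toPair.2
  rw [h, size_prod]
  omega

theorem size_letters (s : List Letter) : size s ≤ 8 * s.length + 1 := by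
  induction s with
  | nil => simp [size_nil]
  | cons x s ih =>
    have := size_letter x
    simp only [size_cons, List.length_cons]
    omega

section PolyTime

variable {O : Language Bool} {α β γ : Type} [Enc α] [Enc β] [Enc γ]

theorem polyTime_letter (F : Letter → β) : PolyTime O F := by
  have h : PolyTime O Letter.toPair := .recode fun _ => rfl
  have := (PolyTime.fst.comp h).ite ((PolyTime.snd.comp h).ite (.const (F .rpar))
    (.const (F .lpar))) ((PolyTime.finite fun b => F (.bit b)).comp (PolyTime.snd.comp h))
  convert this using 2 with x
  cases x <;> rfl

theorem polyTime_bit : PolyTime O Letter.bit := .finite _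

theorem polyTime_node {l : α → List Bool} {c : α → List (List Letter)} (hl : PolyTime O l)
    (hc : PolyTime O c) : PolyTime O fun a => node (l a) (c a) := by
  have h₁ : PolyTime O fun a => (l a).map Letter.bit := hl.map (polyTime_bit.comp .fst)
  have h₂ : PolyTime O fun a => (c a).flatten := by
    simpa only [List.flatMap_id'] using hc.flatMap (f := fun _ s => s) .fst
  exact ((PolyTime.const _).cons (h₁.append h₂)).append (.const _)

theorem polyTime_leaf {l : α → List Bool} (hl : PolyTime O l) : PolyTime O fun a => leaf (l a) :=
  polyTime_node hl .nil

theorem polyTime_word {c : α → List (List Letter)} (hc : PolyTime O c) :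
    PolyTime O fun a => word (c a) :=
  (polyTime_node (.const []) hc).flatMap ((polyTime_letter _).comp .fst)

/-- Growth by a constant in every round adds up to a bound linear in the length of the list. -/
theorem PolyTime.foldl_of_le {l : α → List β} {s : α → γ} {g : α → γ → β → γ} (hl : PolyTime O l)
    (hs : PolyTime O s) (hg : PolyTime O fun x : (β × γ) × α => g x.2 x.1.2 x.1.1) (c : ℕ)
    (h : ∀ a s b, size (g a s b) ≤ size s + c) : PolyTime O fun a => (l a).foldl (g a) (s a) := by
  have key : ∀ a (l : List β) s, size (l.foldl (g a) s) ≤ size s + l.length * c := by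
    intro a l
    induction l with
    | nil => simp
    | cons b l ih =>
      intro s
      have := ih (g a s b)
      have := h a s b
      simp only [List.foldl_cons, List.length_cons, Nat.add_mul]
      omega
  refine hl.foldl hs hg (hs.polyBd.add (hl.polyBd.mul (.const c))) fun a l' hl' => ?_
  have h₁ := key a l' (s a)
  have h₂ := Nat.mul_le_mul_right c (hl'.length_le.trans (length_lt_size _).le)
  omega

end PolyTime

/-! Reading bits in pairs -/

/-- Reads one more bit; the state holds a pending bit and the letters read so far. -/
def readBit (x : Option Bool × List Letter) (b : Bool) : Option Bool × List Letter :=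
  match x.1 with
  | none => (some b, x.2)
  | some a => (none, .ofPair a b :: x.2)

/-- The letters coded by a word. -/
def letters (w : List Bool) : List Letter := (w.foldl readBit (none, [])).2.reverse

theorem letters_flatMap_code (s : List Letter) : letters (s.flatMap Letter.code) = s := by
  have : ∀ (s t : List Letter), (s.flatMap Letter.code).foldl readBit (none, t) =
      (none, s.reverse ++ t) := by
    intro s
    induction s with
    | nil => simp
    | cons x s ih =>
      intro t
      rw [List.flatMap_cons, List.foldl_append, List.reverse_cons, List.append_assoc]
      rw [← show ∀ u, _ = (none, s.reverse ++ u) from ih]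
      cases x <;> rfl
  rw [letters, this]
  simp

theorem polyTime_letters {O : Language Bool} : PolyTime O letters := by
  have hg : PolyTime O fun x : (Bool × (Option Bool × List Letter)) × List Bool =>
      readBit x.1.2 x.1.1 := by
    have h₁ : PolyTime O fun x : (Bool × (Option Bool × List Letter)) × List Bool => x.1.1 :=
      .comp .fst .fst
    have h₂ : PolyTime O fun x : (Bool × (Option Bool × List Letter)) × List Bool => x.1.2 :=
      .comp .snd .fst
    have h₃ : PolyTime O fun x : Bool × Bool => Letter.ofPair x.1 x.2 := by
      have := (PolyTime.fst (O := O) (α := Bool) (β := Bool)).ite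
        ((PolyTime.finite (Letter.ofPair true)).comp .snd)
        ((PolyTime.finite (Letter.ofPair false)).comp .snd)
      convert this using 2 with x
      obtain ⟨_ | _, b⟩ := x <;> rfl
    have := (PolyTime.fst.comp h₂).optionCases (f := fun x => (some x.1.1, x.1.2.2))
      (g := fun x a => (none, Letter.ofPair a x.1.1 :: x.1.2.2)) (h₁.some.mk (PolyTime.snd.comp h₂))
      ((PolyTime.const none).mk ((h₃.comp (PolyTime.fst.mk (h₁.comp .snd))).cons
        (PolyTime.snd.comp (h₂.comp .snd))))
    convert this using 2 with x
    obtain ⟨⟨b, _ | a, t⟩, w⟩ := x <;> rfl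
  refine (PolyTime.snd.comp (PolyTime.foldl_of_le (α := List Bool) (g := fun _ => readBit) .id
    (.const (none, [])) hg 10 ?_)).reverse
  rintro - ⟨_ | a, t⟩ b
  · have := size_bool b
    simp only [readBit, size_prod, size_some, size_none]
    omega
  · have := size_letter (.ofPair a b)
    simp only [readBit, size_prod, size_some, size_none, size_cons]
    omega

/-! Balanced words -/

/-- The words that represent trees. -/
inductive IsTree : List Letter → Prop
  | node (w : List Bool) (c : List (List Letter)) : (∀ s ∈ c, IsTree s) → IsTree (node w c)

/-- States of the scanner: are we done, the number of open brackets in unary notation, and the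
letters taken and left so far. -/
abbrev ScanState : Type := (Bool × List Unit) × (List Letter × List Letter)

/-- The effect of a letter on the number of open brackets. -/
def depthStep (d : List Unit) : Letter → List Unit
  | .lpar => () :: d
  | .rpar => d.tail
  | .bit _ => d

/-- Scans one more letter. -/
def scanStep (z : ScanState) (x : Letter) : ScanState :=
  if z.1.1 then (z.1, (z.2.1, x :: z.2.2))
  else (((depthStep z.1.2 x).isEmpty, depthStep z.1.2 x), (x :: z.2.1, z.2.2))

/-- Splits a word after the bracket that closes the first one. -/
def splitTree (s : List Letter) : List Letter × List Letter :=
  ((s.foldl scanStep ((false, []), ([], []))).2.1.reverse,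
    (s.foldl scanStep ((false, []), ([], []))).2.2.reverse)

theorem foldl_scanStep_done (s : List Letter) : ∀ (d : List Unit) (t r : List Letter),
    s.foldl scanStep ((true, d), (t, r)) = ((true, d), (t, s.reverse ++ r)) := by
  induction s with
  | nil => intro d t r; rfl
  | cons x s ih =>
    intro d t r
    rw [List.foldl_cons, List.reverse_cons, List.append_assoc]
    exact ih d t (x :: r)

theorem foldl_scanStep_bits (w : List Bool) : ∀ (d : List Unit) (t r : List Letter),
    (w.map Letter.bit).foldl scanStep ((false, () :: d), (t, r)) =
      ((false, () :: d), ((w.map Letter.bit).reverse ++ t, r)) := by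
  induction w with
  | nil => intro d t r; rfl
  | cons x s ih =>
    intro d t r
    rw [List.map_cons, List.foldl_cons, List.reverse_cons, List.append_assoc]
    exact ih d (.bit x :: t) r

theorem foldl_scanStep_flatten (c : List (List Letter))
    (h : ∀ s ∈ c, ∀ (d : List Unit) (t r : List Letter),
      s.foldl scanStep ((false, () :: d), (t, r)) = ((false, () :: d), (s.reverse ++ t, r))) :
    ∀ (d : List Unit) (t r : List Letter), c.flatten.foldl scanStep ((false, () :: d), (t, r)) =
      ((false, () :: d), (c.flatten.reverse ++ t, r)) := by
  induction c with
  | nil => intro d t r; rfl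
  | cons s c ih =>
    intro d t r
    rw [List.flatten_cons, List.foldl_append, h s List.mem_cons_self,
      ih fun s hs => h s (List.mem_cons_of_mem _ hs)]
    simp

/-- With a bracket still open outside of `s`, the counter cannot reach zero within `s`, so the scan
takes all of `s` and returns to the old depth. -/
theorem IsTree.foldl_scanStep {s : List Letter} (hs : IsTree s) :
    ∀ (d : List Unit) (t r : List Letter),
      s.foldl scanStep ((false, () :: d), (t, r)) = ((false, () :: d), (s.reverse ++ t, r)) := by
  induction hs with
  | node w c _ ih =>
    intro d t r
    rw [DLN.node, List.append_assoc, List.cons_append, List.foldl_cons]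
    change List.foldl scanStep ((false, () :: () :: d), (.lpar :: t, r)) _ = _
    rw [List.foldl_append, foldl_scanStep_bits, List.foldl_append, foldl_scanStep_flatten c ih]
    simp [scanStep, depthStep]

/-- The opening bracket of `s` keeps the counter positive during the label and all subtrees; the
counter first returns to zero at the closing bracket of `s`. From there on every letter goes to the
remainder. -/
theorem IsTree.splitTree_append {s : List Letter} (hs : IsTree s) (r : List Letter) :
    splitTree (s ++ r) = (s, r) := by
  have : (s ++ r).foldl scanStep ((false, []), ([], [])) =
      ((true, []), (s.reverse, r.reverse)) := by
    cases hs with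
    | node w c h =>
      rw [DLN.node, List.append_assoc, List.append_assoc, List.cons_append, List.foldl_cons]
      change List.foldl scanStep ((false, [()]), ([.lpar], [])) _ = _
      rw [List.foldl_append, foldl_scanStep_bits, List.foldl_append,
        foldl_scanStep_flatten c fun s hs => (h s hs).foldl_scanStep, List.singleton_append,
        List.foldl_cons]
      change List.foldl scanStep ((true, []), (.rpar :: _, [])) _ = _
      rw [foldl_scanStep_done]
      simp
  simp [splitTree, this]

theorem length_foldl_scanStep (s : List Letter) : ∀ z : ScanState,
    (s.foldl scanStep z).2.1.length + (s.foldl scanStep z).2.2.length =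
      z.2.1.length + z.2.2.length + s.length ∧ z.2.1.length ≤ (s.foldl scanStep z).2.1.length := by
  induction s with
  | nil => intro z; exact ⟨rfl, le_rfl⟩
  | cons x s ih =>
    intro z
    have h := ih (scanStep z x)
    have h₁ : (scanStep z x).2.1.length + (scanStep z x).2.2.length =
        z.2.1.length + z.2.2.length + 1 ∧ z.2.1.length ≤ (scanStep z x).2.1.length := by
      unfold scanStep
      split <;> simp <;> omega
    rw [List.foldl_cons, List.length_cons]
    omega

/-- This concerns arbitrary words, including unbalanced ones, because the size bounds for
polynomial-time functions must hold on all inputs. -/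
theorem length_splitTree (x : Letter) (s : List Letter) :
    (splitTree (x :: s)).1.length + (splitTree (x :: s)).2.length = s.length + 1 ∧
      0 < (splitTree (x :: s)).1.length := by
  have h := length_foldl_scanStep s (scanStep ((false, []), ([], [])) x)
  simp only [splitTree, List.length_reverse, List.foldl_cons]
  simp only [scanStep, Bool.false_eq_true, if_false, List.length_cons, List.length_nil] at h ⊢
  omega

theorem polyTime_splitTree {O : Language Bool} : PolyTime O splitTree := by
  have hz : PolyTime O fun x : (Letter × ScanState) × List Letter => x.1.2 := .comp .snd .fst
  have hx : PolyTime O fun x : (Letter × ScanState) × List Letter => x.1.1 := .comp .fst .fst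
  have hdepth : PolyTime O fun x : (Letter × ScanState) × List Letter =>
      depthStep x.1.2.1.2 x.1.1 := by
    have hd : PolyTime O fun x : (Letter × ScanState) × List Letter => x.1.2.1.2 :=
      PolyTime.snd.comp (PolyTime.fst.comp hz)
    have := ((polyTime_letter fun x => x.toPair.1).comp hx).ite
      (((polyTime_letter fun x => x.toPair.2).comp hx).ite hd.tail ((PolyTime.const ()).cons hd)) hd
    convert this using 2 with x
    obtain ⟨⟨_ | _ | _, z⟩, _⟩ := x <;> rfl
  have ht : PolyTime O fun x : (Letter × ScanState) × List Letter => x.1.2.2.1 :=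
    PolyTime.fst.comp (PolyTime.snd.comp hz)
  have hr : PolyTime O fun x : (Letter × ScanState) × List Letter => x.1.2.2.2 :=
    PolyTime.snd.comp (PolyTime.snd.comp hz)
  have hg : PolyTime O fun x : (Letter × ScanState) × List Letter => scanStep x.1.2 x.1.1 :=
    (PolyTime.fst.comp (PolyTime.fst.comp hz)).ite
      ((PolyTime.fst.comp hz).mk (ht.mk (hx.cons hr)))
      ((hdepth.isEmpty.mk hdepth).mk ((hx.cons ht).mk hr))
  have := PolyTime.foldl_of_le (α := List Letter) (s := fun _ => ((false, []), ([], [])))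
    (g := fun _ => scanStep) .id (.const _) hg 20 <| by
      rintro - ⟨⟨b, d⟩, t, r⟩ x
      have h₁ := size_letter x
      unfold scanStep
      split
      · simp only [size_prod, size_cons]
        omega
      · have h₂ := size_bool (depthStep d x).isEmpty
        have h₃ : size (depthStep d x) ≤ size d + 2 := by
          cases x with
          | lpar => exact (size_cons _ _).le.trans (by simp [size, bits, Enc.code, Data.bits]; omega)
          | rpar => exact (size_le_of_sublist (List.tail_sublist d)).trans (by omega)
          | bit b => exact Nat.le_add_right _ _
        simp only [size_prod, size_cons]
        omega
  exact (PolyTime.fst.comp (PolyTime.snd.comp this)).reverse.mk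
    (PolyTime.snd.comp (PolyTime.snd.comp this)).reverse

/-! Cutting out trees -/

/-- Reads a letter, or a tree if the remaining word satisfies `P`. -/
def cutStep (P : List Letter → Bool) (z : List Letter × List (Bool × List Letter)) :
    List Letter × List (Bool × List Letter) :=
  match z.1 with
  | [] => ([], z.2)
  | x :: s => if P (x :: s) then ((splitTree (x :: s)).2, (true, (splitTree (x :: s)).1) :: z.2)
    else (s, (false, [x]) :: z.2)

/-- Divides a word into letters (marked by `false`) and trees (marked by `true`); the trees are read
at the positions where the remaining word satisfies `P`. -/
def cut (P : List Letter → Bool) (s : List Letter) : List (Bool × List Letter) :=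
  ((cutStep P)^[s.length] (s, [])).2.reverse

/-- In every context, the word `s` is divided into the tokens `t`. -/
def CutsTo (P : List Letter → Bool) (s : List Letter) (t : List (Bool × List Letter)) : Prop :=
  ∀ r out, ∃ n ≤ s.length, (cutStep P)^[n] (s ++ r, out) = (r, t.reverse ++ out)

section cut

variable {P : List Letter → Bool} {s s' : List Letter} {t t' : List (Bool × List Letter)}

/-- As many rounds as there are letters always suffice: once the word is used up, `cutStep` changes
nothing. -/
theorem CutsTo.cut_eq (h : CutsTo P s t) : cut P s = t := by
  obtain ⟨n, hn, e⟩ := h [] []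
  obtain ⟨k, hk⟩ := Nat.exists_eq_add_of_le' hn
  have : (cutStep P)^[k] ([], t.reverse) = ([], t.reverse) := Function.iterate_fixed rfl k
  rw [List.append_nil, List.append_nil] at e
  rw [cut, hk, Function.iterate_add_apply, e, this]
  simp

theorem CutsTo.nil : CutsTo P [] [] := fun _ _ => ⟨0, le_rfl, rfl⟩

theorem CutsTo.append (h : CutsTo P s t) (h' : CutsTo P s' t') : CutsTo P (s ++ s') (t ++ t') := by
  intro r out
  obtain ⟨n, hn, e⟩ := h (s' ++ r) out
  obtain ⟨m, hm, e'⟩ := h' r (t.reverse ++ out)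
  refine ⟨m + n, by rw [List.length_append]; omega, ?_⟩
  rw [Function.iterate_add_apply, List.append_assoc, e, e', List.reverse_append, List.append_assoc]

theorem CutsTo.letter {x : Letter} (h : ∀ r, P (x :: s ++ r) = false) (h' : CutsTo P s t) :
    CutsTo P (x :: s) ((false, [x]) :: t) := by
  intro r out
  obtain ⟨n, hn, e⟩ := h' r ((false, [x]) :: out)
  refine ⟨n + 1, Nat.succ_le_succ hn, ?_⟩
  have : cutStep P (x :: s ++ r, out) = (s ++ r, (false, [x]) :: out) := by
    have := h r
    simp only [List.cons_append] at this
    simp [cutStep, this]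
  rw [Function.iterate_succ_apply, this, e]
  simp

theorem CutsTo.tree (hs : IsTree s) (h : ∀ r, P (s ++ r) = true) : CutsTo P s [(true, s)] := by
  intro r out
  have e := hs.splitTree_append r
  have h := h r
  obtain ⟨x, s, rfl⟩ : ∃ x s', s = x :: s' := by
    cases hs with
    | node w c _ => exact ⟨_, _, rfl⟩
  refine ⟨1, by simp, ?_⟩
  simp only [List.cons_append] at e h
  simp [cutStep, h, e]

theorem CutsTo.flatten {ι : Type} {l : List ι} {c : ι → List Letter}
    {T : ι → List (Bool × List Letter)} (h : ∀ i ∈ l, CutsTo P (c i) (T i)) :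
    CutsTo P (l.map c).flatten (l.flatMap T) := by
  induction l with
  | nil => exact .nil
  | cons i l ih =>
    exact (h i List.mem_cons_self).append (ih fun i hi => h i (List.mem_cons_of_mem _ hi))

theorem CutsTo.letters {w : List Letter} (hw : ∀ x ∈ w, ∀ r, P (x :: r) = false) :
    CutsTo P w (w.map fun x => (false, [x])) := by
  induction w with
  | nil => exact .nil
  | cons x w ih =>
    exact (ih fun x hx => hw x (List.mem_cons_of_mem _ hx)).letter
      fun r => hw x List.mem_cons_self _

theorem CutsTo.node {ι : Type} {w : List Bool} {l : List ι} {c : ι → List Letter}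
    {T : ι → List (Bool × List Letter)} (hb : ∀ b r, P (.bit b :: r) = false)
    (hr : ∀ r, P (.rpar :: r) = false) (hw : ∀ r, P (node w (l.map c) ++ r) = false)
    (h : ∀ i ∈ l, CutsTo P (c i) (T i)) :
    CutsTo P (node w (l.map c)) ((false, [.lpar]) :: ((w.map fun b => (false, [.bit b])) ++
      l.flatMap T ++ [(false, [.rpar])])) := by
  refine CutsTo.letter hw (.append (.append ?_ (.flatten h)) (.letter (fun r => hr _) .nil))
  have := CutsTo.letters (w := w.map Letter.bit) (P := P) fun x hx r => by
    obtain ⟨b, -, rfl⟩ := List.mem_map.1 hx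
    exact hb b r
  simpa [Function.comp_def] using this

theorem polyTime_cut {O : Language Bool} (hP : PolyTime O P) : PolyTime O (cut P) := by
  have hg : PolyTime O fun x : (List Letter × List (Bool × List Letter)) × List Letter =>
      cutStep P x.1 := by
    have hg' : PolyTime O fun x : (Letter × List Letter) × (List (Bool × List Letter)) =>
        if P (x.1.1 :: x.1.2) then ((splitTree (x.1.1 :: x.1.2)).2,
          (true, (splitTree (x.1.1 :: x.1.2)).1) :: x.2) else (x.1.2, (false, [x.1.1]) :: x.2) := by
      have h₁ : PolyTime O fun x : (Letter × List Letter) × (List (Bool × List Letter)) =>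
          x.1.1 :: x.1.2 := (PolyTime.fst.comp .fst).cons (PolyTime.snd.comp .fst)
      have h₂ := polyTime_splitTree.comp h₁
      exact (hP.comp h₁).ite ((PolyTime.snd.comp h₂).mk (((PolyTime.const true).mk
        (PolyTime.fst.comp h₂)).cons .snd)) ((PolyTime.snd.comp .fst).mk
        (((PolyTime.const false).mk ((PolyTime.fst.comp .fst).cons .nil)).cons .snd))
    have h₀ : PolyTime O fun z : List Letter × List (Bool × List Letter) =>
        (([] : List Letter), z.2) := PolyTime.nil.mk .snd
    have := (PolyTime.fst (O := O) (α := List Letter)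
      (β := List (Bool × List Letter))).listCases (f := fun z => ([], z.2))
      (g := fun z x s => if P (x :: s) then ((splitTree (x :: s)).2,
        (true, (splitTree (x :: s)).1) :: z.2) else (s, (false, [x]) :: z.2))
      h₀ (hg'.comp (PolyTime.fst.mk (PolyTime.snd.comp .snd)))
    refine PolyTime.comp ?_ .fst
    convert this using 2 with z
    obtain ⟨_ | _, _⟩ := z <;> rfl
  -- A potential argument: every unread letter carries a credit of `14`, which pays for the token it
  -- becomes or for its share in a tree token (`8` per letter, and at most `6` for the wrapping).
  have key : ∀ z : List Letter × List (Bool × List Letter),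
      14 * (cutStep P z).1.length + size (cutStep P z).2 ≤ 14 * z.1.length + size z.2 := by
    rintro ⟨_ | ⟨x, s⟩, out⟩
    · exact le_rfl
    · simp only [cutStep]
      split
      · have h₁ := length_splitTree x s
        have h₂ := size_letters (splitTree (x :: s)).1
        have h₃ := size_bool true
        simp only [size_cons, size_prod, List.length_cons]
        omega
      · have h₁ := size_letter x
        have h₂ : size false = 1 := rfl
        simp only [size_cons, size_prod, size_nil, List.length_cons]
        omega
  have := PolyTime.iterate (α := List Letter) (g := fun _ => cutStep P) .id (PolyTime.id.mk .nil) hg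
    (B := fun s => 14 * size s + 3) (((PolyBd.const 14).mul .size).add (.const 3)) fun s n _ => by
      have : ∀ n, 14 * ((cutStep P)^[n] (s, [])).1.length + size ((cutStep P)^[n] (s, [])).2 ≤
          14 * s.length + 1 := by
        intro n
        induction n with
        | zero => exact le_rfl
        | succ n ih => rw [Function.iterate_succ_apply']; exact (key _).trans ih
      have h₁ := this n
      have h₂ := size_letters ((cutStep P)^[n] (s, [])).1
      have h₃ := length_lt_size s
      rw [size_prod]
      omega
  exact (PolyTime.snd.comp this).reverse

end cut

/-! Immediate subtrees -/

/-- Does the word begin with an opening bracket? -/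
def startsOpen (s : List Letter) : Bool :=
  match s.headD .rpar with
  | .lpar => true
  | _ => false

/-- The immediate subtrees of a tree. -/
def subtrees (s : List Letter) : List (List Letter) :=
  ((cut startsOpen s.tail).filter fun t => t.1).map fun t => t.2

/-- After the outer opening bracket is dropped, the first opening brackets met are those of the
immediate subtrees, and each subtree is cut out as a whole. The label and the outer closing bracket
give tokens marked `false`. -/
theorem subtrees_node (w : List Bool) (c : List (List Letter)) (h : ∀ s ∈ c, IsTree s) :
    subtrees (node w c) = c := by
  have hc : ∀ s ∈ c, CutsTo startsOpen s [(true, s)] := fun s hs =>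
    .tree (h s hs) fun r => by cases h s hs; rfl
  have hb := CutsTo.letters (P := startsOpen) (w := w.map Letter.bit) (by
    intro x hx r
    obtain ⟨b, -, rfl⟩ := List.mem_map.1 hx
    rfl)
  have hf := CutsTo.flatten (c := fun s => s) hc
  rw [List.map_id'] at hf
  have e := ((hb.append hf).append (.letter (x := .rpar) (fun r => rfl) .nil)).cut_eq
  have : ∀ c : List (List Letter), (List.filter (fun t : Bool × List Letter => t.1)
      (c.flatMap fun s => [(true, s)])).map (fun t => t.2) = c := by
    intro c
    induction c with
    | nil => rfl
    | cons s c ih => simpa using ih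
  rw [subtrees, node, List.cons_append, List.cons_append, List.tail_cons, e, List.filter_append,
    List.filter_append, List.map_append, List.map_append, this]
  simp [List.filter_map, Function.comp_def]

theorem polyTime_startsOpen {O : Language Bool} : PolyTime O startsOpen :=
  (polyTime_letter fun x => match x with
    | .lpar => true
    | _ => false).comp (PolyTime.id.headD .rpar)

theorem polyTime_subtrees {O : Language Bool} : PolyTime O subtrees :=
  (((polyTime_cut polyTime_startsOpen).comp PolyTime.id.tail).filter (PolyTime.fst.comp .fst)).map
    (PolyTime.snd.comp .fst)

end DLN

/-! Renaming of concept names in encoded objects -/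

namespace DLN

open OracleTime

variable {K : Constructors}

/-- The number with the given binary digits. -/
def ofDigits (w : List Bool) : ℕ := w.foldr Nat.bit 0

theorem ofDigits_ne_zero (w : List Bool) : ofDigits (w ++ [true]) ≠ 0 := by
  induction w with
  | nil => decide
  | cons b w ih => exact Nat.bit_ne_zero b ih

/-- Binary digits are listed from the least significant one, so a word that ends in `true` has no
leading zeros and is recovered from its number. This is the reason for the final `true` in
`newWord`. -/
theorem bits_ofDigits (w : List Bool) : (ofDigits (w ++ [true])).bits = w ++ [true] := by
  induction w with
  | nil => decide
  | cons b w ih =>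
    exact (Nat.bits_append_bit _ b fun h => absurd h (ofDigits_ne_zero w)).trans
      (congrArg (b :: ·) ih)

/-- The word that names the renamed version of an encoded concept name. -/
def newWord (u : List Letter) : List Bool := u.flatMap Letter.code ++ [true]

/-- An injective renaming of the concept names of the defeasible extension to those of the
description logic. -/
def newName (x : NName K) : ℕ := ofDigits (newWord (encNName x))

/-- The encoding of the renamed version of an encoded concept name. -/
def encNewName (u : List Letter) : List Letter :=
  node [false, false, false, false] [leaf (newWord u)]

theorem encName_newName (x : NName K) : encName (newName x) = encNewName (encNName x) := by
  rw [encName, encNat, newName, newWord, bits_ofDigits]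
  rfl

/-- The number `0` thus remains available as a fresh concept name. -/
theorem newName_ne_zero (x : NName K) : newName x ≠ 0 := ofDigits_ne_zero _

/-- Does the word begin with an encoded concept name? -/
def startsName : List Letter → Bool
  | .lpar :: .bit false :: .bit false :: .bit false :: .bit _ :: .lpar :: _ => true
  | _ => false

/-- Is the fifth letter `true`? Among concept names, these are the normality concepts. -/
def isNormal (s : List Letter) : Bool :=
  match s.tail.tail.tail.tail.headD .rpar with
  | .bit true => true
  | _ => false

/-- Renames a concept name; other tokens are left as they are. -/
def renameToken (t : Bool × List Letter) : List Letter := if t.1 then encNewName t.2 else t.2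

/-- Renames all concept names in an encoded object. -/
def rename (s : List Letter) : List Letter := (cut startsName s).flatMap renameToken

/-- The normality concepts in an encoded object. -/
def normals (s : List Letter) : List (List Letter) :=
  ((cut startsName s).filter fun t => t.1 && isNormal t.2).map fun t => t.2

section PolyTime

variable {O : Language Bool}

theorem polyTime_encNewName : PolyTime O encNewName :=
  polyTime_node (.const _) ((polyTime_leaf ((PolyTime.id.flatMap (f := fun _ => Letter.code)
    ((polyTime_letter _).comp .fst)).append (.const _))).cons .nil)

theorem polyTime_startsName : PolyTime O startsName := by
  -- The default letter `.rpar` fails every test below, so words that are too short are rejected.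
  have h (F : Letter → Bool) {f : List Letter → List Letter} (hf : PolyTime O f) :
      PolyTime O fun s => F ((f s).headD .rpar) := (polyTime_letter F).comp (hf.headD .rpar)
  have h₁ := PolyTime.tail (PolyTime.id (O := O) (α := List Letter))
  have := (h (fun x => x.toPair.1 && !x.toPair.2) .id).and
    ((h (fun x => !x.toPair.1 && !x.toPair.2) h₁).and
    ((h (fun x => !x.toPair.1 && !x.toPair.2) h₁.tail).and
    ((h (fun x => !x.toPair.1 && !x.toPair.2) h₁.tail.tail).and
    ((h (fun x => !x.toPair.1) h₁.tail.tail.tail).and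
    (h (fun x => x.toPair.1 && !x.toPair.2) h₁.tail.tail.tail.tail)))))
  convert this using 2 with s
  match s with
  | [] => rfl
  | .rpar :: _ => rfl
  | .bit _ :: _ => rfl
  | [.lpar] => rfl
  | .lpar :: .lpar :: _ => rfl
  | .lpar :: .rpar :: _ => rfl
  | .lpar :: .bit true :: _ => rfl
  | [.lpar, .bit false] => rfl
  | .lpar :: .bit false :: .lpar :: _ => rfl
  | .lpar :: .bit false :: .rpar :: _ => rfl
  | .lpar :: .bit false :: .bit true :: _ => rfl
  | [.lpar, .bit false, .bit false] => rfl
  | .lpar :: .bit false :: .bit false :: .lpar :: _ => rfl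
  | .lpar :: .bit false :: .bit false :: .rpar :: _ => rfl
  | .lpar :: .bit false :: .bit false :: .bit true :: _ => rfl
  | [.lpar, .bit false, .bit false, .bit false] => rfl
  | .lpar :: .bit false :: .bit false :: .bit false :: .lpar :: _ => rfl
  | .lpar :: .bit false :: .bit false :: .bit false :: .rpar :: _ => rfl
  | [.lpar, .bit false, .bit false, .bit false, .bit _] => rfl
  | .lpar :: .bit false :: .bit false :: .bit false :: .bit _ :: .lpar :: _ => rfl
  | .lpar :: .bit false :: .bit false :: .bit false :: .bit _ :: .rpar :: _ => rfl
  | .lpar :: .bit false :: .bit false :: .bit false :: .bit _ :: .bit _ :: _ => rfl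

theorem polyTime_isNormal : PolyTime O isNormal :=
  (polyTime_letter fun x => match x with
    | .bit true => true
    | _ => false).comp (PolyTime.id.tail.tail.tail.tail.headD .rpar)

theorem polyTime_rename : PolyTime O rename :=
  (polyTime_cut polyTime_startsName).flatMap (f := fun _ => renameToken)
    ((PolyTime.fst.comp .fst).ite (polyTime_encNewName.comp (PolyTime.snd.comp .fst))
      (PolyTime.snd.comp .fst))

theorem polyTime_normals : PolyTime O normals :=
  ((polyTime_cut polyTime_startsName).filter ((PolyTime.fst.comp .fst).and
    (polyTime_isNormal.comp (PolyTime.snd.comp .fst)))).map (PolyTime.snd.comp .fst)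

end PolyTime

/-- An encoded name is recognized by a label of exactly four bits `000b` followed by an opening
bracket. The digits of a number or the code of a constructor may well begin or coincide with such a
label, but they stand in leaves, where a closing bracket follows. -/
theorem not_startsName_node {w : List Bool} {c : List (List Letter)} (hc : ∀ s ∈ c, IsTree s)
    (h : (∀ b, w ≠ [false, false, false, b]) ∨ c = []) (r : List Letter) :
    startsName (node w c ++ r) = false := by
  obtain ⟨x, s, hs, hx⟩ : ∃ x s, c.flatten ++ [.rpar] ++ r = x :: s ∧
      ((∀ b, x ≠ .bit b) ∧ (c = [] → x = .rpar)) := by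
    cases c with
    | nil => exact ⟨.rpar, r, rfl, by simp, fun _ => rfl⟩
    | cons s c =>
      cases hc s List.mem_cons_self with
      | node w' c' => exact ⟨.lpar, _, rfl, by simp, by simp⟩
  have e : node w c ++ r = .lpar :: (w.map .bit ++ x :: s) := by
    rw [← hs]
    simp [node]
  rw [e]
  obtain ⟨hx, hx'⟩ := hx
  match w, h with
  | [], _ => cases x <;> simp_all [startsName]
  | [a], _ => cases x <;> cases a <;> simp_all [startsName]
  | [a, b], _ => cases x <;> cases a <;> cases b <;> simp_all [startsName]
  | [a, b, d], _ => cases x <;> cases a <;> cases b <;> cases d <;> simp_all [startsName]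
  | [a, b, d, f], h =>
    cases x
    · rcases h with h | h
      · have := h f
        cases a <;> cases b <;> cases d <;> simp_all [startsName]
      · simp_all
    · cases a <;> cases b <;> cases d <;> simp [startsName]
    · simp_all
  | a :: b :: d :: f :: g :: w, _ => cases a <;> cases b <;> cases d <;> simp [startsName]

/-- The tree `s` becomes `s'` by renaming, and `N` is the set of (the arguments of) the normality
concepts in `s`. -/
structure Renames (K : Constructors) (s s' : List Letter) (N : Set (Concept K ℕ)) : Prop where
  isTree : IsTree s
  exists_cut : ∃ t, CutsTo startsName s t ∧ t.flatMap renameToken = s' ∧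
    ∀ u, ((true, u) ∈ t ∧ isNormal u = true) ↔ ∃ E ∈ N, u = encNName (.inr E)

namespace Renames

variable {s s' : List Letter} {N N' : Set (Concept K ℕ)}

theorem rename_eq (h : Renames K s s' N) : rename s = s' := by
  obtain ⟨t, h₁, h₂, -⟩ := h.exists_cut
  rw [rename, h₁.cut_eq, h₂]

theorem mem_normals (h : Renames K s s' N) {u : List Letter} :
    u ∈ normals s ↔ ∃ E ∈ N, u = encNName (.inr E) := by
  obtain ⟨t, h₁, -, h₃⟩ := h.exists_cut
  rw [normals, h₁.cut_eq, ← h₃]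
  simp

theorem congr (h : Renames K s s' N) (e : N = N') : Renames K s s' N' := e ▸ h

/-- The scanner does not stop at the root, so it copies the brackets and the label and enters the
subtrees. The tokens of the node, and hence its normality concepts, are those of its subtrees taken
together. -/
theorem node {ι : Type} {w : List Bool} {l : List ι} {c c' : ι → List Letter}
    {N : ι → Set (Concept K ℕ)} (hw : (∀ b, w ≠ [false, false, false, b]) ∨ l = [])
    (h : ∀ i ∈ l, Renames K (c i) (c' i) (N i)) :
    Renames K (node w (l.map c)) (DLN.node w (l.map c')) {E | ∃ i ∈ l, E ∈ N i} := by
  have ht : ∀ s ∈ l.map c, IsTree s := by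
    intro s hs
    obtain ⟨i, hi, rfl⟩ := List.mem_map.1 hs
    exact (h i hi).isTree
  refine ⟨.node w _ ht, ?_⟩
  have h' : ∀ i, ∃ t, i ∈ l → CutsTo startsName (c i) t ∧ t.flatMap renameToken = c' i ∧
      ∀ u, ((true, u) ∈ t ∧ isNormal u = true) ↔ ∃ E ∈ N i, u = encNName (.inr E) := by
    intro i
    by_cases hi : i ∈ l
    · exact (h i hi).exists_cut.imp fun t ht _ => ht
    · exact ⟨[], fun h => absurd h hi⟩
  choose T hT using h'
  refine ⟨_, CutsTo.node (fun _ _ => rfl) (fun _ => rfl)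
    (not_startsName_node ht (hw.imp_right (by rintro rfl; rfl))) fun i hi => (hT i hi).1, ?_, ?_⟩
  · have : ∀ l' : List ι, (∀ i ∈ l', i ∈ l) →
        (l'.flatMap T).flatMap renameToken = (l'.map c').flatten := by
      intro l' hl'
      induction l' with
      | nil => rfl
      | cons i l' ih =>
        rw [List.flatMap_cons, List.flatMap_append, ih fun i hi => hl' i (List.mem_cons_of_mem _ hi),
          (hT i (hl' i List.mem_cons_self)).2.1]
        rfl
    have hb : ∀ w : List Bool, (w.map fun b => (false, [Letter.bit b])).flatMap renameToken =
        w.map .bit := by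
      intro w
      induction w with
      | nil => rfl
      | cons b w ih => rw [List.map_cons, List.flatMap_cons, ih]; rfl
    rw [List.flatMap_cons, List.flatMap_append, List.flatMap_append, this l fun _ => id, hb]
    simp [renameToken, DLN.node]
  · intro u
    simp only [List.mem_cons, List.mem_append, List.mem_map, List.mem_flatMap, Set.mem_ofPred_eq,
      List.not_mem_nil, or_false, Prod.mk.injEq, Bool.true_eq_false, Bool.false_eq_true, false_and,
      and_false, exists_false, false_or]
    constructor
    · rintro ⟨⟨i, hi, hu⟩, hn⟩
      obtain ⟨E, hE, rfl⟩ := ((hT i hi).2.2 u).1 ⟨hu, hn⟩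
      exact ⟨E, ⟨i, hi, hE⟩, rfl⟩
    · rintro ⟨E, ⟨i, hi, hE⟩, rfl⟩
      have := ((hT i hi).2.2 _).2 ⟨E, hE, rfl⟩
      exact ⟨⟨i, hi, this.1⟩, this.2⟩

/-- The componentwise version of `Renames`, for lists of trees. -/
inductive All (K : Constructors) :
    List (List Letter) → List (List Letter) → Set (Concept K ℕ) → Prop
  | nil : All K [] [] ∅
  | cons {s s' c c' N N'} : Renames K s s' N → All K c c' N' → All K (s :: c) (s' :: c') (N ∪ N')

theorem All.exists_list {c c' : List (List Letter)} (h : All K c c' N) :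
    ∃ l : List (List Letter × List Letter × Set (Concept K ℕ)), c = l.map (fun x => x.1) ∧
      c' = l.map (fun x => x.2.1) ∧ N = {E | ∃ x ∈ l, E ∈ x.2.2} ∧
      ∀ x ∈ l, Renames K x.1 x.2.1 x.2.2 := by
  induction h with
  | nil => exact ⟨[], by simp⟩
  | @cons s s' _ _ N _ h _ ih =>
    obtain ⟨l, rfl, rfl, rfl, hl⟩ := ih
    refine ⟨(s, s', N) :: l, rfl, rfl, ?_, ?_⟩
    · ext; simp
    · rintro x (_ | ⟨_, hx⟩)
      exacts [h, hl x hx]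

theorem node' {w : List Bool} {c c' : List (List Letter)}
    (hw : ∀ b, w ≠ [false, false, false, b]) (h : All K c c' N) :
    Renames K (DLN.node w c) (DLN.node w c') N := by
  obtain ⟨l, rfl, rfl, rfl, hl⟩ := h.exists_list
  exact node (.inl hw) hl

theorem leaf (w : List Bool) : Renames K (leaf w) (DLN.leaf w) ∅ :=
  (node (ι := Unit) (l := []) (c := fun _ => []) (c' := fun _ => []) (N := fun _ => ∅) (.inr rfl)
    (by simp)).congr (by simp)

theorem encNat (n : ℕ) : Renames K (encNat n) (DLN.encNat n) ∅ := leaf _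

theorem ofFn {n : ℕ} {c c' : Fin n → List Letter} {N : Fin n → Set (Concept K ℕ)}
    (h : ∀ i, Renames K (c i) (c' i) (N i)) :
    Renames K (DLN.node [] (List.ofFn c)) (DLN.node [] (List.ofFn c')) (⋃ i, N i) := by
  have := node (w := []) (l := List.finRange n) (.inl (by simp)) fun i _ => h i
  rw [← List.ofFn_eq_map, ← List.ofFn_eq_map] at this
  exact this.congr (by ext; simp)

theorem encNats {n : ℕ} (v : Fin n → ℕ) : Renames K (encNats v) (DLN.encNats v) ∅ :=
  (ofFn fun i => encNat (v i)).congr (by simp)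

end Renames

end DLN

/-! Encodings of concepts and axioms -/

namespace DLN

open OracleTime

variable {K : Constructors} {X Y Z : Type}

/-- Ordinary names have the same encoding in both signatures. Hence strong axioms and arguments of
normality concepts can be renamed as if they were written in the extended language. -/
theorem Concept.enc_map_inl (C : Concept K ℕ) :
    (C.map (Sum.inl : ℕ → NName K)).enc encNName = C.enc encName := by
  induction C with
  | name A => rfl
  | top => rfl
  | bot => rfl
  | neg C ih => simp only [map, enc, ih]
  | inter C D ih₁ ih₂ => simp only [map, enc, ih₁, ih₂]
  | union C D ih₁ ih₂ => simp only [map, enc, ih₁, ih₂]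
  | ex R C ih => simp only [map, enc, ih]
  | all R C ih => simp only [map, enc, ih]
  | ext o cs rs is fs ih => simp only [map, enc, ih]

theorem Axm.enc_map_inl (γ : Axm K ℕ) :
    (γ.map (Sum.inl : ℕ → NName K)).enc encNName = γ.enc encName := by
  cases γ with
  | incl C D => simp only [map, enc, Concept.enc_map_inl]
  | assert C a => simp only [map, enc, Concept.enc_map_inl]
  | other o => cases o <;> rfl

/-- The arguments of the normality concepts in a concept. -/
def Concept.normalArgs (C : Concept K (NName K)) : Set (Concept K ℕ) := {E | Sum.inr E ∈ C.names}

theorem renames_concept_of_name (h : ∀ x : NName K, Renames K (encNName x) (encName (newName x))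
    {E | Sum.inr E = x}) (C : Concept K (NName K)) :
    Renames K (C.enc encNName) ((C.map newName).enc encName) C.normalArgs := by
  induction C with
  | name A => exact (h A).congr rfl
  | top => exact .leaf _
  | bot => exact .leaf _
  | neg C ih =>
    exact (Renames.node' (by simp) (.cons ih .nil)).congr
      (by ext; simp [Concept.normalArgs, Concept.names])
  | inter C D ih₁ ih₂ =>
    exact (Renames.node' (by simp)
      (.cons ih₁ (.cons ih₂ .nil))).congr (by ext; simp [Concept.normalArgs, Concept.names])
  | union C D ih₁ ih₂ =>
    exact (Renames.node' (by simp)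
      (.cons ih₁ (.cons ih₂ .nil))).congr (by ext; simp [Concept.normalArgs, Concept.names])
  | ex R C ih =>
    exact (Renames.node' (by simp)
      (.cons (.encNat R) (.cons ih .nil))).congr (by ext; simp [Concept.normalArgs, Concept.names])
  | all R C ih =>
    exact (Renames.node' (by simp)
      (.cons (.encNat R) (.cons ih .nil))).congr (by ext; simp [Concept.normalArgs, Concept.names])
  | ext o cs rs is fs ih =>
    exact (Renames.node' (by simp)
      (.cons (.leaf _) (.cons (.ofFn ih) (.cons (.encNats rs) (.cons (.encNats is) (.cons (.encNats fs) .nil)))))).congr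
      (by ext; simp [Concept.normalArgs, Concept.names])

theorem isTree_leaf (w : List Bool) : IsTree (leaf w) := .node _ _ (by simp)

theorem isTree_encName (n : ℕ) : IsTree (encName n) :=
  .node _ _ (by simpa using! isTree_leaf n.bits)

theorem isTree_ofFn {n : ℕ} {c : Fin n → List Letter} (h : ∀ i, IsTree (c i)) :
    IsTree (node [] (List.ofFn c)) := .node _ _ (by simpa [List.mem_ofFn] using h)

theorem isTree_encNats {n : ℕ} (v : Fin n → ℕ) : IsTree (encNats v) :=
  isTree_ofFn fun _ => isTree_leaf _

/-- The label at the root of the encoding of a concept. -/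
def Concept.label : Concept K ℕ → List Bool
  | .name _ => [false, false, false, false]
  | .top => [false, false, true, false]
  | .bot => [false, false, true, true]
  | .neg _ => [false, true, false, false]
  | .inter _ _ => [false, true, false, true]
  | .union _ _ => [false, true, true, false]
  | .ex _ _ => [false, true, true, true]
  | .all _ _ => [true, false, false, false]
  | .ext _ _ _ _ _ => [true, false, false, true]

/-- The immediate subtrees of the encoding of a concept. -/
def Concept.parts : Concept K ℕ → List (List Letter)
  | .name n => [encNat n]
  | .top => []
  | .bot => []
  | .neg C => [C.enc encName]
  | .inter C D => [C.enc encName, D.enc encName]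
  | .union C D => [C.enc encName, D.enc encName]
  | .ex R C => [encNat R, C.enc encName]
  | .all R C => [encNat R, C.enc encName]
  | .ext o cs rs is fs => [leaf (K.opCode o), node [] (List.ofFn fun i => (cs i).enc encName),
      encNats rs, encNats is, encNats fs]

theorem Concept.enc_eq_node (C : Concept K ℕ) : C.enc encName = node C.label C.parts := by
  cases C <;> rfl

theorem Concept.isTree_enc (C : Concept K ℕ) : IsTree (C.enc encName) := by
  induction C with
  | name A => exact isTree_encName A
  | top => exact isTree_leaf _
  | bot => exact isTree_leaf _
  | neg C ih => exact .node _ _ (by simpa using ih)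
  | inter C D ih₁ ih₂ => exact .node _ _ (by simpa using ⟨ih₁, ih₂⟩)
  | union C D ih₁ ih₂ => exact .node _ _ (by simpa using ⟨ih₁, ih₂⟩)
  | ex R C ih => exact .node _ _ (by simpa using ⟨isTree_leaf _, ih⟩)
  | all R C ih => exact .node _ _ (by simpa using ⟨isTree_leaf _, ih⟩)
  | ext o cs rs is fs ih =>
    exact .node _ _ (by simpa using ⟨isTree_leaf _, isTree_ofFn ih, isTree_encNats rs,
      isTree_encNats is, isTree_encNats fs⟩)

theorem Concept.isTree_of_mem_parts (C : Concept K ℕ) : ∀ s ∈ C.parts, IsTree s := by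
  cases C with
  | name A => simpa [parts] using! isTree_leaf A.bits
  | top => simp [parts]
  | bot => simp [parts]
  | neg C => simpa [parts] using C.isTree_enc
  | inter C D => simpa [parts] using ⟨C.isTree_enc, D.isTree_enc⟩
  | union C D => simpa [parts] using ⟨C.isTree_enc, D.isTree_enc⟩
  | ex R C => simpa [parts] using ⟨isTree_leaf R.bits, C.isTree_enc⟩
  | all R C => simpa [parts] using ⟨isTree_leaf R.bits, C.isTree_enc⟩
  | ext o cs rs is fs =>
    simpa [parts] using ⟨isTree_leaf _, isTree_ofFn fun i => (cs i).isTree_enc, isTree_encNats rs,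
      isTree_encNats is, isTree_encNats fs⟩

theorem isTree_encNName (x : NName K) : IsTree (encNName x) := by
  cases x with
  | inl n => exact isTree_encName n
  | inr C => exact .node _ _ (by simpa using C.isTree_enc)

/-- A name is cut out as one single token. In particular the names inside the argument `C` of `N C`
are not renamed: they only contribute to the identity of the new name. -/
theorem renames_encNName (x : NName K) : Renames K (encNName x) (encName (newName x))
    {E | Sum.inr E = x} := by
  have ht := isTree_encNName x
  refine ⟨ht, _, .tree ht fun r => ?_, ?_, fun u => ?_⟩
  · cases x with
    | inl n => rfl
    | inr C =>
      rw [encNName, C.enc_eq_node]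
      rfl
  · simp [renameToken, encName_newName]
  · simp only [List.mem_singleton, Prod.mk.injEq, true_and, Set.mem_ofPred_eq]
    constructor
    · rintro ⟨rfl, h⟩
      cases x with
      | inl n => exact absurd h Bool.false_ne_true
      | inr C => exact ⟨C, rfl, rfl⟩
    · rintro ⟨E, rfl, rfl⟩
      exact ⟨rfl, rfl⟩

theorem renames_concept (C : Concept K (NName K)) :
    Renames K (C.enc encNName) ((C.map newName).enc encName) C.normalArgs :=
  renames_concept_of_name renames_encNName C

/-! Injectivity -/

theorem takeWhile_bits (w : List Bool) {x : Letter} (hx : ∀ b, x ≠ .bit b) (s : List Letter) :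
    (w.map Letter.bit ++ x :: s).takeWhile (fun x => match x with
      | .bit _ => true
      | _ => false) = w.map Letter.bit := by
  induction w with
  | nil => cases x <;> simp_all
  | cons b w ih => simpa using ih

theorem bit_injective : Function.Injective Letter.bit := fun _ _ h => Letter.bit.inj h

/-- The label is the longest run of bits after the first bracket, since a bracket follows it in any
case. The subtrees are recovered by `subtrees`. -/
theorem node_inj {w w' : List Bool} {c c' : List (List Letter)} (hc : ∀ s ∈ c, IsTree s)
    (hc' : ∀ s ∈ c', IsTree s) (h : node w c = node w' c') : w = w' ∧ c = c' := by
  have key : ∀ {c : List (List Letter)}, (∀ s ∈ c, IsTree s) → ∃ x s, c.flatten ++ [.rpar] = x :: s ∧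
      ∀ b, x ≠ Letter.bit b := by
    intro c hc
    cases c with
    | nil => exact ⟨.rpar, [], rfl, by simp⟩
    | cons s c =>
      cases hc s List.mem_cons_self with
      | node w' c' => exact ⟨.lpar, _, rfl, by simp⟩
  constructor
  · obtain ⟨x, s, e, hx⟩ := key hc
    obtain ⟨x', s', e', hx'⟩ := key hc'
    rw [node, node, List.append_assoc, List.append_assoc, e, e', List.cons_append, List.cons_append,
      List.cons.injEq] at h
    have := congrArg (List.takeWhile fun x => match x with
      | .bit _ => true
      | _ => false) h.2
    rw [takeWhile_bits w hx, takeWhile_bits w' hx'] at this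
    exact List.map_injective_iff.2 bit_injective this
  · rw [← subtrees_node w c hc, h, subtrees_node w' c' hc']

theorem leaf_injective : Function.Injective leaf := fun _ _ h =>
  (node_inj (by simp) (by simp) h).1

theorem ofDigits_bits (n : ℕ) : ofDigits n.bits = n := by
  induction n using Nat.binaryRec' with
  | zero => rfl
  | bit b n h ih =>
    rw [Nat.bits_append_bit n b h]
    exact congrArg (Nat.bit b) ih

theorem encNat_injective : Function.Injective encNat := fun m n h => by
  rw [← ofDigits_bits m, leaf_injective h, ofDigits_bits]

theorem ofFn_node_inj {n : ℕ} {c c' : Fin n → List Letter} (hc : ∀ i, IsTree (c i))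
    (hc' : ∀ i, IsTree (c' i)) (h : node [] (List.ofFn c) = node [] (List.ofFn c')) : c = c' :=
  List.ofFn_injective (node_inj (by simpa [List.mem_ofFn] using hc)
    (by simpa [List.mem_ofFn] using hc') h).2

theorem encNats_injective {n : ℕ} : Function.Injective (encNats : (Fin n → ℕ) → _) :=
  fun _ _ h => funext fun i => encNat_injective
    (congrFun (ofFn_node_inj (fun _ => isTree_leaf _) (fun _ => isTree_leaf _) h) i)

theorem Concept.enc_injective : Function.Injective (Concept.enc (K := K) encName) := by
  intro C
  induction C with
  | ext o cs rs is fs ih =>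
    intro D h
    rw [enc_eq_node, enc_eq_node] at h
    obtain ⟨h₁, h₂⟩ := node_inj (isTree_of_mem_parts _) (isTree_of_mem_parts _) h
    cases D with
    | ext o' cs' rs' is' fs' =>
      simp only [parts, List.cons.injEq, and_true] at h₂
      obtain ⟨ho, hcs, hrs, his, hfs⟩ := h₂
      obtain rfl := K.opCode_injective (leaf_injective ho)
      obtain rfl := encNats_injective hrs
      obtain rfl := encNats_injective his
      obtain rfl := encNats_injective hfs
      have := ofFn_node_inj (fun i => (cs i).isTree_enc) (fun i => (cs' i).isTree_enc) hcs
      obtain rfl : cs = cs' := funext fun i => ih i (congrFun this i)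
      rfl
    | _ => simp [label] at h₁
  | _ =>
    intro D h
    rw [enc_eq_node, enc_eq_node] at h
    obtain ⟨h₁, h₂⟩ := node_inj (isTree_of_mem_parts _) (isTree_of_mem_parts _) h
    cases D <;> simp_all [label, parts, encNat_injective.eq_iff] <;> grind

theorem encNName_injective : Function.Injective (encNName (K := K)) := by
  have hinl : ∀ n : ℕ, ∀ s ∈ [encNat n], IsTree s := by simpa using! fun n : ℕ => isTree_leaf n.bits
  have hinr : ∀ C : Concept K ℕ, ∀ s ∈ [C.enc encName], IsTree s := by
    simpa using fun C => Concept.isTree_enc C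
  rintro (m | C) (n | D) h
  · simpa [encNat_injective.eq_iff] using (node_inj (hinl m) (hinl n) h).2
  · simpa using (node_inj (hinl m) (hinr D) h).1
  · simpa using (node_inj (hinr C) (hinl n) h).1
  · simpa [Concept.enc_injective.eq_iff] using (node_inj (hinr C) (hinr D) h).2

theorem newWord_injective : Function.Injective newWord := fun u v h => by
  rw [← letters_flatMap_code u, List.append_cancel_right h, letters_flatMap_code]

theorem newName_injective : Function.Injective (newName (K := K)) := fun x y h => by
  have := congrArg Nat.bits h
  rw [newName, newName, newWord, newWord, bits_ofDigits, bits_ofDigits] at this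
  exact encNName_injective (newWord_injective this)

/-! Axioms and knowledge bases -/

theorem renames_axm (β : Axm K (NName K)) :
    ∃ N, Renames K (β.enc encNName) ((β.map newName).enc encName) N := by
  cases β with
  | incl C D =>
    exact ⟨_, .node' (by simp)
      (.cons (renames_concept C) (.cons (renames_concept D) .nil))⟩
  | assert C a =>
    exact ⟨_, .node' (by simp)
      (.cons (renames_concept C) (.cons (.encNat a) .nil))⟩
  | other o =>
    cases o with
    | roleAssertion R a b =>
      exact ⟨_, .node' (by simp)
        (.cons (.encNat R) (.cons (.encNat a) (.cons (.encNat b) .nil)))⟩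
    | ext o rs is fs =>
      exact ⟨_, .node' (by simp)
        (.cons (.leaf _) (.cons (.encNats rs) (.cons (.encNats is) (.cons (.encNats fs) .nil))))⟩

/-- The arguments of the normality concepts in a defeasible inclusion. -/
def DI.normalArgs (δ : DI K) : Set (Concept K ℕ) := δ.pre.normalArgs ∪ δ.con.normalArgs

theorem renames_di (δ : DI K) : ∃ s', Renames K δ.enc s' δ.normalArgs :=
  ⟨_, (Renames.node' (by simp)
    (.cons (renames_concept δ.pre) (.cons (renames_concept δ.con) .nil))).congr
    (by ext; simp [DI.normalArgs])⟩

theorem renames_dis (l : List (DI K)) : ∃ s', Renames K (node [] (l.map DI.enc)) s'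
    {E | ∃ δ ∈ l, E ∈ δ.normalArgs} := by
  choose s' hs' using renames_di (K := K)
  exact ⟨_, .node (.inl (by simp)) fun δ _ => hs' δ⟩

end DLN

/-! Renaming and entailment -/

namespace DLN

variable {K : Constructors} {X Y : Type}

/-- The interpretation of the names in `X` through `f`. -/
def Interp.comap (f : X → Y) (I : Interp K Y) : Interp K X :=
  letI := I.nonempty
  { Δ := I.Δ
    concept := fun x => I.concept (f x)
    role := I.role
    individual := I.individual
    feature := I.feature }

/-- The interpretation that gives the empty extension to all names outside the range of `f`. -/
def Interp.extend (f : X → Y) (I : Interp K X) : Interp K Y :=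
  letI := I.nonempty
  { Δ := I.Δ
    concept := fun y => {d | ∃ x, f x = y ∧ d ∈ I.concept x}
    role := I.role
    individual := I.individual
    feature := I.feature }

theorem Interp.comap_extend {f : X → Y} (hf : Function.Injective f) (I : Interp K X) :
    (I.extend f).comap f = I := by
  cases I with
  | mk Δ concept role individual feature =>
    have : (fun x => {d | ∃ x', f x' = f x ∧ d ∈ concept x'}) = concept := by
      funext x
      ext d
      simp [hf.eq_iff]
    simp only [comap, extend, this]

theorem Concept.sem_map (f : X → Y) (I : Interp K Y) (C : Concept K X) :
    (C.map f).sem I = C.sem (I.comap f) := by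
  induction C with
  | name A => rfl
  | top => rfl
  | bot => rfl
  | neg C ih => exact congrArg _ ih
  | inter C D ih₁ ih₂ => exact congrArg₂ (· ∩ ·) ih₁ ih₂
  | union C D ih₁ ih₂ => exact congrArg₂ (· ∪ ·) ih₁ ih₂
  | ex R C ih => exact congrArg (fun s : Set I.Δ => {d | ∃ e, I.role R d e ∧ e ∈ s}) ih
  | all R C ih => exact congrArg (fun s : Set I.Δ => {d | ∀ e, I.role R d e → e ∈ s}) ih
  | ext o cs rs is fs ih =>
    exact congrArg (fun c => K.opSem o I.Δ c (fun i => I.role (rs i))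
      (fun i => I.individual (is i)) (fun i => I.feature (fs i))) (funext ih)

theorem Interp.sat_map (f : X → Y) (I : Interp K Y) (α : Axm K X) :
    I.Sat (α.map f) ↔ (I.comap f).Sat α := by
  cases α with
  | incl C D =>
    change (C.map f).sem I ⊆ (D.map f).sem I ↔ _
    rw [C.sem_map, D.sem_map]
    rfl
  | assert C a =>
    change I.individual a ∈ (C.map f).sem I ↔ _
    rw [C.sem_map]
    rfl
  | other o => cases o <;> rfl

theorem Interp.forall_sat_map (f : X → Y) (I : Interp K Y) (S : Set (Axm K X)) :
    (∀ β ∈ Axm.map f '' S, I.Sat β) ↔ ∀ β ∈ S, (I.comap f).Sat β := by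
  simp [Interp.sat_map]

/-- A model over `X` extends to `Y` with empty extensions outside the range of `f`, and pulling it
back gives the original model by injectivity. Conversely, any model over `Y` can be pulled back. -/
theorem entails_map {f : X → Y} (hf : Function.Injective f) (S : Set (Axm K X)) (α : Axm K X) :
    Entails (Axm.map f '' S) (α.map f) ↔ Entails S α := by
  constructor
  · intro h I hI
    have := h (I.extend f)
    rw [Interp.forall_sat_map, Interp.sat_map, Interp.comap_extend hf] at this
    exact this hI
  · intro h I hI
    rw [Interp.forall_sat_map] at hI
    exact (Interp.sat_map f I α).2 (h _ hI)

/-- Inconsistency of a concept, expressed by means of a new concept name. -/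
theorem entails_incl_new_name {f : X → Y} (hf : Function.Injective f) (S : Set (Axm K X)) (x : X)
    {y : Y} (hy : y ∉ Set.range f) :
    Entails (Axm.map f '' S) (.incl (.name (f x)) (.name y)) ↔ Entails S (.incl (.name x) .bot) := by
  constructor
  · intro h I hI
    have := h (I.extend f)
    rw [Interp.forall_sat_map, Interp.comap_extend hf] at this
    intro d hd
    -- In the extended model `y` has the empty extension, being outside the range of `f`; it plays
    -- the role of `⊥`.
    obtain ⟨x', hx', -⟩ := this hI (show d ∈ (I.extend f).concept (f x) from ⟨x, rfl, hd⟩)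
    exact hy ⟨x', hx'⟩
  · intro h I hI
    rw [Interp.forall_sat_map] at hI
    exact fun d hd => absurd (h _ hI hd) (Set.notMem_empty d)

/-! Individuals -/

/-- The individual `a` does not occur in the concept. -/
def Concept.Avoids (a : ℕ) : Concept K X → Prop
  | .name _ => True
  | .top => True
  | .bot => True
  | .neg C => C.Avoids a
  | .inter C D => C.Avoids a ∧ D.Avoids a
  | .union C D => C.Avoids a ∧ D.Avoids a
  | .ex _ C => C.Avoids a
  | .all _ C => C.Avoids a
  | .ext _ cs _ is _ => (∀ i, (cs i).Avoids a) ∧ ∀ i, is i ≠ a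

/-- The individual `a` does not occur in the axiom. -/
def Axm.Avoids (a : ℕ) : Axm K X → Prop
  | .incl C D => C.Avoids a ∧ D.Avoids a
  | .assert C b => C.Avoids a ∧ b ≠ a
  | .other (.roleAssertion _ b c) => b ≠ a ∧ c ≠ a
  | .other (.ext _ _ is _) => ∀ i, is i ≠ a

/-- The interpretation with another meaning of the individual `a`. -/
def Interp.setIndividual (I : Interp K X) (a : ℕ) (d : I.Δ) : Interp K X :=
  letI := I.nonempty
  { Δ := I.Δ
    concept := I.concept
    role := I.role
    individual := Function.update I.individual a d
    feature := I.feature }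

theorem Concept.Avoids.sem_setIndividual {I : Interp K X} {a : ℕ} {d : I.Δ} {C : Concept K X}
    (h : C.Avoids a) : C.sem (I.setIndividual a d) = C.sem I := by
  induction C with
  | name A => rfl
  | top => rfl
  | bot => rfl
  | neg C ih => exact congrArg _ (ih h)
  | inter C D ih₁ ih₂ => exact congrArg₂ (· ∩ ·) (ih₁ h.1) (ih₂ h.2)
  | union C D ih₁ ih₂ => exact congrArg₂ (· ∪ ·) (ih₁ h.1) (ih₂ h.2)
  | ex R C ih => exact congrArg (fun s : Set I.Δ => {d | ∃ e, I.role R d e ∧ e ∈ s}) (ih h)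
  | all R C ih => exact congrArg (fun s : Set I.Δ => {d | ∀ e, I.role R d e → e ∈ s}) (ih h)
  | ext o cs rs is fs ih =>
    exact congrArg₂ (fun c j => K.opSem o I.Δ c (fun i => I.role (rs i)) j
      (fun i => I.feature (fs i))) (funext fun i => ih i (h.1 i))
      (funext fun i => Function.update_of_ne (h.2 i) _ _)

theorem Axm.Avoids.sat_setIndividual {I : Interp K X} {a : ℕ} {d : I.Δ} {α : Axm K X}
    (h : α.Avoids a) : (I.setIndividual a d).Sat α ↔ I.Sat α := by
  have hu {b : ℕ} (hb : b ≠ a) : (I.setIndividual a d).individual b = I.individual b :=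
    Function.update_of_ne hb _ _
  cases α with
  | incl C D =>
    change C.sem _ ⊆ D.sem _ ↔ _
    rw [h.1.sem_setIndividual, h.2.sem_setIndividual]
    rfl
  | assert C b =>
    change (I.setIndividual a d).individual b ∈ C.sem _ ↔ _
    rw [h.1.sem_setIndividual, hu h.2]
    rfl
  | other o =>
    cases o with
    | roleAssertion R b c =>
      change I.role R ((I.setIndividual a d).individual b) ((I.setIndividual a d).individual c) ↔ _
      rw [hu h.1, hu h.2]
      rfl
    | ext o rs is fs =>
      exact iff_of_eq (congrArg (fun j => K.axSem o I.Δ (fun i => I.role (rs i)) j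
        (fun i => I.feature (fs i))) (funext fun i => hu (h i)))

/-- Inconsistency of a concept, expressed by means of a new concept name and a new individual. -/
theorem entails_assert_new_name {f : X → Y} (hf : Function.Injective f) (S : Set (Axm K X)) (x : X)
    {y : Y} (hy : y ∉ Set.range f) {a : ℕ} (ha : ∀ β ∈ Axm.map f '' S, β.Avoids a) :
    Entails (Axm.map f '' S ∪ {.assert (.name (f x)) a}) (.assert (.name y) a) ↔
      Entails S (.incl (.name x) .bot) := by
  rw [← entails_incl_new_name hf S x hy]
  constructor
  · intro h I hI d hd
    -- Since `a` is new, it may be reinterpreted as an arbitrary element `d` of the extension of `f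
    -- x` without affecting the other axioms.
    have hd' : d ∈ ((I.setIndividual a d).concept y) := by
      have := h (I.setIndividual a d) ?_
      · change Function.update I.individual a d a ∈ I.concept y at this
        rwa [Function.update_self] at this
      · rintro β (hβ | rfl)
        · exact (ha β hβ).sat_setIndividual.2 (hI β hβ)
        · change Function.update I.individual a d a ∈ I.concept (f x)
          rwa [Function.update_self]
    exact hd'
  · intro h I hI
    exact h I (fun β hβ => hI β (.inl hβ)) (hI (.assert (.name (f x)) a) (.inr rfl))

/-! Lengths of encodings -/

theorem length_lt_node {w : List Bool} {c : List (List Letter)} {s : List Letter} (h : s ∈ c) :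
    s.length < (node w c).length := by
  have := (List.sublist_flatten_of_mem h).length_le
  simp only [node, List.length_append, List.length_cons]
  omega

theorem length_encNat_le_encNats {n : ℕ} (v : Fin n → ℕ) (i : Fin n) :
    (encNat (v i)).length < (encNats v).length :=
  length_lt_node ((List.mem_ofFn' _ _).2 ⟨i, rfl⟩)

/-- If `a` occurred as an individual, the encoding of `a` would be a proper part of that of the
concept and thus shorter. -/
theorem Concept.avoids_of_length {a : ℕ} {C : Concept K ℕ}
    (h : (C.enc encName).length < (encNat a).length) : C.Avoids a := by
  induction C with
  | name A => trivial
  | top => trivial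
  | bot => trivial
  | neg C ih => exact ih ((length_lt_node (by simp)).trans h)
  | inter C D ih₁ ih₂ =>
    exact ⟨ih₁ ((length_lt_node (by simp)).trans h), ih₂ ((length_lt_node (by simp)).trans h)⟩
  | union C D ih₁ ih₂ =>
    exact ⟨ih₁ ((length_lt_node (by simp)).trans h), ih₂ ((length_lt_node (by simp)).trans h)⟩
  | ex R C ih => exact ih ((length_lt_node (by simp)).trans h)
  | all R C ih => exact ih ((length_lt_node (by simp)).trans h)
  | ext o cs rs is fs ih =>
    refine ⟨fun i => ih i (lt_trans ?_ h), ?_⟩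
    · exact (length_lt_node (w := [])
        ((List.mem_ofFn' (fun i => (cs i).enc encName) _).2 ⟨i, rfl⟩)).trans
        (length_lt_node (List.mem_cons_of_mem _ List.mem_cons_self))
    · rintro i rfl
      exact lt_irrefl _ (((length_encNat_le_encNats is i).trans (length_lt_node (by simp))).trans h)

theorem Axm.avoids_of_length {a : ℕ} {β : Axm K ℕ}
    (h : (β.enc encName).length < (encNat a).length) : β.Avoids a := by
  cases β with
  | incl C D => exact ⟨Concept.avoids_of_length ((length_lt_node (by simp)).trans h),
      Concept.avoids_of_length ((length_lt_node (by simp)).trans h)⟩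
  | assert C b =>
    refine ⟨Concept.avoids_of_length ((length_lt_node (by simp)).trans h), ?_⟩
    rintro rfl
    exact lt_irrefl _ ((length_lt_node (by simp)).trans h)
  | other o =>
    cases o with
    | roleAssertion R b c =>
      constructor
      · rintro rfl
        exact lt_irrefl _ ((length_lt_node (by simp)).trans h)
      · rintro rfl
        exact lt_irrefl _ ((length_lt_node (by simp)).trans h)
    | ext o rs is fs =>
      rintro i rfl
      exact lt_irrefl _ (((length_encNat_le_encNats is i).trans (length_lt_node (by simp))).trans h)

/-! The set of axioms determined by a defeasible knowledge base -/

/-- `N C` remains consistent when `δ^(N C)` is added to the strong axioms and the axioms of higher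
priority given by `T`. -/
def Overrides (prec : Priority K) (kb : DKB K) (Sg : Set (Concept K ℕ))
    (T : Set (DI K × Concept K ℕ)) (x : DI K × Concept K ℕ) : Prop :=
  ¬ Entails (stageZero kb Sg ∪ {β | ∃ y ∈ T, prec kb y.1 x.1 ∧ β = y.1.inst y.2} ∪ {x.1.inst x.2})
    (.incl (normal x.2) .bot)

/-- One round of an iteration whose fixed point gives the axioms of the knowledge base. -/
def refineStep (prec : Priority K) (kb : DKB K) (Sg : Set (Concept K ℕ))
    (T : Set (DI K × Concept K ℕ)) : Set (DI K × Concept K ℕ) :=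
  {x | x.1 ∈ kb.dis ∧ x.2 ∈ Sg ∧ Overrides prec kb Sg T x}

theorem DI.inst_inj {δ δ' : DI K} {C C' : Concept K ℕ} : δ.inst C = δ'.inst C' ↔ δ = δ' ∧ C = C' := by
  cases δ; cases δ'
  simp only [inst, normal, Axm.incl.injEq, Concept.inter.injEq, Concept.name.injEq, Sum.inr.injEq,
    DI.mk.injEq]
  tauto

/-- Strong axioms contain no normality concepts, and the axioms `N C ⊑ C` have a name, not a
conjunction, on the left. So the removal of instances by `restrict` leaves the initial stage intact.
-/
theorem DI.inst_notMem_stageZero (kb : DKB K) (Sg : Set (Concept K ℕ)) (δ : DI K)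
    (C : Concept K ℕ) : δ.inst C ∉ stageZero kb Sg := by
  rintro (⟨γ, -, h⟩ | ⟨D, -, h⟩)
  · cases γ with
    | incl C' D' =>
      simp only [inst, Axm.map, Axm.incl.injEq] at h
      cases C' with
      | inter C₁ C₂ =>
        simp only [Concept.map, Concept.inter.injEq, normal] at h
        cases C₁ <;> simp [Concept.map] at h
      | _ => simp [Concept.map] at h
    | _ => simp [inst, Axm.map] at h
  · simp [inst, normal] at h

section fixedPoint

variable {prec : Priority K} {kb : DKB K} {Sg : Set (Concept K ℕ)}

/-- An axiom `δ^(N C)` determines `δ` and `C`, so an instance of higher priority cannot be removed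
by coinciding with one that is not. -/
theorem restrict_stage (T : Set (DI K × Concept K ℕ)) (hT : ∀ x ∈ T, x.1 ∈ kb.dis ∧ x.2 ∈ Sg)
    (δ : DI K) :
    restrict prec kb Sg (stageZero kb Sg ∪ {β | ∃ y ∈ T, β = y.1.inst y.2}) δ =
      stageZero kb Sg ∪ {β | ∃ y ∈ T, prec kb y.1 δ ∧ β = y.1.inst y.2} := by
  ext β
  constructor
  · rintro ⟨h | ⟨y, hy, rfl⟩, hn⟩
    · exact .inl h
    · refine .inr ⟨y, hy, ?_, rfl⟩
      by_contra hp
      exact hn ⟨y.1, (hT y hy).1, y.2, (hT y hy).2, hp, rfl⟩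
  · rintro (h | ⟨y, hy, hp, rfl⟩)
    · refine ⟨.inl h, ?_⟩
      rintro ⟨δ₀, -, C, -, -, rfl⟩
      exact DI.inst_notMem_stageZero kb Sg δ₀ C h
    · refine ⟨.inr ⟨y, hy, rfl⟩, ?_⟩
      rintro ⟨δ₀, -, C, -, hp', h⟩
      obtain ⟨rfl, rfl⟩ := DI.inst_inj.1 h
      exact hp' hp

theorem IsLinearization.mem_of_prec {l₁ l₂ : List (DI K)} {δ δ' : DI K}
    (h : IsLinearization prec kb (l₁ ++ δ :: l₂)) (hδ' : δ' ∈ kb.dis) (hp : prec kb δ' δ) :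
    δ' ∈ l₁ := by
  obtain ⟨i, hi⟩ := List.mem_iff_get.1 ((h.mem_iff δ').2 hδ')
  have hj : l₁.length < (l₁ ++ δ :: l₂).length := by simp
  have := h.lt_of_prec i ⟨l₁.length, hj⟩ (by
    rw [hi]
    simpa using hp)
  have hi' : (i : ℕ) < l₁.length := this
  rw [← hi, List.get_eq_getElem, List.getElem_append_left hi']
  exact List.getElem_mem hi'

/-- When `δ` is processed, only instances of higher priority enter the test. Their inclusions
precede `δ`, so by induction exactly those in `T` have been accepted, and the test for `δ` is the
one in the fixed-point equation of `T`. -/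
theorem foldl_stageNext {T : Set (DI K × Concept K ℕ)} (hT : refineStep prec kb Sg T = T) :
    ∀ l₁ l₂ : List (DI K), IsLinearization prec kb (l₁ ++ l₂) →
      l₁.foldl (stageNext prec kb Sg) (stageZero kb Sg) =
        stageZero kb Sg ∪ {β | ∃ y ∈ {y ∈ T | y.1 ∈ l₁}, β = y.1.inst y.2} := by
  have hT' : ∀ x ∈ T, x.1 ∈ kb.dis ∧ x.2 ∈ Sg := fun x hx => by
    rw [← hT] at hx
    exact ⟨hx.1, hx.2.1⟩
  intro l₁
  induction l₁ using List.reverseRecOn with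
  | nil =>
    intro l₂ _
    simp
  | append_singleton l₁ δ ih =>
    intro l₂ hl
    rw [List.append_assoc, List.singleton_append] at hl
    have hδ : δ ∈ kb.dis := (hl.mem_iff δ).1 (by simp)
    rw [List.foldl_append, ih _ hl, List.foldl_cons, List.foldl_nil, stageNext,
      restrict_stage _ fun x hx => hT' x hx.1]
    have e : {β | ∃ y ∈ {y ∈ T | y.1 ∈ l₁}, prec kb y.1 δ ∧ β = y.1.inst y.2} =
        {β | ∃ y ∈ T, prec kb y.1 δ ∧ β = y.1.inst y.2} := by
      ext β
      constructor
      · rintro ⟨y, hy, h⟩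
        exact ⟨y, hy.1, h⟩
      · rintro ⟨y, hy, h⟩
        exact ⟨y, ⟨hy, hl.mem_of_prec (hT' y hy).1 h.1⟩, h⟩
    rw [e, Set.union_assoc]
    congr 1
    ext β
    constructor
    · rintro (⟨y, ⟨hy, hy'⟩, rfl⟩ | ⟨C, hC, rfl, h⟩)
      · exact ⟨y, ⟨hy, by simp [hy']⟩, rfl⟩
      · refine ⟨(δ, C), ⟨?_, by simp⟩, rfl⟩
        rw [← hT]
        exact ⟨hδ, hC, h⟩
    · rintro ⟨y, ⟨hy, hy'⟩, rfl⟩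
      rcases List.mem_append.1 hy' with h | h
      · exact .inl ⟨y, ⟨hy, h⟩, rfl⟩
      · obtain ⟨δ', C⟩ := y
        obtain rfl : δ' = δ := by simpa using h
        rw [← hT] at hy
        exact .inr ⟨C, hy.2.1, rfl, hy.2.2⟩

/-- The right-hand side does not mention `l`: the result is the same for all enumerations. -/
theorem kbSigma_eq {T : Set (DI K × Concept K ℕ)} (hT : refineStep prec kb Sg T = T)
    {l : List (DI K)} (hl : IsLinearization prec kb l) :
    kbSigma prec kb Sg l = stageZero kb Sg ∪ {β | ∃ y ∈ T, β = y.1.inst y.2} := by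
  have := foldl_stageNext hT l [] (by rwa [List.append_nil])
  rw [kbSigma, this]
  congr 1
  ext β
  constructor
  · rintro ⟨y, hy, rfl⟩
    exact ⟨y, hy.1, rfl⟩
  · rintro ⟨y, hy, rfl⟩
    refine ⟨y, ⟨hy, (hl.mem_iff _).2 ?_⟩, rfl⟩
    rw [← hT] at hy
    exact hy.1

theorem mem_dis_of_mem_iterate {n : ℕ} {x : DI K × Concept K ℕ}
    (h : x ∈ (refineStep prec kb Sg)^[n] ∅) : x.1 ∈ kb.dis := by
  cases n with
  | zero => exact h.elim
  | succ n =>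
    rw [Function.iterate_succ_apply'] at h
    exact h.1

/-- The verdicts on the first `k` inclusions are final after `k` rounds, because the verdict on an
inclusion depends only on those for inclusions of higher priority, which come earlier. No
monotonicity is available: more accepted pairs make the next test harder to pass. -/
theorem mem_iterate_iff : ∀ l₁ l₂ : List (DI K), IsLinearization prec kb (l₁ ++ l₂) →
    ∀ n n', l₁.length ≤ n → l₁.length ≤ n' → ∀ x : DI K × Concept K ℕ, x.1 ∈ l₁ →
      (x ∈ (refineStep prec kb Sg)^[n] ∅ ↔ x ∈ (refineStep prec kb Sg)^[n'] ∅) := by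
  intro l₁
  induction l₁ using List.reverseRecOn with
  | nil =>
    intro l₂ _ n n' _ _ x hx
    simp at hx
  | append_singleton l₁ δ ih =>
    intro l₂ hl n n' hn hn' x hx
    rw [List.append_assoc, List.singleton_append] at hl
    rw [List.length_append, List.length_singleton] at hn hn'
    rcases List.mem_append.1 hx with h | h
    · exact ih _ hl n n' (by omega) (by omega) x h
    · obtain ⟨δ', C⟩ := x
      obtain rfl : δ' = δ := by simpa using h
      obtain ⟨n, rfl⟩ : ∃ k, n = k + 1 := ⟨n - 1, by omega⟩
      obtain ⟨n', rfl⟩ : ∃ k, n' = k + 1 := ⟨n' - 1, by omega⟩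
      rw [Function.iterate_succ_apply', Function.iterate_succ_apply']
      have e : {β | ∃ y ∈ (refineStep prec kb Sg)^[n] ∅, prec kb y.1 δ' ∧ β = y.1.inst y.2} =
          {β | ∃ y ∈ (refineStep prec kb Sg)^[n'] ∅, prec kb y.1 δ' ∧ β = y.1.inst y.2} := by
        ext β
        constructor
        · rintro ⟨y, hy, h⟩
          exact ⟨y, (ih _ hl n n' (by omega) (by omega) y
            (hl.mem_of_prec (mem_dis_of_mem_iterate hy) h.1)).1 hy, h⟩
        · rintro ⟨y, hy, h⟩
          exact ⟨y, (ih _ hl n n' (by omega) (by omega) y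
            (hl.mem_of_prec (mem_dis_of_mem_iterate hy) h.1)).2 hy, h⟩
      change (δ' ∈ kb.dis ∧ C ∈ Sg ∧ ¬ Entails _ _) ↔ (δ' ∈ kb.dis ∧ C ∈ Sg ∧ ¬ Entails _ _)
      rw [e]

/-- The list `kb.dis` may contain repetitions, hence only an inequality; additional rounds do no
harm. -/
theorem IsLinearization.length_le {l : List (DI K)} (hl : IsLinearization prec kb l) :
    l.length ≤ kb.dis.length :=
  (hl.nodup.subperm fun δ hδ => (hl.mem_iff δ).1 hδ).length_le

theorem refineStep_iterate {l : List (DI K)} (hl : IsLinearization prec kb l) :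
    refineStep prec kb Sg ((refineStep prec kb Sg)^[kb.dis.length] ∅) =
      (refineStep prec kb Sg)^[kb.dis.length] ∅ := by
  rw [← Function.iterate_succ_apply' (refineStep prec kb Sg)]
  ext x
  have h := mem_iterate_iff (Sg := Sg) l [] (by rwa [List.append_nil]) (kb.dis.length + 1)
    kb.dis.length (by have := hl.length_le; omega) hl.length_le x
  by_cases hx : x.1 ∈ kb.dis
  · exact h ((hl.mem_iff _).2 hx)
  · exact ⟨fun h => absurd (mem_dis_of_mem_iterate h) hx,
      fun h => absurd (mem_dis_of_mem_iterate h) hx⟩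

-- Insertion sort: `δ` is placed after all elements of higher priority and before all others, whose
-- relative order is kept. If some later `b` had priority over an earlier `a ≺ δ`, transitivity
-- would give `b ≺ δ`, a contradiction.
open Classical in
theorem exists_pairwise (hirr : ∀ δ ∈ kb.dis, ¬ prec kb δ δ)
    (htr : ∀ δ₁ ∈ kb.dis, ∀ δ₂ ∈ kb.dis, ∀ δ₃ ∈ kb.dis,
      prec kb δ₁ δ₂ → prec kb δ₂ δ₃ → prec kb δ₁ δ₃) :
    ∀ l : List (DI K), (∀ δ ∈ l, δ ∈ kb.dis) → ∃ l' : List (DI K), l'.Nodup ∧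
      (∀ δ, δ ∈ l' ↔ δ ∈ l) ∧ l'.Pairwise fun δ δ' => ¬ prec kb δ' δ := by
  intro l
  induction l with
  | nil => exact fun _ => ⟨[], by simp⟩
  | cons δ l ih =>
    intro hl
    obtain ⟨l', hnd, hmem, hpw⟩ := ih fun δ hδ => hl δ (List.mem_cons_of_mem _ hδ)
    have hδ := hl δ List.mem_cons_self
    by_cases hin : δ ∈ l
    · refine ⟨l', hnd, fun δ' => ?_, hpw⟩
      rw [hmem, List.mem_cons]
      exact ⟨.inr, fun h => h.elim (fun e => e ▸ hin) fun h => h⟩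
    · have hd : ∀ δ' ∈ l', δ' ∈ kb.dis := fun δ' h =>
        hl δ' (List.mem_cons_of_mem _ ((hmem δ').1 h))
      refine ⟨l'.filter (fun δ' => prec kb δ' δ) ++ δ :: l'.filter (fun δ' => ¬ prec kb δ' δ),
        ?_, ?_, ?_⟩
      · rw [List.nodup_append, List.nodup_cons]
        refine ⟨hnd.filter _, ⟨?_, hnd.filter _⟩, ?_⟩
        · simp [hmem, hin]
        · rintro a ha b hb rfl
          rw [List.mem_filter] at ha
          rcases List.mem_cons.1 hb with rfl | hb
          · exact hin ((hmem _).1 ha.1)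
          · have h₁ : prec kb a δ := by simpa using ha.2
            have h₂ : ¬ prec kb a δ := by simpa using (List.mem_filter.1 hb).2
            exact h₂ h₁
      · intro δ'
        simp only [List.mem_append, List.mem_cons, List.mem_filter, decide_eq_true_eq, hmem]
        tauto
      · rw [List.pairwise_append, List.pairwise_cons]
        refine ⟨hpw.filter _, ⟨?_, hpw.filter _⟩, ?_⟩
        · intro a ha
          simpa using (List.mem_filter.1 ha).2
        · intro a ha b hb hba
          have ha₁ := hd a (List.mem_filter.1 ha).1
          have ha₂ : prec kb a δ := by simpa using (List.mem_filter.1 ha).2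
          rcases List.mem_cons.1 hb with rfl | hb
          · exact hirr _ hδ (htr _ hδ _ ha₁ _ hδ hba ha₂)
          · have hb₂ : ¬ prec kb b δ := by simpa using (List.mem_filter.1 hb).2
            exact hb₂ (htr _ (hd b (List.mem_filter.1 hb).1) _ ha₁ _ hδ hba ha₂)

theorem exists_isLinearization (hirr : ∀ δ ∈ kb.dis, ¬ prec kb δ δ)
    (htr : ∀ δ₁ ∈ kb.dis, ∀ δ₂ ∈ kb.dis, ∀ δ₃ ∈ kb.dis,
      prec kb δ₁ δ₂ → prec kb δ₂ δ₃ → prec kb δ₁ δ₃) : ∃ l, IsLinearization prec kb l := by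
  obtain ⟨l, hnd, hmem, hpw⟩ := exists_pairwise hirr htr kb.dis fun _ h => h
  refine ⟨l, hnd, hmem, fun i j h => ?_⟩
  by_contra hij
  rcases (not_lt.1 hij).lt_or_eq with hlt | rfl
  · exact List.pairwise_iff_get.1 hpw j i hlt h
  · exact hirr _ ((hmem _).1 (List.get_mem l j)) h

end fixedPoint

theorem defEntails_iff {F : Fragment K} {prec : Priority K} (hprec : prec.IsStrictPartialOrder F)
    {kb : DKB K} (hkb : F.IsDKB kb) (α : Axm K (NName K)) :
    DefEntails prec kb α ↔ Entails (stageZero kb (sigma kb α) ∪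
      {β | ∃ y ∈ (refineStep prec kb (sigma kb α))^[kb.dis.length] ∅, β = y.1.inst y.2}) α := by
  constructor
  · intro h
    -- Without an enumeration, the universal quantifier in `DefEntails` would be vacuous.
    obtain ⟨l, hl⟩ := exists_isLinearization (hprec.irrefl kb hkb) (hprec.trans kb hkb)
    have := h l hl
    rwa [kbSigma_eq (refineStep_iterate hl) hl] at this
  · intro h l hl
    rwa [kbSigma_eq (refineStep_iterate hl) hl]

end DLN

/-! The decision procedure on encoded inputs -/

namespace DLN

open OracleTime

/-- The first immediate subtree. -/
def child₀ (s : List Letter) : List Letter := (subtrees s).headD []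

/-- The second immediate subtree. -/
def child₁ (s : List Letter) : List Letter := (subtrees s).tail.headD []

/-- The third immediate subtree. -/
def child₂ (s : List Letter) : List Letter := (subtrees s).tail.tail.headD []

/-- The encodings of the strong axioms in an input word. -/
def inputStrong (w : List Bool) : List (List Letter) := subtrees (child₀ (child₀ (letters w)))

/-- The encodings of the defeasible inclusions in an input word. -/
def inputDIs (w : List Bool) : List (List Letter) := subtrees (child₁ (child₀ (letters w)))

/-- The encodings of the normality concepts in an input word. -/
def inputNormals (w : List Bool) : List (List Letter) :=
  normals (child₁ (child₀ (letters w))) ++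
    (normals (child₁ (letters w)) ++ normals (child₂ (letters w)))

/-- The encoding of `N C ⊓ pre δ ⊑ con δ`, after renaming, from the encodings of `δ` and `N C`. -/
def instCode (x : List Letter × List Letter) : List Letter :=
  node [true, false, true, false]
    [node [false, true, false, true] [encNewName x.2, rename (child₀ x.1)], rename (child₁ x.1)]

/-- The encoding of `N C ⊑ C`, after renaming, from the encoding of `N C`. -/
def normalCode (u : List Letter) : List Letter :=
  node [true, false, true, false] [encNewName u, rename (child₀ u)]

/-- The encodings of the initial axioms, after renaming. -/
def baseCodes (w : List Bool) : List (List Letter) :=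
  (inputStrong w).map rename ++ (inputNormals w).map normalCode

/-- The pairs of a defeasible inclusion and a normality concept. -/
def inputPairs (w : List Bool) : List (List Letter × List Letter) :=
  (inputDIs w).flatMap fun d => (inputNormals w).map fun u => (d, u)

/-- The encodings of the axioms relevant for the pair `x`, given the pairs accepted so far. -/
def relevantCodes (higher : List Bool → Bool) (w : List Bool) (T : List (List Letter × List Letter))
    (x : List Letter × List Letter) : List (List Letter) :=
  baseCodes w ++ (((T.filter fun y => higher (word [child₀ (letters w), y.1, x.1])).map instCode) ++
    [instCode x])

/-- One round of the computation of the pairs whose axioms belong to the knowledge base. -/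
def refineCodes (ask : List (List Letter) × List Letter → Bool) (higher : List Bool → Bool)
    (w : List Bool) (T : List (List Letter × List Letter)) : List (List Letter × List Letter) :=
  (inputPairs w).filter fun x => !ask (relevantCodes higher w T x, x.2)

/-- The decision procedure. -/
def decideDef (ask : List (List Letter) × List Letter → Bool) (higher entails : List Bool → Bool)
    (w : List Bool) : Bool :=
  entails (word [node [] (baseCodes w ++
    ((refineCodes ask higher w)^[(inputDIs w).length] []).map instCode),
    rename (child₁ (letters w)), rename (child₂ (letters w))])

section PolyTime

attribute [local irreducible] node word rename encNewName subtrees letters normals leaf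

variable {O : Language Bool}

theorem polyTime_child₀ : PolyTime O child₀ := polyTime_subtrees.headD []

theorem polyTime_child₁ : PolyTime O child₁ := polyTime_subtrees.tail.headD []

theorem polyTime_child₂ : PolyTime O child₂ := polyTime_subtrees.tail.tail.headD []

theorem polyTime_inputStrong : PolyTime O inputStrong :=
  polyTime_subtrees.comp (polyTime_child₀.comp (polyTime_child₀.comp polyTime_letters))

theorem polyTime_inputDIs : PolyTime O inputDIs :=
  polyTime_subtrees.comp (polyTime_child₁.comp (polyTime_child₀.comp polyTime_letters))

theorem polyTime_inputNormals : PolyTime O inputNormals :=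
  (polyTime_normals.comp (polyTime_child₁.comp (polyTime_child₀.comp polyTime_letters))).append
    ((polyTime_normals.comp (polyTime_child₁.comp polyTime_letters)).append
      (polyTime_normals.comp (polyTime_child₂.comp polyTime_letters)))

theorem polyTime_instCode : PolyTime O instCode :=
  polyTime_node (.const _) ((polyTime_node (.const _) ((polyTime_encNewName.comp .snd).cons
    ((polyTime_rename.comp (polyTime_child₀.comp .fst)).cons .nil))).cons
    ((polyTime_rename.comp (polyTime_child₁.comp .fst)).cons .nil))

theorem polyTime_normalCode : PolyTime O normalCode :=
  polyTime_node (.const _) (polyTime_encNewName.cons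
    ((polyTime_rename.comp polyTime_child₀).cons .nil))

theorem polyTime_baseCodes : PolyTime O baseCodes :=
  (polyTime_inputStrong.map (polyTime_rename.comp .fst)).append
    (polyTime_inputNormals.map (polyTime_normalCode.comp .fst))

theorem polyTime_inputPairs : PolyTime O inputPairs :=
  polyTime_inputDIs.flatMap (f := fun w d => (inputNormals w).map fun u => (d, u))
    ((polyTime_inputNormals.comp .snd).map (f := fun x u => (x.1, u))
      ((PolyTime.fst.comp .snd).mk .fst))

variable {ask : List (List Letter) × List Letter → Bool} {higher entails : List Bool → Bool}

theorem polyTime_relevantCodes (hh : PolyTime O higher) :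
    PolyTime O fun x : (List Letter × List Letter) ×
      (List (List Letter × List Letter) × List Bool) => relevantCodes higher x.2.2 x.2.1 x.1 := by
  have hf : PolyTime O fun z : (List Letter × List Letter) × ((List Letter × List Letter) ×
      (List (List Letter × List Letter) × List Bool)) =>
      higher (word [child₀ (letters z.2.2.2), z.1.1, z.2.1.1]) :=
    hh.comp (polyTime_word (((polyTime_child₀.comp polyTime_letters).comp
      (PolyTime.snd.comp (PolyTime.snd.comp .snd))).cons ((PolyTime.fst.comp .fst).cons
      ((PolyTime.fst.comp (PolyTime.fst.comp .snd)).cons .nil))))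
  exact (polyTime_baseCodes.comp (PolyTime.snd.comp .snd)).append
    ((((PolyTime.fst.comp .snd).filter (f := fun x (y : List Letter × List Letter) =>
      higher (word [child₀ (letters x.2.2), y.1, x.1.1])) hf).map
      (polyTime_instCode.comp .fst)).append ((polyTime_instCode.comp .fst).cons .nil))

attribute [local irreducible] inputPairs relevantCodes

theorem polyTime_refineCodes (ha : PolyTime O ask) (hh : PolyTime O higher) :
    PolyTime O fun x : List (List Letter × List Letter) × List Bool =>
      refineCodes ask higher x.2 x.1 :=
  (polyTime_inputPairs.comp .snd).filter
    (f := fun x y => !ask (relevantCodes higher x.2 x.1 y, y.2))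
    (ha.comp ((polyTime_relevantCodes hh).mk (PolyTime.snd.comp .fst))).not

attribute [local irreducible] inputDIs baseCodes refineCodes

theorem polyTime_decideDef (ha : PolyTime O ask) (hh : PolyTime O higher)
    (he : PolyTime O entails) : PolyTime O (decideDef ask higher entails) := by
  have hr := polyTime_inputDIs.iterate (O := O) (g := refineCodes ask higher) .nil
    -- After the first round, every iterate is a sublist of the list of all pairs, whose size is
    -- polynomial; this bounds all intermediate results.
    (polyTime_refineCodes ha hh) (B := fun w => size (inputPairs w) + 1)
    ((polyTime_inputPairs (O := O)).polyBd.add (.const 1)) fun w n _ => by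
      cases n with
      | zero => exact Nat.le_add_left _ _
      | succ n =>
        rw [Function.iterate_succ_apply', refineCodes]
        exact (size_le_of_sublist List.filter_sublist).trans (Nat.le_add_right _ _)
  exact he.comp (polyTime_word ((polyTime_node (.const _) (polyTime_baseCodes.append
    (hr.map (f := fun _ y => instCode y) (polyTime_instCode.comp .fst)))).cons
    (((polyTime_rename.comp polyTime_child₁).comp polyTime_letters).cons
    (((polyTime_rename.comp polyTime_child₂).comp polyTime_letters).cons .nil))))

end PolyTime

/-- Asks whether a normality concept is inconsistent, by means of a subsumption. -/
def askSubsumption (entails : List Bool → Bool) (x : List (List Letter) × List Letter) : Bool :=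
  entails (word [node [] x.1, encNewName x.2, encName 0])

/-- The encoding of an individual that does not occur in the given axioms. -/
def newIndividual (c : List (List Letter)) : List Letter := leaf ((node [] c).map fun _ => true)

/-- Asks whether a normality concept is inconsistent, by means of an instance check. -/
def askInstance (entails : List Bool → Bool) (x : List (List Letter) × List Letter) : Bool :=
  entails (word [node [] (x.1 ++ [node [true, false, true, true]
    [encNewName x.2, newIndividual x.1]]), encName 0, newIndividual x.1])

section PolyTime

attribute [local irreducible] node word encNewName leaf encName

variable {O : Language Bool} {entails : List Bool → Bool}

theorem polyTime_askSubsumption (he : PolyTime O entails) : PolyTime O (askSubsumption entails) :=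
  he.comp (polyTime_word ((polyTime_node (.const _) .fst).cons
    ((polyTime_encNewName.comp .snd).cons ((PolyTime.const _).cons .nil))))

theorem polyTime_newIndividual : PolyTime O newIndividual :=
  polyTime_leaf ((polyTime_node (.const _) .id).map (.const true))

theorem polyTime_askInstance (he : PolyTime O entails) : PolyTime O (askInstance entails) := by
  have hn : PolyTime O fun x : List (List Letter) × List Letter => newIndividual x.1 :=
    polyTime_newIndividual.comp .fst
  exact he.comp (polyTime_word ((polyTime_node (.const _) (PolyTime.append .fst
    ((polyTime_node (.const _) ((polyTime_encNewName.comp .snd).cons (hn.cons .nil))).cons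
    .nil))).cons ((PolyTime.const _).cons (hn.cons .nil))))

end PolyTime

/-! Correctness -/

variable {K : Constructors}

/-- The encoding of an axiom after renaming. -/
def Axm.newCode (β : Axm K (NName K)) : List Letter := (β.map newName).enc encName

/-- The encoding of a pair of a defeasible inclusion and a normality concept. -/
def pairCode (x : DI K × Concept K ℕ) : List Letter × List Letter := (x.1.enc, encNName (.inr x.2))

theorem child₀_node {w : List Bool} {s : List Letter} {c : List (List Letter)}
    (h : ∀ t ∈ s :: c, IsTree t) : child₀ (node w (s :: c)) = s := by
  rw [child₀, subtrees_node _ _ h]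
  rfl

theorem child₁_node {w : List Bool} {s t : List Letter} {c : List (List Letter)}
    (h : ∀ r ∈ s :: t :: c, IsTree r) : child₁ (node w (s :: t :: c)) = t := by
  rw [child₁, subtrees_node _ _ h]
  rfl

theorem child₂_node {w : List Bool} {s t r : List Letter} {c : List (List Letter)}
    (h : ∀ q ∈ s :: t :: r :: c, IsTree q) : child₂ (node w (s :: t :: r :: c)) = r := by
  rw [child₂, subtrees_node _ _ h]
  rfl

theorem isTree_concept (C : Concept K (NName K)) : IsTree (C.enc encNName) :=
  (renames_concept C).isTree

theorem instCode_pairCode (x : DI K × Concept K ℕ) :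
    instCode (pairCode x) = (x.1.inst x.2).newCode := by
  have h : ∀ t ∈ [x.1.pre.enc encNName, x.1.con.enc encNName], IsTree t := by
    simpa using ⟨isTree_concept x.1.pre, isTree_concept x.1.con⟩
  rw [instCode, pairCode, DI.enc, child₀_node h, child₁_node h, (renames_concept _).rename_eq,
    (renames_concept _).rename_eq, ← encName_newName]
  rfl

theorem normalCode_encNName (C : Concept K ℕ) : normalCode (encNName (.inr C)) =
    (Axm.incl (normal C) (C.map Sum.inl)).newCode := by
  rw [normalCode, encNName, child₀_node (by simpa using C.isTree_enc), ← encNName,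
    ← encName_newName, ← Concept.enc_map_inl, (renames_concept _).rename_eq]
  rfl

theorem rename_axm (γ : Axm K ℕ) : rename (γ.enc encName) = (γ.map Sum.inl).newCode := by
  obtain ⟨N, h⟩ := renames_axm (γ.map (Sum.inl : ℕ → NName K))
  rw [← Axm.enc_map_inl, h.rename_eq]
  rfl

theorem isTree_axm (γ : Axm K ℕ) : IsTree (γ.enc encName) := by
  obtain ⟨N, h⟩ := renames_axm (γ.map (Sum.inl : ℕ → NName K))
  rw [← Axm.enc_map_inl]
  exact h.isTree

theorem isTree_di (δ : DI K) : IsTree δ.enc := (renames_di δ).choose_spec.isTree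

theorem isTree_strong (l : List (Axm K ℕ)) : ∀ s ∈ l.map (Axm.enc encName), IsTree s := by
  intro s hs
  obtain ⟨γ, -, rfl⟩ := List.mem_map.1 hs
  exact isTree_axm γ

theorem isTree_dis (l : List (DI K)) : ∀ s ∈ l.map DI.enc, IsTree s := by
  intro s hs
  obtain ⟨δ, -, rfl⟩ := List.mem_map.1 hs
  exact isTree_di δ

theorem isTree_dkb_parts (kb : DKB K) :
    ∀ s ∈ [encKB encName kb.strong, node [] (kb.dis.map DI.enc), leaf kb.info], IsTree s := by
  simpa using ⟨IsTree.node [] _ (isTree_strong kb.strong), IsTree.node [] _ (isTree_dis kb.dis),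
    isTree_leaf kb.info⟩

/-- A list of concepts, each of which is represented by its normality concept in the list of words
`l`. -/
theorem exists_concepts {l : List (List Letter)} {N : Set (Concept K ℕ)}
    (h : ∀ u, u ∈ l ↔ ∃ E ∈ N, u = encNName (.inr E)) :
    ∃ es : List (Concept K ℕ), l = es.map (fun E => encNName (.inr E)) ∧ ∀ E, E ∈ es ↔ E ∈ N := by
  have : ∀ l : List (List Letter), (∀ u ∈ l, ∃ E : Concept K ℕ, u = encNName (.inr E)) →
      ∃ es : List (Concept K ℕ), l = es.map (fun E => encNName (.inr E)) := by
    intro l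
    induction l with
    | nil => exact fun _ => ⟨[], rfl⟩
    | cons u l ih =>
      intro hl
      obtain ⟨E, rfl⟩ := hl u List.mem_cons_self
      obtain ⟨es, rfl⟩ := ih fun u hu => hl u (List.mem_cons_of_mem _ hu)
      exact ⟨E :: es, rfl⟩
  obtain ⟨es, rfl⟩ := this l fun u hu => ((h u).1 hu).imp fun E hE => hE.2
  refine ⟨es, rfl, fun E => ?_⟩
  have := h (encNName (.inr E))
  simpa [(encNName_injective (K := K)).eq_iff] using this

section correct

variable (kb : DKB K) (es : List (Concept K ℕ))

/-- The initial axioms, as a list. -/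
def baseAxioms : List (Axm K (NName K)) :=
  kb.strong.map (Axm.map Sum.inl) ++ es.map fun C => .incl (normal C) (C.map Sum.inl)

theorem mem_baseAxioms (β : Axm K (NName K)) :
    β ∈ baseAxioms kb es ↔ β ∈ stageZero kb {E | E ∈ es} := by
  simp [baseAxioms, stageZero, eq_comm]

/-- The axioms for a list of pairs, together with the initial ones. -/
def axiomsOf (T : List (DI K × Concept K ℕ)) : List (Axm K (NName K)) :=
  baseAxioms kb es ++ T.map fun x => x.1.inst x.2

/-- All pairs of a defeasible inclusion and a normality concept. -/
def allPairs : List (DI K × Concept K ℕ) := kb.dis.flatMap fun δ => es.map fun E => (δ, E)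

variable {kb es}

theorem mem_allPairs {x : DI K × Concept K ℕ} : x ∈ allPairs kb es ↔ x.1 ∈ kb.dis ∧ x.2 ∈ es := by
  obtain ⟨δ, E⟩ := x
  simp [allPairs]

/-- All added axioms are inclusions. The grammar, which depends on the set of other axioms, is
therefore the same for every query that is asked. -/
theorem others_axiomsOf (T : List (DI K × Concept K ℕ)) :
    others ((axiomsOf kb es T).map (Axm.map newName)) = others kb.strong := by
  ext o
  simp only [others, axiomsOf, baseAxioms, Set.mem_ofPred_eq, List.mem_map, List.mem_append]
  constructor
  · rintro ⟨β, (⟨γ, hγ, rfl⟩ | ⟨C, -, rfl⟩) | ⟨x, -, rfl⟩, h⟩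
    · cases γ <;> simp_all [Axm.map]
    · simp [Axm.map] at h
    · simp [Axm.map, DI.inst] at h
  · intro h
    exact ⟨.other o, .inl (.inl ⟨.other o, h, rfl⟩), rfl⟩

theorem isKB_axiomsOf {F : Fragment K} (hF : F.SupportsConj) (hkb : F.IsDKB kb)
    (hes : ∀ E ∈ es, E ∈ F.rhs (others kb.strong) ℕ) {T : List (DI K × Concept K ℕ)}
    (hT : ∀ x ∈ T, x ∈ allPairs kb es) : F.IsKB ((axiomsOf kb es T).map (Axm.map newName)) := by
  have hs := hkb.strong_isKB
  have hinl {C : Concept K ℕ} : (C.map (Sum.inl : ℕ → NName K)).map newName =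
      C.map fun n => newName (Sum.inl n : NName K) := by
    induction C <;> simp_all [Concept.map]
  have hinj : Function.Injective fun n => newName (Sum.inl n : NName K) :=
    newName_injective.comp Sum.inl_injective
  refine ⟨by rw [others_axiomsOf]; exact hs.others_mem, fun C D h => ?_, fun C a h => ?_⟩
  · rw [others_axiomsOf]
    obtain ⟨β, hβ, e⟩ := List.mem_map.1 h
    rcases List.mem_append.1 hβ with hβ | hβ
    · rcases List.mem_append.1 hβ with hβ | hβ
      · obtain ⟨γ, hγ, rfl⟩ := List.mem_map.1 hβ
        cases γ with
        | incl C' D' =>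
          simp only [Axm.map, Axm.incl.injEq, hinl] at e
          obtain ⟨rfl, rfl⟩ := e
          have := hs.incl_mem C' D' hγ
          exact ⟨(F.map_mem_lhs _ _ _ _ hinj _).2 this.1, (F.map_mem_rhs _ _ _ _ hinj _).2 this.2⟩
        | _ => simp [Axm.map] at e
      · obtain ⟨E, hE, rfl⟩ := List.mem_map.1 hβ
        simp only [Axm.map, Axm.incl.injEq, hinl] at e
        obtain ⟨rfl, rfl⟩ := e
        exact ⟨F.name_mem_lhs _ _ _, (F.map_mem_rhs _ _ _ _ hinj _).2 (hes E hE)⟩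
    · obtain ⟨x, hx, rfl⟩ := List.mem_map.1 hβ
      have hd := (mem_allPairs.1 (hT x hx)).1
      simp only [Axm.map, DI.inst, Axm.incl.injEq] at e
      obtain ⟨rfl, rfl⟩ := e
      -- The axioms `N C ⊓ pre δ ⊑ con δ` are the ones that require conjunction on the left-hand
      -- side.
      exact ⟨hF _ hs.others_mem _ _ (F.name_mem_lhs _ _ _) _
        ((F.map_mem_lhs _ _ _ _ newName_injective _).2 (hkb.pre_mem _ hd).1),
        (F.map_mem_rhs _ _ _ _ newName_injective _).2 (hkb.con_mem _ hd).1⟩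
  · rw [others_axiomsOf]
    obtain ⟨β, hβ, e⟩ := List.mem_map.1 h
    rcases List.mem_append.1 hβ with hβ | hβ
    · rcases List.mem_append.1 hβ with hβ | hβ
      · obtain ⟨γ, hγ, rfl⟩ := List.mem_map.1 hβ
        cases γ with
        | assert C' b =>
          simp only [Axm.map, Axm.assert.injEq, hinl] at e
          obtain ⟨rfl, rfl⟩ := e
          exact (F.map_mem_asr _ _ _ _ hinj _).2 (hs.assert_mem C' b hγ)
        | _ => simp [Axm.map] at e
      · obtain ⟨E, hE, rfl⟩ := List.mem_map.1 hβ
        simp [Axm.map] at e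
    · obtain ⟨x, hx, rfl⟩ := List.mem_map.1 hβ
      simp [Axm.map, DI.inst] at e

/-- The function `ask` decides the inconsistency of normality concepts. -/
def AskSpec (F : Fragment K) (O : Set (OtherAxiom K))
    (ask : List (List Letter) × List Letter → Bool) : Prop :=
  ∀ L : List (Axm K (NName K)), F.IsKB (L.map (Axm.map newName)) →
    others (L.map (Axm.map newName)) = O → ∀ C : Concept K ℕ,
      ask (L.map Axm.newCode, encNName (.inr C)) = true ↔
        Entails {β | β ∈ L} (.incl (normal C) .bot)

open Classical in
/-- One round of the iteration, on lists of pairs. -/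
noncomputable def refineList (prec : Priority K) (kb : DKB K) (es : List (Concept K ℕ))
    (T : List (DI K × Concept K ℕ)) : List (DI K × Concept K ℕ) :=
  (allPairs kb es).filter fun x => Overrides prec kb {E | E ∈ es} {y | y ∈ T} x

theorem mem_refineList {prec : Priority K} {T : List (DI K × Concept K ℕ)} :
    {y | y ∈ refineList prec kb es T} = refineStep prec kb {E | E ∈ es} {y | y ∈ T} := by
  ext x
  simp [refineList, mem_allPairs, refineStep, and_assoc]

theorem mem_iterate_refineList {prec : Priority K} (n : ℕ) :
    {y | y ∈ (refineList prec kb es)^[n] []} = (refineStep prec kb {E | E ∈ es})^[n] ∅ := by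
  induction n with
  | zero => simp
  | succ n ih => rw [Function.iterate_succ_apply', Function.iterate_succ_apply', mem_refineList, ih]

theorem iterate_refineList_subset {prec : Priority K} (n : ℕ) :
    ∀ x ∈ (refineList prec kb es)^[n] [], x ∈ allPairs kb es := by
  cases n with
  | zero => simp
  | succ n =>
    rw [Function.iterate_succ_apply']
    exact fun x hx => (List.mem_filter.1 hx).1

theorem map_newCode_axiomsOf (T : List (DI K × Concept K ℕ)) :
    (axiomsOf kb es T).map Axm.newCode =
      (baseAxioms kb es).map Axm.newCode ++ (T.map pairCode).map instCode := by
  rw [axiomsOf, List.map_append, List.map_map, List.map_map]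
  exact congrArg _ (List.map_congr_left fun x _ => (instCode_pairCode x).symm)

/-- A round on encodings mirrors a round on pairs: the relevant codes encode the axioms of the pairs
of higher priority and of `x` itself, and these form a knowledge base on which `ask` is reliable. -/
theorem refineCodes_eq {F : Fragment K} (hF : F.SupportsConj) (hkb : F.IsDKB kb)
    (hes : ∀ E ∈ es, E ∈ F.rhs (others kb.strong) ℕ) {prec : Priority K}
    {ask : List (List Letter) × List Letter → Bool} {higher : List Bool → Bool}
    (hask : AskSpec F (others kb.strong) ask)
    (hhigher : ∀ δ ∈ kb.dis, ∀ δ' ∈ kb.dis,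
      higher (word [kb.enc, δ.enc, δ'.enc]) = true ↔ prec kb δ δ')
    {w : List Bool} (hw : child₀ (letters w) = kb.enc)
    (hb : baseCodes w = (baseAxioms kb es).map Axm.newCode)
    (hp : inputPairs w = (allPairs kb es).map pairCode) {T : List (DI K × Concept K ℕ)}
    (hT : ∀ x ∈ T, x ∈ allPairs kb es) :
    refineCodes ask higher w (T.map pairCode) = (refineList prec kb es T).map pairCode := by
  classical
  rw [refineCodes, hp, List.filter_map, refineList]
  refine congrArg _ (List.filter_congr fun x hx => ?_)
  have hd := (mem_allPairs.1 hx).1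
  have hrel : relevantCodes higher w (T.map pairCode) (pairCode x) =
      (axiomsOf kb es (T.filter (fun y => prec kb y.1 x.1) ++ [x])).map Axm.newCode := by
    have hf : T.filter ((fun y => higher (word [kb.enc, y.1, (pairCode x).1])) ∘ pairCode) =
        T.filter fun y => prec kb y.1 x.1 := by
      refine List.filter_congr fun y hy => ?_
      rw [Bool.eq_iff_iff, decide_eq_true_eq]
      exact hhigher _ (mem_allPairs.1 (hT y hy)).1 _ hd
    rw [map_newCode_axiomsOf, relevantCodes, hb, hw, List.filter_map, hf, List.map_append,
      List.map_append, List.map_singleton, List.map_singleton]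
  have hall : ∀ y ∈ T.filter (fun y => prec kb y.1 x.1) ++ [x], y ∈ allPairs kb es := by
    intro y hy
    rcases List.mem_append.1 hy with h | h
    · exact hT y (List.mem_filter.1 h).1
    · rwa [List.mem_singleton.1 h]
  have := hask _ (isKB_axiomsOf hF hkb hes hall) (others_axiomsOf _) x.2
  rw [Function.comp_apply, Bool.eq_iff_iff, decide_eq_true_eq, Bool.not_eq_true', hrel,
    ← Bool.not_eq_true, Overrides]
  refine not_congr (this.trans (iff_of_eq (congrArg (Entails · _) (Set.ext fun β => ?_))))
  rw [Set.union_assoc]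
  simp only [axiomsOf, Set.mem_ofPred_eq, List.mem_append, mem_baseAxioms, List.map_append,
    List.mem_map, List.mem_filter, decide_eq_true_eq, List.mem_singleton, Set.mem_union,
    Set.mem_singleton_iff, List.map_cons, List.map_nil, and_assoc, eq_comm (b := β)]

theorem image_ofPred_mem {α β : Type} (f : α → β) (l : List α) :
    {b | b ∈ l.map f} = f '' {a | a ∈ l} := by
  ext
  simp

/-- Correctness of the decision procedure, for queries encoded by `s₁` and `s₂`. -/
theorem decideDef_iff {F : Fragment K} (hF : F.SupportsConj) {prec : Priority K}
    (hprec : prec.IsStrictPartialOrder F) (hkb : F.IsDKB kb)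
    {ask : List (List Letter) × List Letter → Bool} {higher entails : List Bool → Bool}
    (hask : AskSpec F (others kb.strong) ask)
    (hhigher : ∀ δ ∈ kb.dis, ∀ δ' ∈ kb.dis,
      higher (word [kb.enc, δ.enc, δ'.enc]) = true ↔ prec kb δ δ')
    {s₁ s₁' s₂ s₂' : List Letter} {N₁ N₂ : Set (Concept K ℕ)} (h₁ : Renames K s₁ s₁' N₁)
    (h₂ : Renames K s₂ s₂' N₂) {α : Axm K (NName K)}
    (hα : {E | Sum.inr E ∈ α.names} = N₁ ∪ N₂) (hN : ∀ E ∈ N₁ ∪ N₂, E ∈ F.rhs (others kb.strong) ℕ)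
    (hentails : ∀ L : List (Axm K (NName K)), F.IsKB (L.map (Axm.map newName)) →
      others (L.map (Axm.map newName)) = others kb.strong →
      (entails (word [encKB encName (L.map (Axm.map newName)), s₁', s₂']) = true ↔
        Entails {β | β ∈ L} α)) :
    decideDef ask higher entails (word [kb.enc, s₁, s₂]) = true ↔ DefEntails prec kb α := by
  have hk := isTree_dkb_parts kb
  have hparts : ∀ s ∈ [kb.enc, s₁, s₂], IsTree s := by
    simpa using ⟨IsTree.node _ _ hk, h₁.isTree, h₂.isTree⟩
  have hl : letters (word [kb.enc, s₁, s₂]) = node [] [kb.enc, s₁, s₂] := letters_flatMap_code _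
  have c₀ := child₀_node (w := []) hparts
  have c₁ := child₁_node (w := []) hparts
  have c₂ := child₂_node (w := []) hparts
  have k₀ : child₀ kb.enc = encKB encName kb.strong := child₀_node hk
  have k₁ : child₁ kb.enc = node [] (kb.dis.map DI.enc) := child₁_node hk
  rw [← hl] at c₀ c₁ c₂
  set w := word [kb.enc, s₁, s₂] with hw
  have hS : inputStrong w = kb.strong.map (Axm.enc encName) := by
    rw [inputStrong, c₀, k₀, encKB, subtrees_node _ _ (isTree_strong _)]
  have hD : inputDIs w = kb.dis.map DI.enc := by
    rw [inputDIs, c₀, k₁, subtrees_node _ _ (isTree_dis _)]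
  obtain ⟨s', hs'⟩ := renames_dis kb.dis
  have hsigma : sigma kb α = {E | ∃ δ ∈ kb.dis, E ∈ δ.normalArgs} ∪ (N₁ ∪ N₂) := by
    rw [← hα]
    rfl
  -- The list of normality concepts found in the input may have repetitions; only its set of
  -- members, which is `Σ`, matters.
  obtain ⟨es, he, hmem⟩ := exists_concepts (l := inputNormals w) (N := sigma kb α) (by
    intro u
    rw [inputNormals, c₀, k₁, c₁, c₂, List.mem_append, List.mem_append, hs'.mem_normals,
      h₁.mem_normals, h₂.mem_normals, hsigma]
    simp only [Set.mem_union, or_and_right, exists_or])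
  have hset : {E | E ∈ es} = sigma kb α := Set.ext hmem
  have hes : ∀ E ∈ es, E ∈ F.rhs (others kb.strong) ℕ := by
    intro E hE
    have := (hmem E).1 hE
    rw [hsigma] at this
    rcases this with ⟨δ, hδ, h | h⟩ | h
    · exact (hkb.pre_mem δ hδ).2 E h
    · exact (hkb.con_mem δ hδ).2 E h
    · exact hN E h
  have hb : baseCodes w = (baseAxioms kb es).map Axm.newCode := by
    rw [baseCodes, baseAxioms, hS, he, List.map_append, List.map_map, List.map_map, List.map_map,
      List.map_map]
    exact congrArg₂ _ (List.map_congr_left fun γ _ => rename_axm γ)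
      (List.map_congr_left fun C _ => normalCode_encNName C)
  have hp : inputPairs w = (allPairs kb es).map pairCode := by
    rw [inputPairs, allPairs, hD, he, List.map_flatMap, List.flatMap_map]
    refine congrArg (List.flatMap · _) (funext fun δ => ?_)
    rw [List.map_map, List.map_map]
    rfl
  have hiter : ∀ n, (refineCodes ask higher w)^[n] [] =
      ((refineList prec kb es)^[n] []).map pairCode := by
    intro n
    induction n with
    | zero => rfl
    | succ n ih =>
      rw [Function.iterate_succ_apply', Function.iterate_succ_apply', ih,
        refineCodes_eq hF hkb hes hask hhigher c₀ hb hp (iterate_refineList_subset n)]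
  rw [decideDef, hiter, hb, hD, List.length_map, ← map_newCode_axiomsOf, c₁, c₂, h₁.rename_eq,
    h₂.rename_eq, defEntails_iff hprec hkb, ← hset, ← mem_iterate_refineList]
  have hiff := hentails (axiomsOf kb es ((refineList prec kb es)^[kb.dis.length] []))
    (isKB_axiomsOf hF hkb hes (iterate_refineList_subset _)) (others_axiomsOf _)
  rw [encKB, List.map_map] at hiff
  refine hiff.trans (iff_of_eq (congrArg (Entails · _) (Set.ext fun β => ?_)))
  simp only [axiomsOf, Set.mem_ofPred_eq, List.mem_append, mem_baseAxioms, List.mem_map,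
    Set.mem_union, eq_comm]

end correct

end DLN

/-! Complexity of the defeasible extension -/

namespace DLN

open OracleTime

variable {K : Constructors}

theorem newName_notMem_range_zero : 0 ∉ Set.range (newName (K := K)) := by
  rintro ⟨x, hx⟩
  exact newName_ne_zero x hx

theorem map_newCode (L : List (Axm K (NName K))) :
    L.map Axm.newCode = (L.map (Axm.map newName)).map (Axm.enc encName) := by
  rw [List.map_map]
  rfl

theorem askSpec_askSubsumption {F : Fragment K} {L₀ : Language Bool}
    (h : ∀ (S : List (Axm K ℕ)) (C D : Concept K ℕ), F.IsKB S → C ∈ F.lhs (others S) ℕ →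
      D ∈ F.rhs (others S) ℕ →
      (word [encKB encName S, C.enc encName, D.enc encName] ∈ L₀ ↔
        Entails {β | β ∈ S} (.incl C D)))
    (O : Set (OtherAxiom K)) : AskSpec F O (askSubsumption (char L₀)) := by
  intro L hL _ C
  rw [normal, ← entails_incl_new_name newName_injective _ _ newName_notMem_range_zero,
    ← image_ofPred_mem, ← h _ _ _ hL (F.name_mem_lhs _ _ _) (F.name_mem_rhs _ _ _),
    ← char_eq_true, askSubsumption, map_newCode, ← encName_newName]
  rfl

/-- A nonempty word consisting of `true` only has no leading zeros and is thus the numeral of some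
number. -/
theorem exists_encNat_eq_newIndividual (c : List (List Letter)) :
    ∃ a : ℕ, newIndividual c = encNat a := by
  obtain ⟨n, hn⟩ : ∃ n, (node [] c).map (fun _ => true) = List.replicate n true ++ [true] := by
    refine ⟨((node [] c).length - 1), ?_⟩
    rw [List.map_const', ← List.replicate_succ', Nat.sub_add_cancel]
    simp [node]
  exact ⟨ofDigits (List.replicate n true ++ [true]), by
    rw [encNat, bits_ofDigits, newIndividual, hn]⟩

theorem length_lt_newIndividual {c : List (List Letter)} {s : List Letter} (h : s ∈ c) :
    s.length < (newIndividual c).length := by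
  have : ∀ w : List Bool, w.length ≤ (leaf w).length := fun w => by
    simp only [leaf, node, List.length_append, List.length_cons, List.length_map]
    omega
  exact (length_lt_node (w := []) h).trans_le ((List.length_map _).symm.le.trans (this _))

/-- The individual `a` is new because its numeral is longer than the encoding of any axiom. The
assertions `N C(a)` and `A(a)` are legal as soon as any concept is admitted in assertions. -/
theorem askSpec_askInstance {F : Fragment K} {L₀ : Language Bool}
    (h : ∀ (S : List (Axm K ℕ)) (C : Concept K ℕ) (a : ℕ), F.IsKB S → C ∈ F.asr (others S) ℕ →
      (word [encKB encName S, C.enc encName, encNat a] ∈ L₀ ↔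
        Entails {β | β ∈ S} (.assert C a)))
    {O : Set (OtherAxiom K)} (hO : (F.asr O ℕ).Nonempty) :
    AskSpec F O (askInstance (char L₀)) := by
  intro L hL hLO C
  obtain ⟨a, ha⟩ := exists_encNat_eq_newIndividual (L.map Axm.newCode)
  have hav : ∀ β ∈ Axm.map newName '' {β | β ∈ L}, β.Avoids a := by
    rintro _ ⟨β, hβ, rfl⟩
    refine Axm.avoids_of_length ?_
    rw [← ha]
    exact length_lt_newIndividual (List.mem_map_of_mem (f := Axm.newCode) hβ)
  have hoth : others (L.map (Axm.map newName) ++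
      [Axm.assert (.name (newName (.inr C : NName K))) a]) = O := by
    rw [← hLO]
    ext o
    simp [others]
  have hKB : F.IsKB (L.map (Axm.map newName) ++
      [Axm.assert (.name (newName (.inr C : NName K))) a]) := by
    refine ⟨by rw [hoth, ← hLO]; exact hL.others_mem, fun D E hDE => ?_, fun D b hD => ?_⟩
    · rw [hoth, ← hLO]
      exact hL.incl_mem D E (by simpa using hDE)
    · rw [hoth]
      rcases List.mem_append.1 hD with hD | hD
      · rw [← hLO]
        exact hL.assert_mem D b hD
      · obtain ⟨rfl, rfl⟩ := Axm.assert.inj (List.mem_singleton.1 hD)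
        exact F.name_mem_asr _ _ hO _
  have hset : {β | β ∈ L.map (Axm.map newName) ++
      [Axm.assert (.name (newName (.inr C : NName K))) a]} =
      Axm.map newName '' {β | β ∈ L} ∪ {.assert (.name (newName (.inr C : NName K))) a} := by
    rw [← image_ofPred_mem]
    ext
    simp only [List.mem_append, List.mem_singleton, Set.mem_ofPred_eq, Set.mem_union,
      Set.mem_singleton_iff]
  rw [normal, ← entails_assert_new_name newName_injective _ _ newName_notMem_range_zero hav, ← hset,
    ← h _ _ _ hKB (by rw [hoth]; exact F.name_mem_asr _ _ hO _), ← char_eq_true, askInstance, ha,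
    map_newCode, ← encName_newName, encKB, List.map_append]
  rfl

/-- Defeasible subsumption is decided in polynomial time relative to an oracle which decides
subsumption and priorities in polynomial time. -/
theorem defSubsumptionIn_of_polyTime {F : Fragment K} (hF : F.SupportsConj) {prec : Priority K}
    (hprec : prec.IsStrictPartialOrder F) {O Ls Lp : Language Bool} (hs : PolyTime O (char Ls))
    (hp : PolyTime O (char Lp)) (hsub : SubsumptionIn F {Ls}) (hpri : PriorityIn F prec {Lp}) :
    DefSubsumptionIn F prec (PRel O) := by
  obtain ⟨_, rfl, hsub⟩ := hsub
  obtain ⟨_, rfl, hpri⟩ := hpri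
  have hspec (S : List (Axm K ℕ)) (C D : Concept K ℕ) (hS : F.IsKB S)
      (hC : C ∈ F.lhs (others S) ℕ) (hD : D ∈ F.rhs (others S) ℕ) := hsub (S, C, D) ⟨hS, hC, hD⟩
  refine ⟨{w | decideDef (askSubsumption (char _)) (char _) (char _) w = true},
    (polyTime_decideDef (polyTime_askSubsumption hs) hp hs).mem_PRel fun w => Iff.rfl, ?_⟩
  rintro ⟨kb, C, D⟩ ⟨hkb, ⟨hC, hNC⟩, hD, hND⟩
  refine decideDef_iff hF hprec hkb (askSpec_askSubsumption hspec _)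
    (fun δ hδ δ' hδ' => char_eq_true.trans (hpri (kb, δ, δ') ⟨hkb, hδ, hδ'⟩))
    (renames_concept C) (renames_concept D) (α := .incl C D) rfl ?_ fun L hL hLO => ?_
  · rintro E (hE | hE)
    · exact hNC E hE
    · exact hND E hE
  · refine char_eq_true.trans ((hspec _ _ _ hL ?_ ?_).trans ?_)
    · rw [hLO]
      exact (F.map_mem_lhs _ _ _ _ newName_injective _).2 hC
    · rw [hLO]
      exact (F.map_mem_rhs _ _ _ _ newName_injective _).2 hD
    · have := entails_map newName_injective {β | β ∈ L} (.incl C D)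
      rwa [← image_ofPred_mem] at this

/-- Defeasible instance checking is decided in polynomial time relative to an oracle which decides
instance checking and priorities in polynomial time. -/
theorem defInstanceIn_of_polyTime {F : Fragment K} (hF : F.SupportsConj) {prec : Priority K}
    (hprec : prec.IsStrictPartialOrder F) {O Ls Lp : Language Bool} (hs : PolyTime O (char Ls))
    (hp : PolyTime O (char Lp)) (hins : InstanceIn F {Ls}) (hpri : PriorityIn F prec {Lp}) :
    DefInstanceIn F prec (PRel O) := by
  obtain ⟨_, rfl, hins⟩ := hins
  obtain ⟨_, rfl, hpri⟩ := hpri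
  have hspec (S : List (Axm K ℕ)) (C : Concept K ℕ) (a : ℕ) (hS : F.IsKB S)
      (hC : C ∈ F.asr (others S) ℕ) := hins (S, C, a) ⟨hS, hC⟩
  refine ⟨{w | decideDef (askInstance (char _)) (char _) (char _) w = true},
    (polyTime_decideDef (polyTime_askInstance hs) hp hs).mem_PRel fun w => Iff.rfl, ?_⟩
  rintro ⟨kb, C, a⟩ ⟨hkb, hC, hNC⟩
  have hC' : C.map newName ∈ F.asr (others kb.strong) ℕ :=
    (F.map_mem_asr _ _ _ _ newName_injective _).2 hC
  -- The renamed query concept witnesses that some concept is admitted in assertions.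
  refine decideDef_iff hF hprec hkb (askSpec_askInstance hspec ⟨_, hC'⟩)
    (fun δ hδ δ' hδ' => char_eq_true.trans (hpri (kb, δ, δ') ⟨hkb, hδ, hδ'⟩))
    (renames_concept C) (.encNat a) (α := .assert C a) (Set.union_empty _).symm ?_
    fun L hL hLO => ?_
  · rintro E (hE | hE)
    · exact hNC E hE
    · exact hE.elim
  · refine char_eq_true.trans ((hspec _ _ _ hL (hLO ▸ hC')).trans ?_)
    have := entails_map newName_injective {β | β ∈ L} (.assert C a)
    rwa [← image_ofPred_mem] at this

end DLN

/-! ### The theorem, by merging oracles -/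

theorem OracleTime.ProblemIn.exists_language {α : Type} {𝒞 : Set (Language Bool)}
    {enc : α → List Bool} {isInstance yes : α → Prop} (h : ProblemIn 𝒞 enc isInstance yes) :
    ∃ L ∈ 𝒞, ProblemIn {L} enc isInstance yes :=
  h.imp fun L hL => ⟨hL.1, L, rfl, hL.2⟩

theorem OracleTime.ProblemIn.mono {α : Type} {𝒞 𝒞' : Set (Language Bool)}
    {enc : α → List Bool} {isInstance yes : α → Prop} (h : ProblemIn 𝒞 enc isInstance yes)
    (hle : 𝒞 ⊆ 𝒞') : ProblemIn 𝒞' enc isInstance yes :=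
  h.imp fun _ hL => ⟨hle hL.1, hL.2⟩

open OracleTime DLN in
/-- Over a directed class, a language of the class and a language decided relative to the class are
both decided in polynomial time relative to a single member of the class. -/
theorem DLN.IsDirected.exists_oracle {𝒞 : Set (Language Bool)} (h𝒞 : IsDirected 𝒞)
    {Ls Lp : Language Bool} (hs : Ls ∈ 𝒞) (hp : Lp ∈ PClass 𝒞) :
    ∃ D ∈ 𝒞, PolyTime D (char Ls) ∧ PolyTime D (char Lp) := by
  obtain ⟨A, hA, hpA⟩ := hp
  -- Directedness is applied to `Ls` and the oracle `A` behind `Lp`, since `Lp` itself need not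
  -- belong to `𝒞`; two substitutions then lead from `D` to `Lp`.
  obtain ⟨D, hD, hsD, hAD⟩ := h𝒞 _ hs _ hA
  exact ⟨D, hD, (PolyTime.oracle D).char_of_mem_PRel hsD,
    ((PolyTime.oracle D).char_of_mem_PRel hAD).char_of_mem_PRel hpA⟩

theorem theorem1 (K : DLN.Constructors) (F : DLN.Fragment K) (hF : F.SupportsConj)
    (prec : DLN.Priority K) (hprec : prec.IsStrictPartialOrder F) :
    (∀ 𝒞 : Set (Language Bool), DLN.IsDirected 𝒞 →
      DLN.PriorityIn F prec (OracleTime.PClass 𝒞) →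
        (DLN.SubsumptionIn F 𝒞 → DLN.DefSubsumptionIn F prec (OracleTime.PClass 𝒞)) ∧
        (DLN.InstanceIn F 𝒞 → DLN.DefInstanceIn F prec (OracleTime.PClass 𝒞))) ∧
    (DLN.PriorityIn F prec OracleTime.PTime →
        (DLN.SubsumptionIn F OracleTime.PTime → DLN.DefSubsumptionIn F prec OracleTime.PTime) ∧
        (DLN.InstanceIn F OracleTime.PTime → DLN.DefInstanceIn F prec OracleTime.PTime)) := by
  refine ⟨fun 𝒞 h𝒞 hp => ⟨fun hs => ?_, fun hs => ?_⟩, fun hp => ⟨fun hs => ?_, fun hs => ?_⟩⟩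
  all_goals
    obtain ⟨Lp, hLp, hp⟩ := hp.exists_language
    obtain ⟨Ls, hLs, hs⟩ := hs.exists_language
  · obtain ⟨D, hD, h₁, h₂⟩ := h𝒞.exists_oracle hLs hLp
    exact (DLN.defSubsumptionIn_of_polyTime hF hprec h₁ h₂ hs hp).mono fun L hL => ⟨D, hD, hL⟩
  · obtain ⟨D, hD, h₁, h₂⟩ := h𝒞.exists_oracle hLs hLp
    exact (DLN.defInstanceIn_of_polyTime hF hprec h₁ h₂ hs hp).mono fun L hL => ⟨D, hD, hL⟩
  -- For `P` the empty oracle serves throughout: both decision procedures are run as subroutines,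
  -- which also shows that `P` relative to languages of `P` gives nothing more.
  · exact DLN.defSubsumptionIn_of_polyTime hF hprec
      ((OracleTime.PolyTime.oracle 0).char_of_mem_PRel hLs)
      ((OracleTime.PolyTime.oracle 0).char_of_mem_PRel hLp) hs hp
  · exact DLN.defInstanceIn_of_polyTime hF hprec
      ((OracleTime.PolyTime.oracle 0).char_of_mem_PRel hLs)
      ((OracleTime.PolyTime.oracle 0).char_of_mem_PRel hLp) hs hp
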